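/- **Conventions.** Inner products $(\cdot\mid\cdot)$ on complex Hilbert spaces are linear in the first variable. "Smooth" is meant for real, "holomorphic" for complex Banach manifolds (holomorphic maps are in particular smooth). All $C^*$-algebras are complex and unital. **Like-Hermitian bundles.** Let $Z$ be a real Banach manifold with an involutive diffeomorphism $z\mapsto z^{-*}$. A *like-Hermitian bundle* over $Z$ is a smooth vector bundle $\Pi\colon D\to Z$ whose typical fibre is a complex Banach space, with sesquilinear continuous pairings $(\cdot\mid\cdot)_{z,z^{-*}}\colon D_z\times D_{z^{-*}}\to\mathbb C$ ($z\in Z$) which are strong dualities (the maps $D_z\to\overline{D_{z^{-*}}}{}^{\,*}$ and $\overline{D_{z^{-*}}}\to D_z^{*}$ induced by the pairing are isomorphisms), satisfy $\overline{(\xi\mid\eta)_{z,z^{-*}}}=(\eta\mid\xi)_{z^{-*},z}$, and depend smoothly on $z$ in local trivializations. A morphism $\Theta=(\delta,\zeta)$ from $\widetilde\Pi$ to $\Pi$ consists of smooth maps $\delta\colon\widetilde D\to D$, $\zeta\colon\widetilde Z\to Z$ such that $\delta$ maps $\widetilde D_z$ into $D_{\zeta(z)}$ by a bounded linear operator and $\zeta(z^{-*})=\zeta(z)^{-*}$.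 **$\mathbf{Kern}$.** An object is a *reproducing $(-*)$-kernel* on a like-Hermitian bundle: a family of bounded linear operators $K(s,t)\colon D_t\to D_s$ ($s,t\in Z$) with $\sum_{l,j=1}^n(K(t_l,t_j^{-*})\eta_j\mid\eta_l)_{t_l,t_l^{-*}}\ge0$ for all $n$, $t_j\in Z$, $\eta_j\in D_{t_j^{-*}}$. A morphism $\widetilde K\to K$ is a morphism $\Theta=(\delta,\zeta)$ of the bundles such that, for some constant $M>0$, $$\sum_{l,j=1}^n\bigl(K(\zeta(s_l)^{-*},\zeta(s_j))\delta(\xi_j)\mid\delta(\xi_l)\bigr)_{\zeta(s_l)^{-*},\zeta(s_l)}\le M\sum_{l,j=1}^n\bigl(\widetilde K(s_l^{-*},s_j)\xi_j\mid\xi_l\bigr)_{s_l^{-*},s_l}$$ for all $n$, $s_j\in\widetilde Z$ and $\xi_j\in\widetilde D_{s_j}$. **Groups.** An *involutive group* is a complex Banach-Lie group $G$ with a smooth antimultiplicative involution $u\mapsto u^*$; put $u^{-*}=(u^{-1})^*$. Homomorphisms of involutive groups are holomorphic group homomorphisms preserving the involutions. A holomorphic $*$-representation of $G$ on a Hilbert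 space $\mathcal H$ is a holomorphic map $\pi\colon G\to\mathcal B(\mathcal H)$ with $\pi(1)=1$, $\pi(uv)=\pi(u)\pi(v)$, $\pi(u^*)=\pi(u)^*$. **$\mathbf{Trans}$.** An object is a *transfer mapping* $\mathcal R\colon D\to\mathcal H$, given together with: a holomorphic vector bundle $\Pi\colon D\to Z$ over a complex Banach manifold whose underlying real bundle is like-Hermitian; an involutive group $G$; holomorphic actions $\nu\colon G\times Z\to Z$ and $\mu\colon G\times D\to D$ such that $\mu(u,\cdot)$ maps $D_z$ into $D_{\nu(u,z)}$ by a bounded linear operator, $\nu(u^{-*},z^{-*})=\nu(u,z)^{-*}$, and $(\mu(u^*,\eta)\mid\xi)_{z^{-*},z}=(\eta\mid\mu(u,\xi))_{\nu(u,z)^{-*},\nu(u,z)}$ for $\xi\in D_z$, $\eta\in D_{\nu(u^{-*},z^{-*})}$; and a holomorphic $*$-representation $\pi$ of $G$ on a Hilbert space $\mathcal H$. The map $\mathcal R$ is holomorphic, its restrictions $\mathcal R_z=\mathcal R|_{D_z}\colon D_z\to\mathcal H$ are injective bounded linear operators, $(\xi\mid\eta)_{z,z^{-*}}=(\mathcal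 R\xi\mid\mathcal R\eta)_{\mathcal H}$ for $\xi\in D_z$, $\eta\in D_{z^{-*}}$, and $\mathcal R(\mu(u,\xi))=\pi(u)\mathcal R(\xi)$. A morphism $\widetilde{\mathcal R}\to\mathcal R$ is a triple $(\Theta;\alpha,L)$ with $\Theta=(\delta,\zeta)$ a morphism of the like-Hermitian bundles, $\alpha\colon\widetilde G\to G$ a homomorphism of involutive groups and $L\colon\widetilde{\mathcal H}\to\mathcal H$ bounded linear, such that $\zeta(\tilde\nu(u,z))=\nu(\alpha(u),\zeta(z))$, $\delta(\tilde\mu(u,\xi))=\mu(\alpha(u),\delta(\xi))$, $\pi(\alpha(u))L=L\tilde\pi(u)$, $\mathcal R\circ\delta=L\circ\widetilde{\mathcal R}$ and, for some $M>0$, $$\sum_{l,j=1}^n\bigl(L\widetilde{\mathcal R}(\xi_l)\mid L\widetilde{\mathcal R}(\xi_j)\bigr)_{\mathcal H}\le M\sum_{l,j=1}^n\bigl(\widetilde{\mathcal R}(\xi_j)\mid\widetilde{\mathcal R}(\xi_l)\bigr)_{\widetilde{\mathcal H}}$$ for all $n$ and $\xi_1,\dots,\xi_n\in\widetilde D$.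 **$\mathbf{sRep}$.** An object $\pi_A$ is a holomorphic $*$-representation $\pi_A$ of an involutive group $G_A$ on a Hilbert space $\mathcal H_A$, given together with a complex Banach-Lie subgroup (that is, split complex submanifold) $G_B\subseteq G_A$ stable under the involution and a closed subspace $\mathcal H_B\subseteq\mathcal H_A$ with $\pi_A(u)\mathcal H_B\subseteq\mathcal H_B$ for $u\in G_B$; $\pi_B$ denotes the representation of $G_B$ on $\mathcal H_B$ by restriction of $\pi_A$. A morphism $\tilde\pi_A\to\pi_A$ is a pair $(\alpha,L)$ with $\alpha\colon\widetilde G_A\to G_A$ a homomorphism of involutive groups, $\alpha(\widetilde G_B)\subseteq G_B$, and $L\colon\widetilde{\mathcal H}_A\to\mathcal H_A$ bounded linear, $L\tilde\pi_A(u)=\pi_A(\alpha(u))L$, $L(\widetilde{\mathcal H}_B)\subseteq\mathcal H_B$, such that for some $M>0$ $$\sum_{l,j=1}^n\bigl(\pi_A(\alpha(u_l))Lh_l\mid\pi_A(\alpha(u_j))Lh_j\bigr)_{\mathcal H_A}\le M\sum_{l,j=1}^n\bigl(\tilde\pi_A(u_l)h_l\mid\tilde\pi_A(u_j)h_j\bigr)_{\widetilde{\mathcal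 H}_A}$$ for all $n$, $u_j\in\widetilde G_A$, $h_j\in\widetilde{\mathcal H}_A$. **$\mathbf{CPos}$.** An object is a unital completely positive map $\Phi\colon A\to\mathcal B(\mathcal H_0)$, with $A$ a $C^*$-algebra and $\mathcal H_0$ a Hilbert space, given together with a unital $C^*$-subalgebra $B\subseteq A$ and a conditional expectation $E\colon A\to B$ (an idempotent bounded linear map of norm $1$ with range $B$) such that $\Phi\circ E=\Phi$. A morphism $\widetilde\Phi\to\Phi$ is a pair $(\alpha,T)$ with $\alpha\colon\widetilde A\to A$ a unital $*$-homomorphism and $T\colon\widetilde{\mathcal H}_0\to\mathcal H_0$ bounded linear, such that $\alpha\circ\widetilde E=E\circ\alpha$ on $\widetilde B$, $\Phi(\alpha(b))T=T\widetilde\Phi(b)$ for $b\in\widetilde B$ and, for some $M>0$, $$\sum_{l,j=1}^n\bigl(\Phi(\alpha(a_{lj}))Th_j\mid Th_l\bigr)_{\mathcal H_0}\le M\sum_{l,j=1}^n\bigl(\widetilde\Phi(a_{lj})h_j\mid h_l\bigr)_{\widetilde{\mathcal H}_0}$$ for all $n$, all positive $(a_{lj})\in M_n(\widetilde A)$ and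 all $h_1,\dots,h_n\in\widetilde{\mathcal H}_0$. In all four categories morphisms are composed componentwise. **Stinespring dilation.** For an object $\Phi$ of $\mathbf{CPos}$, let $\mathcal H_A$ be the Hilbert space completion of $A\otimes\mathcal H_0$ (modulo null vectors) for the semi-inner product with $(b\otimes\eta\mid a\otimes\xi)=(\Phi(a^*b)\eta\mid\xi)_{\mathcal H_0}$; let $\mathcal H_B$ be the closure of the image of $B\otimes\mathcal H_0$; let $G_A$, $G_B$ be the groups of invertible elements of $A$, $B$; and let $\pi_A(u)$ ($u\in G_A$) be the continuous extension of $b\otimes\eta\mapsto ub\otimes\eta$. **Homogeneous bundle.** For an object $\pi_A$ of $\mathbf{sRep}$, let $D=G_A\times_{G_B}\mathcal H_B$ be the quotient of $G_A\times\mathcal H_B$ by the relation $(u,f)\sim(uw,\pi_B(w^{-1})f)$, $w\in G_B$, with projection $[(u,f)]\mapsto uG_B$ onto $Z=G_A/G_B$, involution $(uG_B)^{-*}=u^{-*}G_B$, actions $v\cdot uG_B=vuG_B$, $v\cdot[(u,f)]=[(vu,f)]$ of $G_A$ ($v\in G_A$), and pairings $([(u,f)]\mid[(v,g)])_{z,z^{-*}}=(\pi_A(u)f\mid\pi_A(v)g)_{\mathcal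 H_A}$ for $z=uG_B$, $z^{-*}=vG_B$. The linear structure and topology of the fibre over $uG_B$ are those for which $f\mapsto[(u,f)]$ is an isomorphism from $\mathcal H_B$. **Proposition.** The following correspondences are well defined and are functors. (i) $\mathbf{CPos}\to\mathbf{sRep}$, $\Phi\mapsto\pi_A$ (the Stinespring dilation of $\Phi$, with $G_A,G_B,\mathcal H_A,\mathcal H_B$ as above), $(\alpha,T)\mapsto(\alpha|_{\widetilde G_A},\alpha\otimes T)$, where $\alpha\otimes T\colon\widetilde{\mathcal H}_A\to\mathcal H_A$ is the continuous extension of $a\otimes\xi\mapsto\alpha(a)\otimes T\xi$. (ii) $\mathbf{sRep}\to\mathbf{Trans}$, $\pi_A\mapsto\mathcal R^{\pi}$, where $\mathcal R^\pi\colon G_A\times_{G_B}\mathcal H_B\to\mathcal H_A$, $\mathcal R^\pi([(u,f)])=\pi_A(u)f$, and $(\alpha,L)\mapsto(\Theta;\alpha,L)$ with $\Theta=(\delta,\zeta)$, $\delta([(u,f)])=[(\alpha(u),Lf)]$, $\zeta(u\widetilde G_B)=\alpha(u)G_B$. Here $G_A/G_B$ and $G_A\times_{G_B}\mathcal H_B$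 carry quotient complex structures, for which the quotient maps from $G_A$ and from $G_A\times\mathcal H_B$ are holomorphic submersions; that these structures exist and make $\mathcal R^\pi$ an object of $\mathbf{Trans}$ is part of the assertion. (iii) $\mathbf{Trans}\to\mathbf{Kern}$, $\mathcal R\mapsto K^{\mathcal R}$, $K^{\mathcal R}(s,t)=(\mathcal R_{s^{-*}})^{-*}\circ\mathcal R_t$ for $s,t\in Z$, and $(\Theta;\alpha,L)\mapsto\Theta$. Here $(\mathcal R_{s^{-*}})^{-*}\colon\mathcal H\to D_s$ is the bounded linear operator with $\bigl((\mathcal R_{s^{-*}})^{-*}h\mid\xi\bigr)_{s,s^{-*}}=(h\mid\mathcal R_{s^{-*}}\xi)_{\mathcal H}$ for $h\in\mathcal H$, $\xi\in D_{s^{-*}}$, so that $\bigl(K^{\mathcal R}(s,t)\eta\mid\xi\bigr)_{s,s^{-*}}=(\mathcal R_t\eta\mid\mathcal R_{s^{-*}}\xi)_{\mathcal H}$ for $\eta\in D_t$, $\xi\in D_{s^{-*}}$. -/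

import Mathlib

open CategoryTheory Bundle UniformSpace
open scoped Manifold ContDiff ComplexOrder TensorProduct InnerProductSpace

universe u

noncomputable section

namespace PosKernel

/-! ### Functors given by a prescribed correspondence -/

/-- `obj` on objects together with the specification `spec` on morphisms defines a functor
`C ⥤ D`: there is a functor whose object map is `obj` and each of whose values on morphisms
satisfies the specification. -/
def DefinesFunctor {C D : Type*} [Category C] [Category D] (obj : C → D)
    (spec : ∀ {X Y : C}, (X ⟶ Y) → (obj X ⟶ obj Y) → Prop) : Prop :=
  ∃ (F : C ⥤ D) (map : ∀ {X Y : C}, (X ⟶ Y) → (obj X ⟶ obj Y)),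
    F.toPrefunctor = ⟨obj, map⟩ ∧ ∀ {X Y : C} (f : X ⟶ Y), spec f (map f)

/-! ### Like-Hermitian vector bundles -/

section RestrictScalars

variable {B F : Type*} {E : B → Type*} [NormedAddCommGroup F] [NormedSpace ℂ F]
  [∀ b, AddCommGroup (E b)] [∀ b, Module ℂ (E b)] [∀ b, TopologicalSpace (E b)]
  [TopologicalSpace B] [TopologicalSpace (TotalSpace F E)] [FiberBundle F E]

/-- A complex vector bundle is a real vector bundle. -/
instance vectorBundleReal [VectorBundle ℂ F E] : VectorBundle ℝ F E := by
  have key : ∀ (e : Trivialization F (π F E)) [MemTrivializationAtlas e], e.IsLinear ℝ := by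
    intro e _
    refine ⟨fun b hb => ?_⟩
    have h := Trivialization.IsLinear.linear (R := ℂ) (e := e) b hb
    refine ⟨h.map_add, fun c x => ?_⟩
    have := h.map_smul (c : ℂ) x
    simpa using this
  refine ⟨key, fun e e' _ _ => ?_⟩
  have := key e
  have := key e'
  have h := VectorBundle.continuousOn_coordChange' (R := ℂ) e e'
  have h2 : Continuous (fun f : F →L[ℂ] F => f.restrictScalars ℝ) :=
    (ContinuousLinearMap.restrictScalarsL ℂ F F ℝ ℝ).continuous
  refine (h2.comp_continuousOn h).congr fun b hb => ?_
  ext y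
  simp [Trivialization.coordChangeL_apply (R := ℝ) e e' hb,
    Trivialization.coordChangeL_apply (R := ℂ) e e' hb]

end RestrictScalars

/-- A family of complex topological vector spaces `E z` (the fibres) over a set `Z` with a
self-map `z ↦ z^{-*}` (here `inv`), a complex Banach space `F` (the typical fibre) and sesquilinear
pairings `(· ∣ ·)_{z, z^{-*}} : E z × E (z^{-*}) → ℂ`, linear in the first and antilinear in the
second variable.  The second base point `w` is kept as a variable subject to `w = z^{-*}`. -/
structure PairedFamily where
  Z : Type u
  inv : Z → Z
  F : Type u
  [normF : NormedAddCommGroup F]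
  [spaceF : NormedSpace ℂ F]
  [completeF : CompleteSpace F]
  E : Z → Type u
  [addE : ∀ z, AddCommGroup (E z)]
  [moduleE : ∀ z, Module ℂ (E z)]
  [topE : ∀ z, TopologicalSpace (E z)]
  pairing : ∀ {z w : Z}, w = inv z → (E z →ₗ[ℂ] E w →ₗ⋆[ℂ] ℂ)

attribute [instance] PairedFamily.normF PairedFamily.spaceF PairedFamily.completeF
  PairedFamily.addE PairedFamily.moduleE PairedFamily.topE

/-- The total space `D` of the bundle. -/
abbrev PairedFamily.D (X : PairedFamily.{u}) : Type u := TotalSpace X.F X.E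

/-- The base `Z` is a real Banach manifold modelled on `M` with involutive diffeomorphism `inv`, the
family of fibres is a smooth vector bundle with complex typical fibre over `Z`, and the pairings
form a like-Hermitian structure on it. -/
structure IsLikeHermitian (X : PairedFamily.{u}) (M : Type u) [NormedAddCommGroup M]
    [NormedSpace ℝ M] [TopologicalSpace X.Z] [ChartedSpace M X.Z] [TopologicalSpace X.D]
    [FiberBundle X.F X.E] : Prop where
  isManifold : IsManifold 𝓘(ℝ, M) ∞ X.Z
  vectorBundle : VectorBundle ℂ X.F X.E
  smoothBundle : ContMDiffVectorBundle ∞ X.F X.E 𝓘(ℝ, M)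
  inv_inv : ∀ z, X.inv (X.inv z) = z
  smooth_inv : ContMDiff 𝓘(ℝ, M) 𝓘(ℝ, M) ∞ X.inv
  /-- The pairings are continuous, -/
  continuous_pairing : ∀ {z w : X.Z} (h : w = X.inv z),
    Continuous fun p : X.E z × X.E w => X.pairing h p.1 p.2
  /-- and the induced continuous linear map from `E z` to the Banach space of continuous antilinear
  functionals on `E (z^{-*})` is bijective (hence an isomorphism by the open mapping theorem), -/
  exists_unique_left : ∀ {z w : X.Z} (h : w = X.inv z) (φ : X.E w →L⋆[ℂ] ℂ),
    ∃! ξ : X.E z, ∀ η, X.pairing h ξ η = φ η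
  /-- and likewise the one from the conjugate of `E (z^{-*})` to the dual of `E z`. -/
  exists_unique_right : ∀ {z w : X.Z} (h : w = X.inv z) (φ : X.E z →L[ℂ] ℂ),
    ∃! η : X.E w, ∀ ξ, X.pairing h ξ η = φ ξ
  conj_pairing : ∀ {z w : X.Z} (h : w = X.inv z) (h' : z = X.inv w) (ξ : X.E z) (η : X.E w),
    star (X.pairing h ξ η) = X.pairing h' η ξ
  /-- The pairing is smooth when read in trivializations `e` near `z` and `e'` near `z^{-*}`. -/
  smooth_pairing : ∀ (e e' : Trivialization X.F (π X.F X.E)) [MemTrivializationAtlas e]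
    [MemTrivializationAtlas e'],
    ContMDiffOn (𝓘(ℝ, M).prod 𝓘(ℝ, X.F × X.F)) 𝓘(ℝ, ℂ) ∞
      (fun p : X.Z × (X.F × X.F) =>
        X.pairing (rfl : X.inv p.1 = X.inv p.1) (e.symm p.1 p.2.1) (e'.symm (X.inv p.1) p.2.2))
      ((e.baseSet ∩ X.inv ⁻¹' e'.baseSet) ×ˢ Set.univ)

/-- A (smooth) like-Hermitian vector bundle. -/
structure LHer where
  fam : PairedFamily.{u}
  M : Type u
  [normM : NormedAddCommGroup M]
  [spaceM : NormedSpace ℝ M]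
  [completeM : CompleteSpace M]
  [topZ : TopologicalSpace fam.Z]
  [chartedZ : ChartedSpace M fam.Z]
  [topD : TopologicalSpace fam.D]
  [fiberBundle : FiberBundle fam.F fam.E]
  isLikeHermitian : IsLikeHermitian fam M

attribute [instance] LHer.normM LHer.spaceM LHer.completeM LHer.topZ LHer.chartedZ LHer.topD
  LHer.fiberBundle

/-- The map between total spaces induced by fibrewise maps over a map of base spaces. -/
def totalMap {X Y : PairedFamily.{u}} (ζ : X.Z → Y.Z) (δ : ∀ z, X.E z →L[ℂ] Y.E (ζ z)) :
    X.D → Y.D :=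
  fun ξ => ⟨ζ ξ.proj, δ ξ.proj ξ.snd⟩

/-- A morphism `Θ = (δ, ζ)` of like-Hermitian vector bundles; `δ` is given by its restrictions
`δ_z : E z → E (ζ z)` to the fibres, which are bounded linear operators. -/
@[ext]
structure LHer.Hom (X Y : LHer.{u}) where
  ζ : X.fam.Z → Y.fam.Z
  δ : ∀ z, X.fam.E z →L[ℂ] Y.fam.E (ζ z)
  smooth_ζ : ContMDiff 𝓘(ℝ, X.M) 𝓘(ℝ, Y.M) ∞ ζ
  smooth_δ : ContMDiff (𝓘(ℝ, X.M).prod 𝓘(ℝ, X.fam.F)) (𝓘(ℝ, Y.M).prod 𝓘(ℝ, Y.fam.F)) ∞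
    (totalMap ζ δ)
  ζ_inv : ∀ z, ζ (X.fam.inv z) = Y.fam.inv (ζ z)

/-- The map `δ : D̃ → D` of a morphism of like-Hermitian bundles. -/
def LHer.Hom.tot {X Y : LHer.{u}} (Θ : LHer.Hom X Y) : X.fam.D → Y.fam.D := totalMap Θ.ζ Θ.δ

instance : Category LHer.{u} where
  Hom := LHer.Hom
  id X :=
    { ζ := id
      δ := fun _ => ContinuousLinearMap.id ℂ _
      smooth_ζ := contMDiff_id
      smooth_δ := contMDiff_id
      ζ_inv := fun _ => rfl }
  comp f g :=
    { ζ := g.ζ ∘ f.ζ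
      δ := fun z => (g.δ (f.ζ z)).comp (f.δ z)
      smooth_ζ := g.smooth_ζ.comp f.smooth_ζ
      smooth_δ := g.smooth_δ.comp f.smooth_δ
      ζ_inv := fun z => by simp [f.ζ_inv, g.ζ_inv] }

/-! ### Reproducing `(-*)`-kernels -/

/-- The sum over `l, j` of `(K(s_l^{-*}, s_j) ξ_j ∣ ξ_l)_{s_l^{-*}, s_l}` for vectors `ξ_j` in the
fibres over the points `s_j`. -/
def LHer.kernelSum (X : LHer.{u}) (K : ∀ s t, X.fam.E t →L[ℂ] X.fam.E s) {n : ℕ}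
    (s : Fin n → X.fam.Z) (ξ : ∀ j, X.fam.E (s j)) : ℂ :=
  ∑ l, ∑ j, X.fam.pairing (X.isLikeHermitian.inv_inv (s l)).symm
    (K (X.fam.inv (s l)) (s j) (ξ j)) (ξ l)

/-- `(-*)`-positive definiteness of a section `K` of `Hom(p₂^*Π, p₁^*Π)`. -/
def IsReproducingKernel (X : LHer.{u}) (K : ∀ s t, X.fam.E t →L[ℂ] X.fam.E s) : Prop :=
  ∀ (n : ℕ) (t : Fin n → X.fam.Z) (η : ∀ j, X.fam.E (X.fam.inv (t j))),
    0 ≤ ∑ l, ∑ j, X.fam.pairing rfl (K (t l) (X.fam.inv (t j)) (η j)) (η l)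

/-- Objects: reproducing `(-*)`-kernels on like-Hermitian vector bundles. -/
structure Kern where
  bundle : LHer.{u}
  K : ∀ s t, bundle.fam.E t →L[ℂ] bundle.fam.E s
  isReproducing : IsReproducingKernel bundle K

/-- Morphisms of reproducing `(-*)`-kernels. -/
@[ext]
structure Kern.Hom (X Y : Kern.{u}) where
  Θ : X.bundle ⟶ Y.bundle
  bound : ∃ M : ℝ, 0 < M ∧ ∀ (n : ℕ) (s : Fin n → X.bundle.fam.Z)
    (ξ : ∀ j, X.bundle.fam.E (s j)),
    Y.bundle.kernelSum Y.K (fun j => Θ.ζ (s j)) (fun j => Θ.δ (s j) (ξ j))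
      ≤ (M : ℂ) * X.bundle.kernelSum X.K s ξ

instance : Category Kern.{u} where
  Hom := Kern.Hom
  id X := ⟨𝟙 X.bundle, 1, one_pos, fun n s ξ => by
    rw [Complex.ofReal_one, one_mul]; exact le_rfl⟩
  comp f g := ⟨f.Θ ≫ g.Θ, by
    obtain ⟨M, hM, h⟩ := f.bound
    obtain ⟨N, hN, h'⟩ := g.bound
    refine ⟨N * M, mul_pos hN hM, fun n s ξ => ?_⟩
    refine (h' n (fun j => f.Θ.ζ (s j)) (fun j => f.Θ.δ (s j) (ξ j))).trans ?_
    rw [Complex.ofReal_mul, mul_assoc]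
    exact mul_le_mul_of_nonneg_left (h n s ξ) (by exact_mod_cast hN.le)⟩

/-! ### Involutive Banach-Lie groups and holomorphic `*`-representations -/

/-- A complex involutive Banach-Lie group: the involution `u ↦ u^*` is antimultiplicative and smooth
in the real sense. -/
structure InvBanachLieGroup where
  carrier : Type u
  model : Type u
  [normModel : NormedAddCommGroup model]
  [spaceModel : NormedSpace ℂ model]
  [completeModel : CompleteSpace model]
  [group : Group carrier]
  [top : TopologicalSpace carrier]
  [charted : ChartedSpace model carrier]
  [lieGroup : LieGroup 𝓘(ℂ, model) ω carrier]
  [starMul : StarMul carrier]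
  smooth_star : ContMDiff 𝓘(ℝ, model) 𝓘(ℝ, model) ∞ (star : carrier → carrier)

instance : CoeSort InvBanachLieGroup.{u} (Type u) := ⟨InvBanachLieGroup.carrier⟩

attribute [instance] InvBanachLieGroup.normModel InvBanachLieGroup.spaceModel
  InvBanachLieGroup.completeModel InvBanachLieGroup.group InvBanachLieGroup.top
  InvBanachLieGroup.charted InvBanachLieGroup.lieGroup InvBanachLieGroup.starMul

/-- `u^{-*} = (u⁻¹)^*`. -/
def negStar {G : InvBanachLieGroup.{u}} (u : G) : G := star u⁻¹

/-- A holomorphic homomorphism of groups preserving the involutions. -/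
@[ext]
structure InvBanachLieGroup.Hom (G G' : InvBanachLieGroup.{u}) extends G →* G' where
  holomorphic : ContMDiff 𝓘(ℂ, G.model) 𝓘(ℂ, G'.model) ω toFun
  map_star : ∀ u, toFun (star u) = star (toFun u)

instance {G G' : InvBanachLieGroup.{u}} : CoeFun (InvBanachLieGroup.Hom G G') (fun _ => G → G') :=
  ⟨fun α => α.toFun⟩

/-- The identity homomorphism. -/
def InvBanachLieGroup.Hom.id (G : InvBanachLieGroup.{u}) : InvBanachLieGroup.Hom G G :=
  { MonoidHom.id G with
    holomorphic := contMDiff_id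
    map_star := fun _ => rfl }

/-- Composition of homomorphisms. -/
def InvBanachLieGroup.Hom.comp {G G' G'' : InvBanachLieGroup.{u}}
    (β : InvBanachLieGroup.Hom G' G'') (α : InvBanachLieGroup.Hom G G') :
    InvBanachLieGroup.Hom G G'' :=
  { β.toMonoidHom.comp α.toMonoidHom with
    holomorphic := β.holomorphic.comp α.holomorphic
    map_star := fun u => (congrArg β (α.map_star u)).trans (β.map_star _) }

/-- `S` is a complex Banach-Lie subgroup of `G`: around each of its points, in a suitable chart of
`G`, it is given by a closed complemented complex linear subspace `W` of the model space. -/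
def IsBanachLieSubgroup {G : InvBanachLieGroup.{u}} (S : Subgroup G) : Prop :=
  ∃ W : Submodule ℂ G.model, W.ClosedComplemented ∧ IsClosed (W : Set G.model) ∧
    ∀ u ∈ S, ∃ φ ∈ IsManifold.maximalAtlas 𝓘(ℂ, G.model) ω G,
      u ∈ φ.source ∧ ∀ x ∈ φ.source, x ∈ S ↔ φ x ∈ W

/-- `ρ` is a holomorphic `*`-representation of `G` by bounded operators on the Hilbert space `H`. -/
structure IsHolomorphicStarRep {G : InvBanachLieGroup.{u}} {H : Type u} [NormedAddCommGroup H]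
    [InnerProductSpace ℂ H] [CompleteSpace H] (ρ : G → (H →L[ℂ] H)) : Prop where
  map_one : ρ 1 = ContinuousLinearMap.id ℂ H
  map_mul : ∀ u v, ρ (u * v) = (ρ u).comp (ρ v)
  map_star : ∀ u, ρ (star u) = ContinuousLinearMap.adjoint (ρ u)
  holomorphic : ContMDiff 𝓘(ℂ, G.model) 𝓘(ℂ, H →L[ℂ] H) ω ρ

/-! ### Transfer mappings -/

/-- The underlying data of a transfer mapping: a family of fibres with pairings, a group `G` acting
by `ν` on the base and by fibrewise bounded operators `μ` on the total space, a representation of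
`G` on a Hilbert space `H`, and a fibrewise bounded linear map `R` into `H`. -/
structure TransData where
  fam : PairedFamily.{u}
  G : InvBanachLieGroup.{u}
  ν : G → fam.Z → fam.Z
  μ : ∀ (g : G) (z : fam.Z), fam.E z →L[ℂ] fam.E (ν g z)
  H : Type u
  [normH : NormedAddCommGroup H]
  [innerH : InnerProductSpace ℂ H]
  [completeH : CompleteSpace H]
  rep : G → (H →L[ℂ] H)
  R : ∀ z, fam.E z →L[ℂ] H

attribute [instance] TransData.normH TransData.innerH TransData.completeH

/-- The action `μ(u, ·) : D → D`. -/
def TransData.act (X : TransData.{u}) (u : X.G) : X.fam.D → X.fam.D := totalMap (X.ν u) (X.μ u)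

/-- The transfer mapping `R : D → H`. -/
def TransData.transfer (X : TransData.{u}) : X.fam.D → X.H := fun ξ => X.R ξ.proj ξ.snd

/-- Manifold and bundle structures on the data, turning it into a holomorphic like-Hermitian vector
bundle acted on holomorphically by `G`, with a transfer mapping to a holomorphic
`*`-representation. -/
structure TransGeometry (X : TransData.{u}) where
  M : Type u
  [normM : NormedAddCommGroup M]
  [spaceM : NormedSpace ℂ M]
  [completeM : CompleteSpace M]
  [topZ : TopologicalSpace X.fam.Z]
  [chartedZ : ChartedSpace M X.fam.Z]
  [topD : TopologicalSpace X.fam.D]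
  [fiberBundle : FiberBundle X.fam.F X.fam.E]
  /-- the underlying real structures form a like-Hermitian bundle, -/
  isLikeHermitian : IsLikeHermitian X.fam M
  /-- which is a holomorphic bundle over a complex manifold, -/
  isManifold : IsManifold 𝓘(ℂ, M) ω X.fam.Z
  vectorBundle : VectorBundle ℂ X.fam.F X.fam.E
  holomorphicBundle : ContMDiffVectorBundle ω X.fam.F X.fam.E 𝓘(ℂ, M)
  /-- `ν` and `μ` are holomorphic actions, -/
  ν_one : ∀ z, X.ν 1 z = z
  ν_mul : ∀ u v z, X.ν (u * v) z = X.ν u (X.ν v z)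
  act_one : ∀ ξ, X.act 1 ξ = ξ
  act_mul : ∀ u v ξ, X.act (u * v) ξ = X.act u (X.act v ξ)
  holomorphic_ν : ContMDiff (𝓘(ℂ, X.G.model).prod 𝓘(ℂ, M)) 𝓘(ℂ, M) ω
    (fun p : X.G × X.fam.Z => X.ν p.1 p.2)
  holomorphic_act : ContMDiff (𝓘(ℂ, X.G.model).prod (𝓘(ℂ, M).prod 𝓘(ℂ, X.fam.F)))
    (𝓘(ℂ, M).prod 𝓘(ℂ, X.fam.F)) ω (fun p : X.G × X.fam.D => X.act p.1 p.2)
  /-- compatible with the involutions -/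
  ν_negStar : ∀ u z, X.ν (negStar u) (X.fam.inv z) = X.fam.inv (X.ν u z)
  /-- and with the pairings, -/
  pairing_act : ∀ (u : X.G) (ξ η : X.fam.D) (_ : η.proj = X.ν (negStar u) (X.fam.inv ξ.proj))
    (h : ξ.proj = X.fam.inv (X.act (star u) η).proj)
    (h' : (X.act u ξ).proj = X.fam.inv η.proj),
    X.fam.pairing h (X.act (star u) η).snd ξ.snd = X.fam.pairing h' η.snd (X.act u ξ).snd
  /-- `rep` is a holomorphic `*`-representation, -/
  isRep : IsHolomorphicStarRep X.rep
  /-- and `R` relates the bundle to `rep`. -/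
  holomorphic_transfer : ContMDiff (𝓘(ℂ, M).prod 𝓘(ℂ, X.fam.F)) 𝓘(ℂ, X.H) ω X.transfer
  injective_R : ∀ z, Function.Injective (X.R z)
  pairing_eq : ∀ {z w : X.fam.Z} (h : w = X.fam.inv z) (ξ : X.fam.E z) (η : X.fam.E w),
    X.fam.pairing h ξ η = ⟪X.R w η, X.R z ξ⟫_ℂ
  transfer_act : ∀ (u : X.G) (ξ : X.fam.D), X.transfer (X.act u ξ) = X.rep u (X.transfer ξ)

/-- Objects: transfer mappings between holomorphic like-Hermitian bundles acted on by complex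
involutive Banach-Lie groups and holomorphic `*`-representations of these groups. -/
structure Trans where
  data : TransData.{u}
  geom : TransGeometry data

/-- The underlying smooth like-Hermitian bundle. -/
abbrev Trans.bundle (X : Trans.{u}) : LHer.{u} :=
  letI := X.geom.normM
  letI := X.geom.spaceM
  letI := X.geom.topZ
  letI := X.geom.topD
  { fam := X.data.fam
    M := X.geom.M
    completeM := X.geom.completeM
    chartedZ := X.geom.chartedZ
    fiberBundle := X.geom.fiberBundle
    isLikeHermitian := X.geom.isLikeHermitian }

/-- Morphisms `(Θ, α, L)`, `Θ = (δ, ζ)`.  In the last condition `L(R̃(ξ)) = R(δ(ξ))`. -/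
@[ext]
structure Trans.Hom (X Y : Trans.{u}) where
  Θ : X.bundle ⟶ Y.bundle
  α : InvBanachLieGroup.Hom X.data.G Y.data.G
  L : X.data.H →L[ℂ] Y.data.H
  ζ_ν : ∀ (u : X.data.G) (z : X.data.fam.Z), Θ.ζ (X.data.ν u z) = Y.data.ν (α u) (Θ.ζ z)
  tot_act : ∀ (u : X.data.G) (ξ : X.data.fam.D),
    Θ.tot (X.data.act u ξ) = Y.data.act (α u) (Θ.tot ξ)
  L_rep : ∀ u : X.data.G, (Y.data.rep (α u)).comp L = L.comp (X.data.rep u)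
  transfer_tot : ∀ ξ : X.data.fam.D, Y.data.transfer (Θ.tot ξ) = L (X.data.transfer ξ)
  bound : ∃ M : ℝ, 0 < M ∧ ∀ (n : ℕ) (ξ : Fin n → X.data.fam.D),
    ∑ l, ∑ j, ⟪L (X.data.transfer (ξ j)), L (X.data.transfer (ξ l))⟫_ℂ
      ≤ (M : ℂ) * ∑ l, ∑ j, ⟪X.data.transfer (ξ l), X.data.transfer (ξ j)⟫_ℂ

instance : Category Trans.{u} where
  Hom := Trans.Hom
  id X :=
    { Θ := 𝟙 X.bundle
      α := InvBanachLieGroup.Hom.id _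
      L := ContinuousLinearMap.id ℂ _
      ζ_ν := fun _ _ => rfl
      tot_act := fun _ _ => rfl
      L_rep := fun _ => rfl
      transfer_tot := fun _ => rfl
      bound := ⟨1, one_pos, fun n ξ => by
        rw [Complex.ofReal_one, one_mul, Finset.sum_comm]; exact le_rfl⟩ }
  comp {X Y Z} f g :=
    { Θ := f.Θ ≫ g.Θ
      α := g.α.comp f.α
      L := g.L.comp f.L
      ζ_ν := fun u z => (congrArg g.Θ.ζ (f.ζ_ν u z)).trans (g.ζ_ν _ _)
      tot_act := fun u ξ => (congrArg g.Θ.tot (f.tot_act u ξ)).trans (g.tot_act _ _)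
      L_rep := fun u => by
        ext x
        have h1 := DFunLike.congr_fun (f.L_rep u) x
        have h2 := DFunLike.congr_fun (g.L_rep (f.α u)) (f.L x)
        exact h2.trans (congrArg g.L h1)
      transfer_tot := fun ξ => (g.transfer_tot _).trans (congrArg g.L (f.transfer_tot ξ))
      bound := by
        obtain ⟨M, hM, h⟩ := f.bound
        obtain ⟨N, hN, h'⟩ := g.bound
        refine ⟨N * M, mul_pos hN hM, fun n ξ => ?_⟩
        have h2 := h' n (fun j => f.Θ.tot (ξ j))
        simp only [f.transfer_tot] at h2
        have h1 := h n ξ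
        rw [Finset.sum_comm] at h1
        refine h2.trans ?_
        rw [Complex.ofReal_mul, mul_assoc]
        exact mul_le_mul_of_nonneg_left h1 (by exact_mod_cast hN.le) }

/-- `S^{-*}`: for a bounded linear `S : E w → H`, `w = z^{-*}`, the bounded linear operator
`T : H → E z` with `(T h ∣ y)_{z, z^{-*}} = (h ∣ S y)_H` for all `h` and `y`.  In a like-Hermitian
bundle the pairings are strong dualities, so that `T` exists and is unique. -/
def negStarAdjoint (X : PairedFamily.{u}) {H : Type u} [NormedAddCommGroup H]
    [InnerProductSpace ℂ H] {z w : X.Z} (h : w = X.inv z) (S : X.E w →L[ℂ] H) : H →L[ℂ] X.E z :=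
  Classical.epsilon fun T => ∀ (x : H) (y : X.E w), X.pairing h (T x) y = ⟪S y, x⟫_ℂ

/-- `K^R(s, t) = (R_{s^{-*}})^{-*} ∘ R_t`. -/
def kernelOf (X : Trans.{u}) (s t : X.data.fam.Z) : X.data.fam.E t →L[ℂ] X.data.fam.E s :=
  (negStarAdjoint X.data.fam rfl (X.data.R (X.data.fam.inv s))).comp (X.data.R t)

/-! ### Representations with homogeneous data -/

/-- The underlying data `(G_A, G_B, H_A, H_B, π_A)`. -/
structure SRepData where
  GA : InvBanachLieGroup.{u}
  GB : Subgroup GA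
  HA : Type u
  [normHA : NormedAddCommGroup HA]
  [innerHA : InnerProductSpace ℂ HA]
  [completeHA : CompleteSpace HA]
  HB : Submodule ℂ HA
  rep : GA → (HA →L[ℂ] HA)

attribute [instance] SRepData.normHA SRepData.innerHA SRepData.completeHA

/-- `G_B` is an involutive complex Banach-Lie subgroup of `G_A`, `π_A` is a holomorphic
`*`-representation of `G_A`, and `H_B` is a closed subspace invariant under `π_A(G_B)`.  The
representation `π_B` of `G_B` by restriction to `H_B` and the orthogonal projection `P` of `H_A`
onto `H_B` are determined by these data. -/
structure IsSRep (X : SRepData.{u}) : Prop where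
  isBanachLieSubgroup : IsBanachLieSubgroup X.GB
  star_mem : ∀ u ∈ X.GB, star u ∈ X.GB
  isRep : IsHolomorphicStarRep X.rep
  isClosed_HB : IsClosed (X.HB : Set X.HA)
  rep_mem : ∀ u ∈ X.GB, ∀ f ∈ X.HB, X.rep u f ∈ X.HB

/-- Objects: `*`-representations `π_A` with the data `(π_A, π_B, P)`. -/
structure SRep where
  data : SRepData.{u}
  isSRep : IsSRep data

/-- Morphisms `(α, L)`.  Here `L(H̃_B) ⊆ H_B` is the same as `P ∘ L = L ∘ P̃` on `H̃_B`. -/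
@[ext]
structure SRep.Hom (X Y : SRep.{u}) where
  α : InvBanachLieGroup.Hom X.data.GA Y.data.GA
  L : X.data.HA →L[ℂ] Y.data.HA
  α_mem : ∀ u ∈ X.data.GB, α u ∈ Y.data.GB
  L_rep : ∀ u : X.data.GA, L.comp (X.data.rep u) = (Y.data.rep (α u)).comp L
  L_mem : ∀ f ∈ X.data.HB, L f ∈ Y.data.HB
  bound : ∃ M : ℝ, 0 < M ∧ ∀ (n : ℕ) (u : Fin n → X.data.GA) (h : Fin n → X.data.HA),
    ∑ l, ∑ j, ⟪Y.data.rep (α (u j)) (L (h j)), Y.data.rep (α (u l)) (L (h l))⟫_ℂ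
      ≤ (M : ℂ) * ∑ l, ∑ j, ⟪X.data.rep (u j) (h j), X.data.rep (u l) (h l)⟫_ℂ

instance : Category SRep.{u} where
  Hom := SRep.Hom
  id X :=
    { α := InvBanachLieGroup.Hom.id _
      L := ContinuousLinearMap.id ℂ _
      α_mem := fun _ h => h
      L_rep := fun _ => rfl
      L_mem := fun _ h => h
      bound := ⟨1, one_pos, fun n u h => by
        rw [Complex.ofReal_one, one_mul]; exact le_rfl⟩ }
  comp f g :=
    { α := g.α.comp f.α
      L := g.L.comp f.L
      α_mem := fun u h => g.α_mem _ (f.α_mem u h)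
      L_rep := fun u => by
        ext x
        have h1 := DFunLike.congr_fun (f.L_rep u) x
        have h2 := DFunLike.congr_fun (g.L_rep (f.α u)) (f.L x)
        exact (congrArg g.L h1).trans h2
      L_mem := fun x h => g.L_mem _ (f.L_mem x h)
      bound := by
        obtain ⟨M, hM, h⟩ := f.bound
        obtain ⟨N, hN, h'⟩ := g.bound
        refine ⟨N * M, mul_pos hN hM, fun n u x => ?_⟩
        refine (h' n (fun j => f.α (u j)) (fun j => f.L (x j))).trans ?_
        rw [Complex.ofReal_mul, mul_assoc]
        exact mul_le_mul_of_nonneg_left (h n u x) (by exact_mod_cast hN.le) }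

/-! ### The homogeneous like-Hermitian bundle of `(π_A, π_B, P)` -/

namespace SRep

variable (X : SRep.{u})

/-- `π_B(w)`. -/
def repB (w : X.data.GB) : X.data.HB →L[ℂ] X.data.HB :=
  ((X.data.rep w.1).comp X.data.HB.subtypeL).codRestrict X.data.HB
    fun f => X.isSRep.rep_mem w.1 w.2 f.1 f.2

/-- `(u, f) ∼ (u', f')` if `u' = u w` and `f' = π_B(w⁻¹) f` for some `w ∈ G_B`. -/
def rel (p q : X.data.GA × X.data.HB) : Prop :=
  ∃ w : X.data.GB, q.1 = p.1 * w ∧ q.2 = X.repB w⁻¹ p.2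

lemma repB_mul (v w : X.data.GB) (f : X.data.HB) : X.repB (v * w) f = X.repB v (X.repB w f) :=
  Subtype.ext (DFunLike.congr_fun (X.isSRep.isRep.map_mul v.1 w.1) f.1)

lemma repB_one (f : X.data.HB) : X.repB 1 f = f :=
  Subtype.ext (DFunLike.congr_fun X.isSRep.isRep.map_one f.1)

/-- `∼` is an equivalence relation. -/
def setoid : Setoid (X.data.GA × X.data.HB) where
  r := X.rel
  iseqv :=
    { refl := fun p => ⟨1, by simp, by rw [inv_one, repB_one]⟩
      symm := by
        rintro p q ⟨w, h1, h2⟩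
        refine ⟨w⁻¹, by simp [h1], ?_⟩
        rw [h2, ← repB_mul, inv_inv, mul_inv_cancel, repB_one]
      trans := by
        rintro p q r ⟨w, h1, h2⟩ ⟨v, h3, h4⟩
        refine ⟨w * v, by simp [h1, h3, mul_assoc], ?_⟩
        rw [h4, h2, ← repB_mul, mul_inv_rev] }

/-- The base `G_A / G_B`. -/
abbrev Base : Type u := X.data.GA ⧸ X.data.GB

/-- The total space `D = G_A ×_{G_B} H_B`. -/
def Tot : Type u := Quotient X.setoid

variable {X}

/-- The class `[(u, f)]`. -/
def cls (u : X.data.GA) (f : X.data.HB) : X.Tot := Quotient.mk X.setoid (u, f)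

variable (X)

/-- The projection `Π : [(u, f)] ↦ u G_B`. -/
def proj : X.Tot → X.Base :=
  Quotient.lift (fun p : X.data.GA × X.data.HB => (QuotientGroup.mk p.1 : X.Base)) (by
    rintro p q ⟨w, h1, -⟩
    simp [h1])

/-- The map `[(u, f)] ↦ π_A(u) f`. -/
def transferTot : X.Tot → X.data.HA :=
  Quotient.lift (fun p : X.data.GA × X.data.HB => X.data.rep p.1 p.2) (by
    rintro p q ⟨w, h1, h2⟩
    have h3 : X.data.rep q.1 q.2 = X.data.rep p.1 (X.repB w (X.repB w⁻¹ p.2)) := by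
      rw [h1, h2, X.isSRep.isRep.map_mul]; rfl
    rw [← repB_mul, mul_inv_cancel, repB_one] at h3
    exact h3.symm)

/-- The fibre `D_s = Π⁻¹(s)`. -/
def Fiber (s : X.Base) : Type u := {d : X.Tot // X.proj d = s}

/-- `[(u, f)]` as an element of its fibre. -/
def fcls (u : X.data.GA) (f : X.data.HB) : X.Fiber (QuotientGroup.mk u) := ⟨cls u f, rfl⟩

/-- `R_s : D_s → H_A`, `[(u, f)] ↦ π_A(u) f`. -/
def fiberTransfer (s : X.Base) (d : X.Fiber s) : X.data.HA := X.transferTot d.1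

lemma fiber_eq (u : X.data.GA) (d : X.Fiber (QuotientGroup.mk u)) : ∃ f, d = X.fcls u f := by
  obtain ⟨d, hd⟩ := d
  induction d using Quotient.inductionOn with
  | h p =>
    have h : u⁻¹ * p.1 ∈ X.data.GB := QuotientGroup.eq.1 hd.symm
    refine ⟨X.repB ⟨u⁻¹ * p.1, h⟩ p.2, Subtype.ext (Quotient.sound ?_)⟩
    refine ⟨(⟨u⁻¹ * p.1, h⟩ : X.data.GB)⁻¹, ?_, ?_⟩
    · simp
    · rw [inv_inv]

lemma rep_inv_rep (u : X.data.GA) (x : X.data.HA) : X.data.rep u⁻¹ (X.data.rep u x) = x := by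
  have h := DFunLike.congr_fun (X.isSRep.isRep.map_mul u⁻¹ u) x
  rw [inv_mul_cancel, X.isSRep.isRep.map_one] at h
  exact h.symm

lemma fiberTransfer_injective (s : X.Base) : Function.Injective (X.fiberTransfer s) := by
  induction s using QuotientGroup.induction_on with
  | H u =>
    intro d d' h
    obtain ⟨f, rfl⟩ := X.fiber_eq u d
    obtain ⟨f', rfl⟩ := X.fiber_eq u d'
    have h' : X.data.rep u f.1 = X.data.rep u f'.1 := h
    have h2 := congrArg (X.data.rep u⁻¹) h'
    rw [rep_inv_rep, rep_inv_rep] at h2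
    rw [Subtype.ext h2]

/-- The range `π_A(u) H_B` of `R_s`, `s = u G_B`. -/
def fiberRange (s : X.Base) : Submodule ℂ X.data.HA where
  carrier := Set.range (X.fiberTransfer s)
  zero_mem' := by
    induction s using QuotientGroup.induction_on with
    | H u => exact ⟨X.fcls u 0, map_zero (X.data.rep u)⟩
  add_mem' := by
    induction s using QuotientGroup.induction_on with
    | H u =>
      rintro _ _ ⟨d, rfl⟩ ⟨d', rfl⟩
      obtain ⟨f, rfl⟩ := X.fiber_eq u d
      obtain ⟨f', rfl⟩ := X.fiber_eq u d'
      exact ⟨X.fcls u (f + f'), map_add (X.data.rep u) f.1 f'.1⟩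
  smul_mem' := by
    induction s using QuotientGroup.induction_on with
    | H u =>
      rintro c _ ⟨d, rfl⟩
      obtain ⟨f, rfl⟩ := X.fiber_eq u d
      exact ⟨X.fcls u (c • f), map_smul (X.data.rep u) c f.1⟩

/-- The bijection `R_s : D_s → π_A(u) H_B`. -/
def fiberEquiv (s : X.Base) : X.Fiber s ≃ X.fiberRange s :=
  Equiv.ofInjective _ (X.fiberTransfer_injective s)

/-- The linear structure of `D_s` and its topology, which is that of the Hilbertian norm
`‖[(u, f)]‖ = ‖π_A(u) f‖`, are transported by the bijection `R_s`. -/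
instance (s : X.Base) : AddCommGroup (X.Fiber s) := (X.fiberEquiv s).addCommGroup

instance (s : X.Base) : Module ℂ (X.Fiber s) := (X.fiberEquiv s).module ℂ

instance (s : X.Base) : TopologicalSpace (X.Fiber s) :=
  TopologicalSpace.induced (X.fiberTransfer s) inferInstance

/-- `R_s` as a bounded linear operator. -/
def fiberTransferL (s : X.Base) : X.Fiber s →L[ℂ] X.data.HA where
  toFun := X.fiberTransfer s
  map_add' d d' := congrArg Subtype.val (map_add ((X.fiberEquiv s).linearEquiv ℂ) d d')
  map_smul' c d := congrArg Subtype.val (map_smul ((X.fiberEquiv s).linearEquiv ℂ) c d)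
  cont := continuous_induced_dom

/-- `(u G_B)^{-*} = u^{-*} G_B`. -/
def baseInv : X.Base → X.Base :=
  Quotient.lift (fun u : X.data.GA => (QuotientGroup.mk (negStar u) : X.Base)) (by
    intro u v h
    have h' : u⁻¹ * v ∈ X.data.GB := QuotientGroup.leftRel_apply.1 h
    refine QuotientGroup.eq.2 ?_
    have h2 := X.isSRep.star_mem _ (inv_mem h')
    have h3 : (negStar u)⁻¹ * negStar v = star (u⁻¹ * v)⁻¹ := by
      have h4 : (star u⁻¹)⁻¹ = star u := by
        rw [inv_eq_iff_mul_eq_one, ← star_mul, mul_inv_cancel]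
        have h5 : star (1 : X.data.GA) * star 1 = star 1 * 1 := by
          rw [← star_mul, mul_one, mul_one]
        exact mul_left_cancel h5
      rw [negStar, negStar, h4, ← star_mul, mul_inv_rev, inv_inv]
    rw [h3]
    exact h2)

/-- The fibres `D_s` of `G_A ×_{G_B} H_B`, with
`([(u, f)] ∣ [(u^{-*}, g)]) = (π_A(u) f ∣ π_A(u^{-*}) g)`. -/
def family : PairedFamily.{u} :=
  letI : CompleteSpace X.data.HB := X.isSRep.isClosed_HB.completeSpace_coe
  { Z := X.Base
    inv := X.baseInv
    F := X.data.HB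
    E := X.Fiber
    pairing := fun {z w} _ => LinearMap.mk₂'ₛₗ (RingHom.id ℂ) (starRingEnd ℂ)
      (fun ξ η => ⟪X.fiberTransferL w η, X.fiberTransferL z ξ⟫_ℂ)
      (fun ξ ξ' η => by rw [map_add, inner_add_right])
      (fun c ξ η => by rw [map_smul, inner_smul_right]; rfl)
      (fun ξ η η' => by rw [map_add, inner_add_left])
      (fun c ξ η => by rw [map_smul, inner_smul_left]; rfl) }

/-- `v · [(u, f)] = [(v u, f)]` on `G_A ×_{G_B} H_B`. -/
def actTot (v : X.data.GA) : X.Tot → X.Tot :=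
  Quotient.map (fun p => (v * p.1, p.2)) (by
    rintro p q ⟨w, h1, h2⟩
    exact ⟨w, by simp [h1, mul_assoc], h2⟩)

lemma transferTot_actTot (v : X.data.GA) (d : X.Tot) :
    X.transferTot (X.actTot v d) = X.data.rep v (X.transferTot d) := by
  induction d using Quotient.inductionOn with
  | h p => exact DFunLike.congr_fun (X.isSRep.isRep.map_mul v p.1) p.2.1

lemma proj_actTot (v : X.data.GA) (d : X.Tot) : X.proj (X.actTot v d) = v • X.proj d := by
  induction d using Quotient.inductionOn with
  | h p => rfl

/-- `v · : D_s → D_{v s}`, `[(u, f)] ↦ [(v u, f)]`. -/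
def fiberActFun (v : X.data.GA) (s : X.Base) (d : X.Fiber s) : X.Fiber (v • s) :=
  ⟨X.actTot v d.1, by rw [proj_actTot, d.2]⟩

lemma fiberTransferL_fiberActFun (v : X.data.GA) (s : X.Base) (d : X.Fiber s) :
    X.fiberTransferL (v • s) (X.fiberActFun v s d) = X.data.rep v (X.fiberTransferL s d) :=
  X.transferTot_actTot v d.1

/-- `v · : D_s → D_{v s}` as a bounded linear operator. -/
def fiberAct (v : X.data.GA) (s : X.Base) : X.Fiber s →L[ℂ] X.Fiber (v • s) where
  toFun := X.fiberActFun v s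
  map_add' d d' := X.fiberTransfer_injective (v • s) <| by
    change X.fiberTransferL _ _ = X.fiberTransferL _ _
    rw [map_add, fiberTransferL_fiberActFun, fiberTransferL_fiberActFun,
      fiberTransferL_fiberActFun, map_add, map_add]
  map_smul' c d := X.fiberTransfer_injective (v • s) <| by
    change X.fiberTransferL _ _ = X.fiberTransferL _ _
    rw [RingHom.id_apply, map_smul, fiberTransferL_fiberActFun, fiberTransferL_fiberActFun,
      map_smul, map_smul]
  cont := by
    refine continuous_induced_rng.2 ?_
    have h : X.fiberTransfer (v • s) ∘ X.fiberActFun v s =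
        fun d => X.data.rep v (X.fiberTransferL s d) :=
      funext (X.fiberTransferL_fiberActFun v s)
    rw [h]
    exact (X.data.rep v).continuous.comp (X.fiberTransferL s).continuous

/-- The data of the transfer mapping `R^π : G_A ×_{G_B} H_B → H_A`, `R^π([(u, f)]) = π_A(u) f`. -/
def transData : TransData.{u} where
  fam := X.family
  G := X.data.GA
  ν := fun (v : X.data.GA) (s : X.Base) => v • s
  μ := X.fiberAct
  H := X.data.HA
  rep := X.data.rep
  R := X.fiberTransferL

/-- The quotient map `u ↦ u G_B`, with values in the base of the bundle. -/
def basePoint (u : X.data.GA) : X.transData.fam.Z := (QuotientGroup.mk u : X.Base)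

/-- The quotient map `(u, f) ↦ [(u, f)]`, with values in the total space of the bundle. -/
def point (p : X.data.GA × X.data.HB) : X.transData.fam.D := ⟨X.basePoint p.1, X.fcls p.1 p.2⟩

/-- The manifold structures on `G_A / G_B` and `G_A ×_{G_B} H_B` are the quotient ones: the quotient
maps `u ↦ u G_B` and `(u, f) ↦ [(u, f)]` are holomorphic submersions. -/
structure IsQuotientGeometry (g : TransGeometry X.transData) : Prop where
  submersion_base :
    letI := g.normM
    letI := g.spaceM
    letI := g.topZ
    letI := g.chartedZ
    Manifold.IsSubmersion 𝓘(ℂ, X.data.GA.model) 𝓘(ℂ, g.M) ω X.basePoint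
  submersion_total :
    letI := g.normM
    letI := g.spaceM
    letI := g.topZ
    letI := g.chartedZ
    letI := g.topD
    letI := g.fiberBundle
    Manifold.IsSubmersion (𝓘(ℂ, X.data.GA.model).prod 𝓘(ℂ, X.data.HB))
      (𝓘(ℂ, g.M).prod 𝓘(ℂ, X.transData.fam.F)) ω X.point

end SRep

/-! ### Completely positive maps -/

/-- Objects: unital completely positive maps `Φ : A → B(H₀)` on unital `C^*`-algebras, together with
a unital `C^*`-subalgebra `B` and a conditional expectation `E : A → B` such that `Φ ∘ E = Φ`. -/
structure CPos where
  A : Type u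
  [cstarA : CStarAlgebra A]
  [orderA : PartialOrder A]
  [starOrderedA : StarOrderedRing A]
  B : StarSubalgebra ℂ A
  isClosed_B : IsClosed (B : Set A)
  E : A →L[ℂ] A
  E_idem : ∀ a, E (E a) = E a
  norm_E : ‖E‖ = 1
  range_E : Set.range E = B
  H₀ : Type u
  [normH : NormedAddCommGroup H₀]
  [innerH : InnerProductSpace ℂ H₀]
  [completeH : CompleteSpace H₀]
  Φ : CompletelyPositiveMap A (H₀ →L[ℂ] H₀)
  Φ_one : Φ 1 = 1
  Φ_E : ∀ a, Φ (E a) = Φ a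

attribute [instance] CPos.cstarA CPos.orderA CPos.starOrderedA CPos.normH CPos.innerH
  CPos.completeH

/-- Morphisms `(α, T)`. -/
@[ext]
structure CPos.Hom (X Y : CPos.{u}) where
  α : X.A →⋆ₐ[ℂ] Y.A
  T : X.H₀ →L[ℂ] Y.H₀
  α_E : ∀ b ∈ X.B, α (X.E b) = Y.E (α b)
  Φ_T : ∀ b ∈ X.B, (Y.Φ (α b)).comp T = T.comp (X.Φ b)
  bound : ∃ M : ℝ, 0 < M ∧ ∀ (n : ℕ) (a : CStarMatrix (Fin n) (Fin n) X.A), 0 ≤ a →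
    ∀ h : Fin n → X.H₀,
      ∑ l, ∑ j, ⟪T (h l), Y.Φ (α (a l j)) (T (h j))⟫_ℂ
        ≤ (M : ℂ) * ∑ l, ∑ j, ⟪h l, X.Φ (a l j) (h j)⟫_ℂ

lemma CPos.Hom.α_mem {X Y : CPos.{u}} (f : CPos.Hom X Y) {b : X.A} (hb : b ∈ X.B) :
    f.α b ∈ Y.B := by
  have h1 : b ∈ Set.range X.E := by rw [X.range_E]; exact hb
  obtain ⟨c, rfl⟩ := h1
  have h2 := f.α_E _ hb
  rw [X.E_idem] at h2
  have h3 : f.α (X.E c) ∈ Set.range Y.E := ⟨_, h2.symm⟩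
  rw [Y.range_E] at h3
  exact h3

instance : Category CPos.{u} where
  Hom := CPos.Hom
  id X :=
    { α := StarAlgHom.id ℂ X.A
      T := ContinuousLinearMap.id ℂ _
      α_E := fun _ _ => rfl
      Φ_T := fun _ _ => rfl
      bound := ⟨1, one_pos, fun n a _ h => by
        rw [Complex.ofReal_one, one_mul]; exact le_rfl⟩ }
  comp f g :=
    { α := g.α.comp f.α
      T := g.T.comp f.T
      α_E := fun b hb => (congrArg g.α (f.α_E b hb)).trans (g.α_E _ (f.α_mem hb))
      Φ_T := fun b hb => by
        ext x
        have h1 := DFunLike.congr_fun (f.Φ_T b hb) x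
        have h2 := DFunLike.congr_fun (g.Φ_T (f.α b) (f.α_mem hb)) (f.T x)
        exact h2.trans (congrArg g.T h1)
      bound := by
        obtain ⟨M, hM, h⟩ := f.bound
        obtain ⟨N, hN, h'⟩ := g.bound
        refine ⟨N * M, mul_pos hN hM, fun n a ha x => ?_⟩
        have ha' : 0 ≤ a.map f.α := CompletelyPositiveMapClass.map_cstarMatrix_nonneg' f.α n a ha
        refine (h' n (a.map f.α) ha' (fun j => f.T (x j))).trans ?_
        rw [Complex.ofReal_mul, mul_assoc]
        exact mul_le_mul_of_nonneg_left (h n a ha x) (by exact_mod_cast hN.le) }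

/-! ### The Stinespring dilation -/

namespace CPos

variable (X : CPos.{u})

/-- A positive matrix of operators has a positive quadratic form. -/
lemma matrix_sum_nonneg {H : Type u} [NormedAddCommGroup H] [InnerProductSpace ℂ H]
    [CompleteSpace H] {n : ℕ} (N : CStarMatrix (Fin n) (Fin n) (H →L[ℂ] H)) (hN : 0 ≤ N)
    (h : Fin n → H) : 0 ≤ ∑ i, ∑ j, ⟪h i, N i j (h j)⟫_ℂ := by
  have hN' := StarOrderedRing.nonneg_iff.1 hN
  clear hN
  induction hN' using AddSubmonoid.closure_induction with
  | mem N hd =>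
    obtain ⟨d, rfl⟩ := hd
    have h4 : ∑ i, ∑ j, ⟪h i, (star d * d) i j (h j)⟫_ℂ =
        ∑ k, ⟪∑ i, d k i (h i), ∑ j, d k j (h j)⟫_ℂ := by
      have h5 : ∀ i j, ⟪h i, (star d * d) i j (h j)⟫_ℂ = ∑ k, ⟪d k i (h i), d k j (h j)⟫_ℂ := by
        intro i j
        have h6 : (star d * d) i j = ∑ k, (ContinuousLinearMap.adjoint (d k i)).comp (d k j) := by
          rw [CStarMatrix.mul_apply]; rfl
        simp [h6, ContinuousLinearMap.adjoint_inner_right]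
      simp only [h5, sum_inner, inner_sum]
      rw [Finset.sum_congr rfl fun i _ => Finset.sum_comm, Finset.sum_comm]
      exact Finset.sum_congr rfl fun k _ => Finset.sum_comm
    simp only
    rw [h4]
    refine Finset.sum_nonneg fun k _ => ?_
    rw [inner_self_eq_norm_sq_to_K]
    positivity
  | zero => simp
  | add M N _ _ hM hN =>
    have h1 : ∀ i j, (M + N) i j (h j) = M i j (h j) + N i j (h j) := fun _ _ => rfl
    simp only [h1, inner_add_right, Finset.sum_add_distrib]
    exact add_nonneg hM hN

/-- Positivity of `∑ (Φ(a_i^* a_j) h_j ∣ h_i)`. -/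
lemma sum_nonneg {n : ℕ} (a : Fin n → X.A) (h : Fin n → X.H₀) :
    0 ≤ ∑ i, ∑ j, ⟪h i, X.Φ (star (a i) * a j) (h j)⟫_ℂ := by
  rcases Nat.eq_zero_or_pos n with rfl | hn
  · simp
  let i₀ : Fin n := ⟨0, hn⟩
  let c : CStarMatrix (Fin n) (Fin n) X.A :=
    CStarMatrix.ofMatrix (Matrix.of fun i j => if i = i₀ then a j else 0)
  have hc : ∀ i j, (star c * c) i j = star (a i) * a j := by
    intro i j
    rw [CStarMatrix.mul_apply, Finset.sum_eq_single i₀]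
    · simp [c, CStarMatrix.star_apply]
    · intro b _ hb
      simp [c, hb]
    · simp
  have h1 := matrix_sum_nonneg _
    (X.Φ.map_cstarMatrix_nonneg' n (star c * c) (star_mul_self_nonneg c)) h
  have h2 : ∀ i j, ((star c * c).map X.Φ.toLinearMap) i j = X.Φ (star (a i) * a j) := by
    intro i j
    rw [CStarMatrix.map_apply, hc]; rfl
  simpa only [h2] using h1

/-- The algebraic tensor product `A ⊗ H₀`, to be given the semi-inner product of `Φ`. -/
def Pre : Type u := X.A ⊗[ℂ] X.H₀

instance : AddCommGroup X.Pre := inferInstanceAs (AddCommGroup (X.A ⊗[ℂ] X.H₀))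

instance : Module ℂ X.Pre := inferInstanceAs (Module ℂ (X.A ⊗[ℂ] X.H₀))

/-- The sesquilinear form with `(a ⊗ ξ, b ⊗ η) ↦ (Φ(a^* b) η ∣ ξ)`, antilinear in the first and
linear in the second variable. -/
def form : X.A ⊗[ℂ] X.H₀ →ₗ⋆[ℂ] X.A ⊗[ℂ] X.H₀ →ₗ[ℂ] ℂ :=
  TensorProduct.lift (LinearMap.mk₂'ₛₗ (starRingEnd ℂ) (starRingEnd ℂ)
    (fun a ξ => TensorProduct.lift (LinearMap.mk₂ ℂ (fun b η => ⟪ξ, X.Φ (star a * b) η⟫_ℂ)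
      (fun b b' η => by simp [mul_add])
      (fun c b η => by simp)
      (fun b η η' => by simp)
      (fun c b η => by simp)))
    (fun a a' ξ => TensorProduct.ext' fun b η => by simp [add_mul])
    (fun c a ξ => TensorProduct.ext' fun b η => by simp)
    (fun a ξ ξ' => TensorProduct.ext' fun b η => by simp)
    (fun c a ξ => TensorProduct.ext' fun b η => by simp [mul_comm]))

lemma form_tmul (a b : X.A) (ξ η : X.H₀) :
    X.form (a ⊗ₜ ξ) (b ⊗ₜ η) = ⟪ξ, X.Φ (star a * b) η⟫_ℂ := rfl

lemma exists_sum (x : X.A ⊗[ℂ] X.H₀) :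
    ∃ (n : ℕ) (a : Fin n → X.A) (h : Fin n → X.H₀), x = ∑ i, a i ⊗ₜ[ℂ] h i := by
  obtain ⟨S, rfl⟩ := TensorProduct.exists_finset x
  refine ⟨S.card, fun i => (S.equivFin.symm i).1.1, fun i => (S.equivFin.symm i).1.2, ?_⟩
  rw [S.equivFin.symm.sum_comp (fun p : S => p.1.1 ⊗ₜ[ℂ] p.1.2)]
  exact (S.sum_coe_sort fun p => p.1 ⊗ₜ[ℂ] p.2).symm

lemma form_nonneg (x : X.A ⊗[ℂ] X.H₀) : 0 ≤ X.form x x := by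
  obtain ⟨n, a, h, rfl⟩ := X.exists_sum x
  simp only [map_sum, LinearMap.sum_apply, form_tmul]
  rw [Finset.sum_comm]
  exact X.sum_nonneg a h

lemma form_conj (x y : X.A ⊗[ℂ] X.H₀) : star (X.form x y) = X.form y x := by
  have hΦ : ∀ a, X.Φ (star a) = ContinuousLinearMap.adjoint (X.Φ a) := map_star X.Φ
  induction x with
  | zero => simp
  | add x x' hx hx' => simp [hx, hx']
  | tmul a ξ =>
    induction y with
    | zero => simp
    | add y y' hy hy' => simp only [map_add, LinearMap.add_apply, star_add, hy, hy']
    | tmul b η =>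
      rw [form_tmul, form_tmul]
      have h1 : star b * a = star (star a * b) := by simp
      rw [h1, hΦ, ContinuousLinearMap.adjoint_inner_right]
      exact inner_conj_symm _ _

/-- The identification of `A ⊗ H₀` with the space to be given the semi-inner product of `Φ`. -/
def toPre : X.A ⊗[ℂ] X.H₀ ≃ₗ[ℂ] X.Pre := LinearEquiv.refl ℂ _

/-- The semi-inner product of `Φ`. -/
abbrev preCore : PreInnerProductSpace.Core ℂ X.Pre where
  inner x y := X.form (X.toPre.symm x) (X.toPre.symm y)
  conj_inner_symm x y := X.form_conj _ _
  re_inner_nonneg x := (RCLike.nonneg_iff.mp (X.form_nonneg _)).1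
  add_left x y z := by rw [map_add, map_add]; rfl
  smul_left x y c := by rw [map_smul, LinearMap.map_smulₛₗ]; rfl

instance : SeminormedAddCommGroup X.Pre :=
  InnerProductSpace.Core.toSeminormedAddCommGroup (c := X.preCore)

instance : InnerProductSpace ℂ X.Pre := InnerProductSpace.ofCore X.preCore

/-- The Stinespring space `H_A`: the Hilbert space completion of `A ⊗ H₀` modulo null vectors. -/
abbrev HA : Type u := Completion X.Pre

/-- The class of `a ⊗ ξ` in `H_A`. -/
def ι (a : X.A) (ξ : X.H₀) : X.HA := ((X.toPre (a ⊗ₜ[ℂ] ξ) : X.Pre) : Completion X.Pre)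

/-- `b ⊗ η ↦ a b ⊗ η` on `A ⊗ H₀`. -/
def preMul (a : X.A) : X.A ⊗[ℂ] X.H₀ →ₗ[ℂ] X.A ⊗[ℂ] X.H₀ :=
  (LinearMap.mulLeft ℂ a).rTensor X.H₀

lemma form_preMul (a : X.A) (x y : X.A ⊗[ℂ] X.H₀) :
    X.form (X.preMul a x) (X.preMul a y) = X.form x (X.preMul (star a * a) y) := by
  induction x with
  | zero => simp
  | add x x' hx hx' => simp only [map_add, LinearMap.add_apply, hx, hx']
  | tmul b ξ =>
    induction y with
    | zero => simp
    | add y y' hy hy' => simp only [map_add, hy, hy']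
    | tmul c η => simp [preMul, form_tmul, mul_assoc]

lemma form_preMul_le (a : X.A) (x : X.A ⊗[ℂ] X.H₀) :
    X.form (X.preMul a x) (X.preMul a x) ≤ ((‖a‖ ^ 2 : ℝ) : ℂ) * X.form x x := by
  have h1 : 0 ≤ algebraMap ℝ X.A (‖a‖ ^ 2) - star a * a := by
    rw [sub_nonneg, pow_two, ← CStarRing.norm_star_mul_self]
    exact IsSelfAdjoint.le_algebraMap_norm_self (.star_mul_self a)
  obtain ⟨c, hc⟩ := CStarAlgebra.nonneg_iff_eq_star_mul_self.1 h1
  have h2 := X.form_nonneg (X.preMul c x)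
  rw [form_preMul, ← hc] at h2
  have h3 : X.preMul (algebraMap ℝ X.A (‖a‖ ^ 2) - star a * a) x =
      ((‖a‖ ^ 2 : ℝ) : ℂ) • x - X.preMul (star a * a) x := by
    have h4 : X.preMul (algebraMap ℝ X.A (‖a‖ ^ 2) - star a * a) =
        ((‖a‖ ^ 2 : ℝ) : ℂ) • LinearMap.id - X.preMul (star a * a) := by
      refine TensorProduct.ext' fun b ξ => ?_
      simp only [preMul, LinearMap.rTensor_tmul, LinearMap.mulLeft_apply, LinearMap.sub_apply,
        LinearMap.smul_apply, LinearMap.id_apply, sub_mul, TensorProduct.sub_tmul,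
        TensorProduct.smul_tmul', Algebra.algebraMap_eq_smul_one, smul_mul_assoc, one_mul]
      rfl
    rw [h4]; rfl
  rw [h3, map_sub, map_smul, sub_nonneg] at h2
  rw [form_preMul]
  exact h2

/-- `b ⊗ η ↦ a b ⊗ η` as a bounded operator for the seminorm of `Φ`. -/
def preRep (a : X.A) : X.Pre →L[ℂ] X.Pre :=
  (X.toPre.toLinearMap ∘ₗ X.preMul a ∘ₗ X.toPre.symm.toLinearMap).mkContinuous ‖a‖ fun x => by
    have h := (Complex.le_def.1 (X.form_preMul_le a (X.toPre.symm x))).1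
    rw [Complex.re_ofReal_mul] at h
    have h1 : ∀ y : X.Pre, (X.form (X.toPre.symm y) (X.toPre.symm y)).re = ‖y‖ ^ 2 :=
      fun y => inner_self_eq_norm_sq (𝕜 := ℂ) y
    rw [← sq_le_sq₀ (by positivity) (by positivity), mul_pow, ← h1, ← h1]
    exact h

/-- The Stinespring representation `π_Φ(a)`: the continuous extension of `b ⊗ η ↦ a b ⊗ η`. -/
def stinespringRep (a : X.A) : X.HA →L[ℂ] X.HA := (X.preRep a).completion

end CPos

/-- The complex involutive Banach-Lie group of invertible elements of a unital `C^*`-algebra. -/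
def unitsGroup (A : Type u) [CStarAlgebra A] : InvBanachLieGroup.{u} where
  carrier := Aˣ
  model := A
  smooth_star := by
    refine ContMDiff.of_comp_isOpenEmbedding Units.isOpenEmbedding_val ?_
    have h : ContDiff ℝ ∞ (star : A → A) := (starL' ℝ : A ≃L[ℝ] A).contDiff
    exact h.contMDiff.comp (Units.contMDiff_val (𝕜 := ℝ))

/-- The Stinespring data of `Φ`: the groups `G_A` and `G_B` of invertible elements of `A` and `B`, the
space `H_A`, the closure `H_B` of the image of `B ⊗ H₀` in `H_A`, which is the Stinespring space of the
restriction of `Φ` to `B`, and the restriction of `π_Φ` to `G_A`. -/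
def CPos.stinespring (X : CPos.{u}) : SRepData.{u} where
  GA := unitsGroup X.A
  GB := X.B.toSubalgebra.toSubmonoid.units
  HA := X.HA
  HB := (Submodule.span ℂ {x | ∃ b ∈ X.B, ∃ ξ, X.ι b ξ = x}).topologicalClosure
  rep := fun u : X.Aˣ => X.stinespringRep u

end PosKernel

end

/-! Three constructions have to be checked, and the analytic weight lies in the second.

For completely positive maps, the conditional expectation `E` is a bounded projection of `A` onto
`B`, so `B` is complemented. A closed unital `*`-subalgebra is inverse-closed, so inside the open
set of invertibles the group of `B` is cut out by the linear subspace `B`; this makes it a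
Banach-Lie subgroup. The estimate `norm_stinespringRep_le` makes the dilation a bounded linear map
on `A`, hence holomorphic on the invertibles. A morphism `(α, T)` induces a bounded `α ⊗ T` because
its inequality, applied to the Gram matrix of elements `a_i^* a_j`, is exactly an inequality between
the two semi-inner products (`Hom.exists_form_preMap_le`).

For representations, complementedness and the inverse function theorem give a chart of the group in
`V × W` whose first coordinate separates left cosets near `1` (`exists_sliceChart`). Its translates
give an atlas of the quotient together with holomorphic local sections of the quotient map. Along a
section, a fibre of the homogeneous bundle is identified with `H_B`, and the coordinate changes are
values of `π_B`. These are read through the compression of `π_A` to `H_B`, which is holomorphic on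
all of `G_A`. Maps out of the quotients are holomorphic as soon as their composites with the
quotient maps are, by inserting local sections. Representing a point by `u` and its image under the
involution by `u^{-*}` turns the pairing into the inner product of `H_B`, since `π_A(u^{-*})` is the
inverse of the adjoint of `π_A(u)`; the Riesz theorem then gives strong duality.

For transfer mappings, strong duality and the closed graph theorem yield the operators `S^{-*}`
(`LHer.exists_negStarAdjoint`). The sum defining positivity of the kernel is the squared norm of a
sum of transferred vectors, and the kernel inequality of a morphism is the inequality of the
transfer mappings.

The inequalities required of morphisms of representations and of transfer mappings compare squared
norms of `L x` and `x`, so boundedness of `L` supplies them for the morphisms that have to be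
constructed (`sum_sum_inner_le`). -/

noncomputable section

namespace PosKernel

open Filter Topology

/-! ### Restriction of scalars for maps between complex manifolds -/

section RestrictScalars

variable {E H M E' H' M' : Type*} [NormedAddCommGroup E] [NormedSpace ℂ E] [TopologicalSpace H]
  [TopologicalSpace M] [ChartedSpace H M] [NormedAddCommGroup E'] [NormedSpace ℂ E']
  [TopologicalSpace H'] [TopologicalSpace M'] [ChartedSpace H' M']

/-- A complex and a real model with corners with the same underlying maps. -/
structure SameModel (I : ModelWithCorners ℂ E H) (J : ModelWithCorners ℝ E H) : Prop where
  coe_eq : (I : H → E) = J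
  symm_eq : (I.symm : E → H) = J.symm

lemma sameModel_self : SameModel 𝓘(ℂ, E) 𝓘(ℝ, E) := ⟨rfl, rfl⟩

lemma SameModel.prod {I : ModelWithCorners ℂ E H} {J : ModelWithCorners ℝ E H}
    {I' : ModelWithCorners ℂ E' H'} {J' : ModelWithCorners ℝ E' H'} (h : SameModel I J)
    (h' : SameModel I' J') : SameModel (I.prod I') (J.prod J') := by
  refine ⟨funext fun x => ?_, funext fun x => ?_⟩
  · simp [h.coe_eq, h'.coe_eq]
  · change (I.symm x.1, I'.symm x.2) = (J.symm x.1, J'.symm x.2)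
    rw [h.symm_eq, h'.symm_eq]

variable {I : ModelWithCorners ℂ E H} {J : ModelWithCorners ℝ E H}
  {I' : ModelWithCorners ℂ E' H'} {J' : ModelWithCorners ℝ E' H'} {n : WithTop ℕ∞}
  {f : M → M'} {s : Set M} {x : M}

/-- The local expressions over the two fields are the same function, because the models have the
same underlying maps; only the scalars of its derivatives are restricted. -/
lemma contMDiffWithinAt_real (h : SameModel I J) (h' : SameModel I' J')
    (hf : ContMDiffWithinAt I I' n f s x) : ContMDiffWithinAt J J' n f s x := by
  rw [contMDiffWithinAt_iff] at hf ⊢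
  refine ⟨hf.1, ?_⟩
  have h2 := hf.2.restrict_scalars ℝ
  simpa only [extChartAt, OpenPartialHomeomorph.extend, PartialEquiv.coe_trans,
    PartialEquiv.coe_trans_symm, ModelWithCorners.toPartialEquiv_coe, Function.comp_def,
    ModelWithCorners.toPartialEquiv_coe_symm, h.coe_eq, h.symm_eq, h'.coe_eq, h'.symm_eq] using h2

lemma contMDiffAt_real (h : SameModel I J) (h' : SameModel I' J')
    (hf : ContMDiffAt I I' n f x) : ContMDiffAt J J' n f x :=
  contMDiffWithinAt_real h h' hf

lemma contMDiffOn_real (h : SameModel I J) (h' : SameModel I' J')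
    (hf : ContMDiffOn I I' n f s) : ContMDiffOn J J' n f s :=
  fun x hx => contMDiffWithinAt_real h h' (hf x hx)

lemma contMDiff_real (h : SameModel I J) (h' : SameModel I' J')
    (hf : ContMDiff I I' n f) : ContMDiff J J' n f :=
  fun x => contMDiffWithinAt_real h h' (hf x)

lemma isManifold_real (h : SameModel I J) [IsManifold I n M] : IsManifold J n M := by
  refine isManifold_of_contDiffOn J n M fun e e' he he' => ?_
  have h2 := (contDiffGroupoid n I).compatible he he'
  rw [contDiffGroupoid, mem_groupoid_of_pregroupoid] at h2
  have h3 := h2.1.restrict_scalars ℝ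
  simpa only [← h.coe_eq, ← h.symm_eq] using h3

end RestrictScalars

section RestrictScalarsBundle

variable {EB HB B F : Type*} {E : B → Type*} [NormedAddCommGroup EB] [NormedSpace ℂ EB]
  [TopologicalSpace HB] [NormedAddCommGroup F] [NormedSpace ℂ F]
  [∀ b, AddCommGroup (E b)] [∀ b, Module ℂ (E b)] [∀ b, TopologicalSpace (E b)]
  [TopologicalSpace B] [ChartedSpace HB B] [TopologicalSpace (TotalSpace F E)] [FiberBundle F E]

/-- The real coordinate change is the complex one followed by restriction of scalars on operators,
which is bounded and linear. -/
lemma contMDiffVectorBundle_real {I : ModelWithCorners ℂ EB HB} {J : ModelWithCorners ℝ EB HB}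
    (h : SameModel I J) {n : WithTop ℕ∞} [VectorBundle ℂ F E] [ContMDiffVectorBundle n F E I] :
    ContMDiffVectorBundle n F E J := by
  refine ⟨fun e e' _ _ => ?_⟩
  have h1 := ContMDiffVectorBundle.contMDiffOn_coordChangeL (IB := I) (n := n) (𝕜 := ℂ) e e'
  have h2 : ContMDiff 𝓘(ℝ, F →L[ℂ] F) 𝓘(ℝ, F →L[ℝ] F) n
      (fun f : F →L[ℂ] F => f.restrictScalars ℝ) :=
    (ContinuousLinearMap.restrictScalarsL ℂ F F ℝ ℝ).contDiff.contMDiff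
  refine (h2.comp_contMDiffOn (contMDiffOn_real h sameModel_self h1)).congr fun b hb => ?_
  ext y
  simp [Trivialization.coordChangeL_apply (R := ℝ) e e' hb,
    Trivialization.coordChangeL_apply (R := ℂ) e e' hb]

end RestrictScalarsBundle

/-! ### Slice charts of a group along a Banach-Lie subgroup -/

/-- A chart of `G` around `1` with values in a product `V × W` in which two points lie in the same
left coset of `S` if and only if they have the same coordinate in `V`. -/
structure SliceChart {E G : Type u} [NormedAddCommGroup E] [NormedSpace ℂ E] [Group G]
    [TopologicalSpace G] [ChartedSpace E G] (S : Subgroup G) where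
  V : Type u
  W : Type u
  [normV : NormedAddCommGroup V]
  [spaceV : NormedSpace ℂ V]
  [completeV : CompleteSpace V]
  [normW : NormedAddCommGroup W]
  [spaceW : NormedSpace ℂ W]
  equiv : E ≃L[ℂ] V × W
  τ : OpenPartialHomeomorph G (V × W)
  one_mem : 1 ∈ τ.source
  contMDiffOn : ContMDiffOn 𝓘(ℂ, E) 𝓘(ℂ, V × W) ω τ τ.source
  contMDiffOn_symm : ContMDiffOn 𝓘(ℂ, V × W) 𝓘(ℂ, E) ω τ.symm τ.target
  mem_iff : ∀ x ∈ τ.source, ∀ y ∈ τ.source, x⁻¹ * y ∈ S ↔ (τ x).1 = (τ y).1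

attribute [instance] SliceChart.normV SliceChart.spaceV SliceChart.completeV SliceChart.normW
  SliceChart.spaceW

section Slice

variable {E G : Type u} [NormedAddCommGroup E] [NormedSpace ℂ E] [CompleteSpace E] [Group G]
    [TopologicalSpace G] [ChartedSpace E G] [LieGroup 𝓘(ℂ, E) ω G]

/-- A submanifold chart of a complemented subgroup yields a slice chart. -/
theorem exists_sliceChart (S : Subgroup G) (W : Submodule ℂ E) (hW : W.ClosedComplemented)
    (hWc : IsClosed (W : Set E)) (φ : OpenPartialHomeomorph G E)
    (hφ : φ ∈ IsManifold.maximalAtlas 𝓘(ℂ, E) ω G) (h1 : (1 : G) ∈ φ.source)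
    (hS : ∀ x ∈ φ.source, x ∈ S ↔ φ x ∈ W) : Nonempty (SliceChart (E := E) S) := by
  obtain ⟨p, hp⟩ := hW
  have : CompleteSpace W := hWc.completeSpace_coe
  let V : Submodule ℂ E := LinearMap.ker (p : E →ₗ[ℂ] W)
  have hVc : IsClosed (V : Set E) := p.isClosed_ker
  have : CompleteSpace V := hVc.completeSpace_coe
  -- `V` is the kernel of the projection `p` onto `W`, and the inverse of this splitting is
  -- addition.
  let eq : E ≃L[ℂ] V × W :=
    (ContinuousLinearEquiv.equivOfRightInverse p W.subtypeL hp).trans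
      (ContinuousLinearEquiv.prodComm ℂ W V)
  have heq : ∀ q : V × W, eq.symm q = (q.1 : E) + q.2 := by
    intro q
    exact add_comm (q.2 : E) q.1
  have hsymm := contMDiffOn_symm_of_mem_maximalAtlas hφ
  have hφs := contMDiffOn_of_mem_maximalAtlas hφ
  set a := φ 1 with ha
  have haW : a ∈ W := (hS 1 h1).1 S.one_mem
  have haT : a ∈ φ.target := φ.map_source h1
  have hsa : φ.symm a = 1 := φ.left_inv h1
  have hsm : ∀ x ∈ φ.target, ContMDiffAt 𝓘(ℂ, E) 𝓘(ℂ, E) ω φ.symm x := fun x hx =>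
    hsymm.contMDiffAt (φ.open_target.mem_nhds hx)
  -- The group product replaces the sum `v + w`: the right factor lies in `S`, so moving in the `W`
  -- direction stays within a left coset.
  let Ψ : V × W → G := fun q => φ.symm (a + q.1) * φ.symm (a + q.2)
  have hc1 : ContDiff ℂ ω (fun q : V × W => a + (q.1 : E)) :=
    contDiff_const.add (V.subtypeL.contDiff.comp contDiff_fst)
  have hc2 : ContDiff ℂ ω (fun q : V × W => a + (q.2 : E)) :=
    contDiff_const.add (W.subtypeL.contDiff.comp contDiff_snd)
  have hΨ : ∀ q : V × W, a + (q.1 : E) ∈ φ.target → a + (q.2 : E) ∈ φ.target →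
      ContMDiffAt 𝓘(ℂ, V × W) 𝓘(ℂ, E) ω Ψ q := fun q hq1 hq2 =>
    ((hsm _ hq1).comp q hc1.contMDiff.contMDiffAt).mul
      ((hsm _ hq2).comp q hc2.contMDiff.contMDiffAt)
  have hΨ0 : Ψ 0 = 1 := by simp [Ψ, hsa]
  have hg : ∀ q : V × W, a + (q.1 : E) ∈ φ.target → a + (q.2 : E) ∈ φ.target →
      Ψ q ∈ φ.source → ContDiffAt ℂ ω (φ ∘ Ψ) q := fun q hq1 hq2 hq3 =>
    ((hφs.contMDiffAt (φ.open_source.mem_nhds hq3)).comp q (hΨ q hq1 hq2)).contDiffAt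
  have haT' : ∀ {X : Type u} [TopologicalSpace X] (f : X → E) (x : X), ContinuousAt f x →
      f x = 0 → ∀ᶠ y in 𝓝 x, a + f y ∈ φ.target := by
    intro X _ f x hf h0
    have h2 : ContinuousAt (fun y => a + f y) x := continuousAt_const.add hf
    refine h2.eventually_mem (φ.open_target.mem_nhds ?_)
    simpa [h0] using haT
  have hg0 : ContDiffAt ℂ ω (φ ∘ Ψ) 0 :=
    hg 0 (by simpa using haT) (by simpa using haT) (by rw [hΨ0]; exact h1)
  -- On each of the two axes one factor is `1`, so `φ ∘ Ψ` is there `a` plus the inclusion. The two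
  -- partial derivatives add up to the splitting `V × W ≃ E`, and the inverse function theorem
  -- applies.
  have hD : HasFDerivAt (φ ∘ Ψ) (eq.symm : V × W →L[ℂ] E) 0 := by
    have hd := (hg0.differentiableAt (by simp)).hasFDerivAt
    have e1 : HasFDerivAt (fun v : V => (φ ∘ Ψ) (v, 0)) V.subtypeL 0 := by
      have h2 : HasFDerivAt (fun v : V => a + (v : E)) V.subtypeL 0 :=
        V.subtypeL.hasFDerivAt.const_add a
      refine h2.congr_of_eventuallyEq ?_
      filter_upwards [haT' (fun v : V => (v : E)) 0 (by fun_prop) rfl] with v hv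
      simp [Ψ, hsa, φ.right_inv hv]
    have e2 : HasFDerivAt (fun w : W => (φ ∘ Ψ) (0, w)) W.subtypeL 0 := by
      have h2 : HasFDerivAt (fun w : W => a + (w : E)) W.subtypeL 0 :=
        W.subtypeL.hasFDerivAt.const_add a
      refine h2.congr_of_eventuallyEq ?_
      filter_upwards [haT' (fun v : W => (v : E)) 0 (by fun_prop) rfl] with v hv
      simp [Ψ, hsa, φ.right_inv hv]
    have d1 : HasFDerivAt (fun v : V => (φ ∘ Ψ) (v, 0)) _ 0 :=
      HasFDerivAt.comp (0 : V) (f := fun v : V => (v, (0 : W))) hd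
        (ContinuousLinearMap.inl ℂ V W).hasFDerivAt
    have d2 : HasFDerivAt (fun w : W => (φ ∘ Ψ) (0, w)) _ 0 :=
      HasFDerivAt.comp (0 : W) (f := fun w : W => ((0 : V), w)) hd
        (ContinuousLinearMap.inr ℂ V W).hasFDerivAt
    have u1 := d1.unique e1
    have u2 := d2.unique e2
    have key : (eq.symm : V × W →L[ℂ] E) = fderiv ℂ (φ ∘ Ψ) 0 := ?_
    · rw [key]
      exact hd
    refine ContinuousLinearMap.ext fun q => ?_
    have k1 := DFunLike.congr_fun u1 q.1
    have k2 := DFunLike.congr_fun u2 q.2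
    have k3 : q = (q.1, 0) + (0, q.2) := by simp
    conv_rhs => rw [k3, map_add]
    refine (heq q).trans (congrArg₂ _ k1.symm k2.symm)
  let Ξ : OpenPartialHomeomorph (V × W) E := hg0.toOpenPartialHomeomorph _ hD (by simp)
  have hΞ : (Ξ : V × W → E) = φ ∘ Ψ := rfl
  have h0 : (0 : V × W) ∈ Ξ.source := hg0.mem_toOpenPartialHomeomorph_source hD (by simp)
  have hΞ0 : Ξ 0 = a := by rw [hΞ, Function.comp_apply, hΨ0]
  have hinv : ContDiffAt ℂ ω Ξ.symm (Ξ 0) := hg0.to_localInverse hD (by simp)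
  -- A quotient of two slice points that lies in `S` and near `1` is `φ.symm (a + w)` for a small
  -- `w` in `W`. Hence `Ψ (v, w) = Ψ (v', 0)`, and local injectivity of `Ξ` forces `v = v'`.
  have hsep : ∀ᶠ q : V × V in 𝓝 (0, 0),
      (φ.symm (a + q.1))⁻¹ * φ.symm (a + q.2) ∈ S → q.1 = q.2 := by
    let k : V × V → G := fun q => (φ.symm (a + q.1))⁻¹ * φ.symm (a + q.2)
    have hk0 : k (0, 0) = 1 := by simp [k]
    have hkc : ContinuousAt k (0, 0) := by
      have := topologicalGroup_of_lieGroup 𝓘(ℂ, E) ω (G := G)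
      have c0 : ContinuousAt φ.symm a := φ.continuousAt_symm haT
      have c1 : ContinuousAt (fun q : V × V => φ.symm (a + (q.1 : E))) (0, 0) :=
        ContinuousAt.comp (f := fun q : V × V => a + (q.1 : E)) (by simpa using c0)
          (by fun_prop)
      have c2 : ContinuousAt (fun q : V × V => φ.symm (a + (q.2 : E))) (0, 0) :=
        ContinuousAt.comp (f := fun q : V × V => a + (q.2 : E)) (by simpa using c0)
          (by fun_prop)
      exact c1.inv.mul c2
    have hkφ : ContinuousAt (φ ∘ k) (0, 0) :=
      ContinuousAt.comp (by rw [hk0]; exact φ.continuousAt h1) hkc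
    have n1 : ∀ᶠ q in 𝓝 ((0 : V), (0 : V)), k q ∈ φ.source :=
      hkc.eventually_mem (φ.open_source.mem_nhds (by rw [hk0]; exact h1))
    -- Applying `p` gives a continuous `W`-valued candidate for `w` before `φ (k q) - a` is known to
    -- lie in `W`; once it does, `p` fixes it.
    have n2 : ∀ᶠ q in 𝓝 ((0 : V), (0 : V)), ((q.1, p (φ (k q) - a)) : V × W) ∈ Ξ.source := by
      have c : ContinuousAt (fun q : V × V => ((q.1, p (φ (k q) - a)) : V × W)) (0, 0) :=
        continuousAt_fst.prodMk (p.continuous.continuousAt.comp (hkφ.sub continuousAt_const))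
      refine c.eventually_mem (Ξ.open_source.mem_nhds ?_)
      have h2 : p (φ (k (0, 0)) - a) = 0 := by rw [hk0, ← ha, sub_self, map_zero]
      rw [h2]
      exact h0
    have n3 : ∀ᶠ q in 𝓝 ((0 : V), (0 : V)), ((q.2, 0) : V × W) ∈ Ξ.source := by
      have c : ContinuousAt (fun q : V × V => ((q.2, 0) : V × W)) (0, 0) := by fun_prop
      exact c.eventually_mem (Ξ.open_source.mem_nhds h0)
    filter_upwards [n1, n2, n3] with q m1 m2 m3 hq
    have hw : φ (k q) - a ∈ W := W.sub_mem ((hS _ m1).1 hq) haW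
    have hpw : ((p (φ (k q) - a) : W) : E) = φ (k q) - a :=
      congrArg Subtype.val (hp ⟨_, hw⟩)
    have h3 : Ξ (q.1, p (φ (k q) - a)) = Ξ (q.2, 0) := by
      rw [hΞ]
      simp only [Function.comp_apply, Ψ, hpw, add_sub_cancel, φ.left_inv m1]
      simp [k, hsa]
    exact congrArg Prod.fst (Ξ.injOn m2 m3 h3)
  obtain ⟨N, hN, hN'⟩ : ∃ N ∈ 𝓝 (0 : V), ∀ v ∈ N, ∀ v' ∈ N,
      (φ.symm (a + v))⁻¹ * φ.symm (a + v') ∈ S → v = v' := by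
    rw [nhds_prod_eq] at hsep
    obtain ⟨t, ht, ht'⟩ :=
      (eventually_prod_self_iff
        (r := fun v v' : V => (φ.symm (a + v))⁻¹ * φ.symm (a + v') ∈ S → v = v')).1 hsep
    exact ⟨t, ht, fun v hv v' hv' h => ht' v hv v' hv' h⟩
  -- All requirements hold near `0`, so one open set `Q` serves for them together. The last one is
  -- analyticity of the local inverse, known at the centre and an open condition.
  have hall : ∀ᶠ q : V × W in 𝓝 0, q.1 ∈ N ∧ a + (q.1 : E) ∈ φ.target ∧
      a + (q.2 : E) ∈ φ.target ∧ Ψ q ∈ φ.source ∧ ContDiffAt ℂ ω Ξ.symm (Ξ q) := by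
    refine .and ?_ (.and ?_ (.and ?_ (.and ?_ ?_)))
    · exact continuousAt_fst.eventually_mem hN
    · exact haT' (fun q : V × W => (q.1 : E)) 0 (by fun_prop) rfl
    · exact haT' (fun q : V × W => (q.2 : E)) 0 (by fun_prop) rfl
    · exact (hΨ 0 (by simpa using haT) (by simpa using haT)).continuousAt.eventually_mem
        (φ.open_source.mem_nhds (by rw [hΨ0]; exact h1))
    · exact (Ξ.continuousAt h0).eventually (hinv.eventually (by simp))
  obtain ⟨Q, hQ, hQo, h0Q⟩ := eventually_nhds_iff.1 hall
  let τ' : OpenPartialHomeomorph (V × W) G := (Ξ.trans φ.symm).restrOpen Q hQo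
  have hsrc : ∀ q ∈ τ'.source, q ∈ Q ∧ q ∈ Ξ.source := by
    intro q hq
    have h2 : q ∈ (Ξ.trans φ.symm).source ∩ Q := hq
    exact ⟨h2.2, (OpenPartialHomeomorph.trans_source Ξ φ.symm ▸ h2.1).1⟩
  have hτ : ∀ q ∈ Q, τ' q = Ψ q := fun q hq => φ.left_inv (hQ q hq).2.2.2.1
  have h0τ : (0 : V × W) ∈ τ'.source := by
    change (0 : V × W) ∈ (Ξ.trans φ.symm).source ∩ Q
    refine ⟨?_, h0Q⟩
    rw [OpenPartialHomeomorph.trans_source]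
    exact ⟨h0, by rw [Set.mem_preimage, hΞ0]; exact haT⟩
  have hmemS : ∀ q ∈ Q, φ.symm (a + (q.2 : E)) ∈ S := by
    intro q hq
    have h2 := (hQ q hq).2.2.1
    rw [hS _ (φ.map_target h2), φ.right_inv h2]
    exact W.add_mem haW q.2.2
  refine ⟨⟨V, W, eq, τ'.symm, ?_, ?_, ?_, ?_⟩⟩
  · have := τ'.map_source h0τ
    rwa [hτ 0 h0Q, hΨ0] at this
  · intro x hx
    have hx' : x ∈ τ'.target := hx
    have hq := hsrc _ (τ'.map_target hx')
    have hxe : Ψ (τ'.symm x) = x := by rw [← hτ _ hq.1, τ'.right_inv hx']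
    have hxs : x ∈ φ.source := by rw [← hxe]; exact (hQ _ hq.1).2.2.2.1
    have h2 := (hQ _ hq.1).2.2.2.2
    have h3 : Ξ (τ'.symm x) = φ x := by rw [hΞ, Function.comp_apply, hxe]
    rw [h3] at h2
    exact (h2.contMDiffAt.comp x
      (hφs.contMDiffAt (φ.open_source.mem_nhds hxs))).contMDiffWithinAt
  · intro q hq
    have hq' := hsrc q hq
    refine ((hΨ q (hQ q hq'.1).2.1 (hQ q hq'.1).2.2.1).congr_of_eventuallyEq
      ?_).contMDiffWithinAt
    filter_upwards [hQo.mem_nhds hq'.1] with r hr using hτ r hr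
  · intro x hx y hy
    have hq := hsrc _ (τ'.map_target hx)
    have hr := hsrc _ (τ'.map_target hy)
    have hxe : Ψ (τ'.symm x) = x := by rw [← hτ _ hq.1, τ'.right_inv hx]
    have hye : Ψ (τ'.symm y) = y := by rw [← hτ _ hr.1, τ'.right_inv hy]
    generalize hqq : τ'.symm x = q at *
    generalize hrr : τ'.symm y = r at *
    have hm1 := hmemS q hq.1
    have hm2 := hmemS r hr.1
    -- The outer factors come from `W` and lie in `S`, so membership of `x⁻¹ * y` in `S` depends
    -- only on the `V`-coordinates, which `N` separates.
    have h5 : x⁻¹ * y = (φ.symm (a + (q.2 : E)))⁻¹ *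
        ((φ.symm (a + (q.1 : E)))⁻¹ * φ.symm (a + (r.1 : E))) * φ.symm (a + (r.2 : E)) := by
      rw [← hxe, ← hye]
      simp only [Ψ, mul_inv_rev, mul_assoc]
    rw [h5, S.mul_mem_cancel_right hm2, S.mul_mem_cancel_left (S.inv_mem hm1)]
    constructor
    · exact hN' _ (hQ q hq.1).1 _ (hQ r hr.1).1
    · intro h
      rw [h, inv_mul_cancel]
      exact S.one_mem

end Slice

/-! ### The quotient of a Banach-Lie group by a complemented subgroup -/

namespace SliceChart

variable {E G : Type u} [NormedAddCommGroup E] [NormedSpace ℂ E] [Group G]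
  [TopologicalSpace G] [ChartedSpace E G] {S : Subgroup G} (C : SliceChart (E := E) S)

/-- The points of `V` whose translate along the slice through `1` lies in the chart. -/
def dom : Set C.V := {v | (v, (C.τ 1).2) ∈ C.τ.target}

/-- The slice through `1`. -/
def sec₀ (v : C.V) : G := C.τ.symm (v, (C.τ 1).2)

/-- A neighbourhood of `1` whose points are in the coset of a point of the slice through `1`. -/
def nbhd : Set G := C.τ.source ∩ C.τ ⁻¹' (Prod.fst ⁻¹' C.dom)

lemma isOpen_dom : IsOpen C.dom :=
  C.τ.open_target.preimage (by fun_prop)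

lemma isOpen_nbhd : IsOpen C.nbhd :=
  C.τ.isOpen_inter_preimage (C.isOpen_dom.preimage continuous_fst)

lemma τ_sec₀ {v : C.V} (hv : v ∈ C.dom) : C.τ (C.sec₀ v) = (v, (C.τ 1).2) := C.τ.right_inv hv

lemma sec₀_mem_source {v : C.V} (hv : v ∈ C.dom) : C.sec₀ v ∈ C.τ.source := C.τ.map_target hv

lemma sec₀_mem {v : C.V} (hv : v ∈ C.dom) : C.sec₀ v ∈ C.nbhd :=
  ⟨C.sec₀_mem_source hv, by
    rw [Set.mem_preimage, C.τ_sec₀ hv]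
    exact hv⟩

lemma one_mem_dom : (C.τ 1).1 ∈ C.dom := C.τ.map_source C.one_mem

lemma one_mem_nbhd : 1 ∈ C.nbhd := ⟨C.one_mem, C.one_mem_dom⟩

lemma mk_eq_iff {x y : G} (hx : x ∈ C.nbhd) (hy : y ∈ C.nbhd) :
    (QuotientGroup.mk x : G ⧸ S) = QuotientGroup.mk y ↔ (C.τ x).1 = (C.τ y).1 :=
  QuotientGroup.eq.trans (C.mem_iff x hx.1 y hy.1)

lemma mk_sec₀ {x : G} (hx : x ∈ C.nbhd) :
    (QuotientGroup.mk (C.sec₀ (C.τ x).1) : G ⧸ S) = QuotientGroup.mk x := by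
  rw [C.mk_eq_iff (C.sec₀_mem hx.2) hx, C.τ_sec₀ hx.2]

open Classical in
/-- The coordinate on `G ⧸ S` around the base point. -/
def coord₀ (z : G ⧸ S) : C.V :=
  if h : ∃ x ∈ C.nbhd, QuotientGroup.mk x = z then (C.τ h.choose).1 else 0

/-- The representative chosen in `coord₀` is immaterial: points of `nbhd` in one coset share their
`V`-coordinate. -/
lemma coord₀_mk {x : G} (hx : x ∈ C.nbhd) : C.coord₀ (QuotientGroup.mk x : G ⧸ S) = (C.τ x).1 := by
  have h : ∃ y ∈ C.nbhd, (QuotientGroup.mk y : G ⧸ S) = QuotientGroup.mk x := ⟨x, hx, rfl⟩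
  rw [coord₀, dif_pos h]
  exact (C.mk_eq_iff h.choose_spec.1 hx).1 h.choose_spec.2

lemma contMDiffOn_sec₀ : ContMDiffOn 𝓘(ℂ, C.V) 𝓘(ℂ, E) ω C.sec₀ C.dom := by
  have h : ContMDiff 𝓘(ℂ, C.V) 𝓘(ℂ, C.V × C.W) ω (fun v : C.V => (v, (C.τ 1).2)) :=
    (contDiff_id.prodMk contDiff_const).contMDiff
  exact C.contMDiffOn_symm.comp h.contMDiffOn fun v hv => hv

variable [IsTopologicalGroup G]

/-- The chart of `G ⧸ S` around the base point. -/
def chart₀ : OpenPartialHomeomorph (G ⧸ S) C.V where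
  toFun := C.coord₀
  invFun v := QuotientGroup.mk (C.sec₀ v)
  source := QuotientGroup.mk '' C.nbhd
  target := C.dom
  map_source' := by
    rintro _ ⟨x, hx, rfl⟩
    rw [C.coord₀_mk hx]
    exact hx.2
  map_target' v hv := ⟨_, C.sec₀_mem hv, rfl⟩
  left_inv' := by
    rintro _ ⟨x, hx, rfl⟩
    rw [C.coord₀_mk hx, C.mk_sec₀ hx]
  right_inv' v hv := by rw [C.coord₀_mk (C.sec₀_mem hv), C.τ_sec₀ hv]
  open_source := QuotientGroup.isOpenMap_coe _ C.isOpen_nbhd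
  open_target := C.isOpen_dom
  continuousOn_toFun := by
    rintro _ ⟨x, hx, rfl⟩
    refine ContinuousAt.continuousWithinAt ?_
    -- Continuity can be tested after composing with an open quotient map, where the coordinate
    -- becomes the first component of `τ`.
    have hq : IsOpenQuotientMap (QuotientGroup.mk : G → G ⧸ S) :=
      QuotientGroup.isOpenQuotientMap_mk
    rw [← hq.continuousAt_comp_iff]
    have h2 : ContinuousAt (fun y => (C.τ y).1) x :=
      continuousAt_fst.comp (C.τ.continuousAt hx.1)
    refine h2.congr ?_
    filter_upwards [C.isOpen_nbhd.mem_nhds hx] with y hy using (C.coord₀_mk hy).symm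
  continuousOn_invFun := QuotientGroup.continuous_mk.comp_continuousOn
    (C.contMDiffOn_sec₀.continuousOn)

/-- The translate of `chart₀` around the coset of `g`. -/
def chart (g : G) : OpenPartialHomeomorph (G ⧸ S) C.V :=
  (Homeomorph.smul g⁻¹).transOpenPartialHomeomorph C.chart₀

/-- The local section of `G → G ⧸ S` through `g`. -/
def sec (g : G) (z : G ⧸ S) : G := g * C.sec₀ (C.chart g z)

lemma chart_apply (g : G) (z : G ⧸ S) : C.chart g z = C.coord₀ (g⁻¹ • z) := rfl

lemma chart_symm_apply (g : G) (v : C.V) : (C.chart g).symm v = QuotientGroup.mk (g * C.sec₀ v) := by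
  change (g⁻¹)⁻¹ • (QuotientGroup.mk (C.sec₀ v) : G ⧸ S) = _
  rw [inv_inv]; rfl

lemma mem_chart_source {g : G} {z : G ⧸ S} :
    z ∈ (C.chart g).source ↔ ∃ x ∈ C.nbhd, QuotientGroup.mk (g * x) = z := by
  change g⁻¹ • z ∈ QuotientGroup.mk '' C.nbhd ↔ _
  refine exists_congr fun x => and_congr_right fun _ => ?_
  rw [eq_inv_smul_iff]; rfl

lemma mk_mem_chart_source (g : G) : (QuotientGroup.mk g : G ⧸ S) ∈ (C.chart g).source :=
  C.mem_chart_source.2 ⟨1, C.one_mem_nbhd, by rw [mul_one]⟩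

lemma mk_sec {g : G} {z : G ⧸ S} (hz : z ∈ (C.chart g).source) :
    (QuotientGroup.mk (C.sec g z) : G ⧸ S) = z := by
  have := (C.chart g).left_inv hz
  rwa [chart_symm_apply] at this

/-- The atlas of `G ⧸ S` given by the translates of the chart around the base point. -/
@[reducible]
def chartedSpace : ChartedSpace C.V (G ⧸ S) where
  atlas := Set.range C.chart
  chartAt z := C.chart z.out
  mem_chart_source z := by
    have := C.mk_mem_chart_source z.out
    rwa [QuotientGroup.out_eq'] at this
  chart_mem_atlas z := ⟨_, rfl⟩

variable [LieGroup 𝓘(ℂ, E) ω G]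

/-- The representative `y` need not lie in the translate of `nbhd` by `g`, but some `g * x` in its
coset does. Right multiplication by `y⁻¹ * (g * x)`, an element of `S`, moves `y` there without
changing cosets, and the slice chart then computes the coordinate. -/
lemma contMDiffOn_chart_mk (g : G) :
    ContMDiffOn 𝓘(ℂ, E) 𝓘(ℂ, C.V) ω (fun y : G => C.chart g (QuotientGroup.mk y))
      (QuotientGroup.mk ⁻¹' (C.chart g).source) := by
  intro y hy
  obtain ⟨x, hx, hxy⟩ := C.mem_chart_source.1 hy
  refine ContMDiffAt.contMDiffWithinAt ?_
  have hh : y⁻¹ * (g * x) ∈ S := QuotientGroup.eq.1 hxy.symm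
  have hm : ∀ y', g⁻¹ • (QuotientGroup.mk y' : G ⧸ S) =
      QuotientGroup.mk (g⁻¹ * (y' * (y⁻¹ * (g * x)))) := by
    intro y'
    have : (QuotientGroup.mk y' : G ⧸ S) = QuotientGroup.mk (y' * (y⁻¹ * (g * x))) :=
      (QuotientGroup.mk_mul_of_mem y' hh).symm
    rw [this]; rfl
  have h1 : ContMDiff 𝓘(ℂ, E) 𝓘(ℂ, E) ω (fun y' : G => g⁻¹ * (y' * (y⁻¹ * (g * x)))) :=
    contMDiff_mul_left.comp contMDiff_mul_right
  have hx' : g⁻¹ * (y * (y⁻¹ * (g * x))) = x := by group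
  have h2 : ContMDiffAt 𝓘(ℂ, E) 𝓘(ℂ, C.V × C.W) ω
      (fun y' : G => C.τ (g⁻¹ * (y' * (y⁻¹ * (g * x))))) y := by
    refine ContMDiffAt.comp y ?_ h1.contMDiffAt
    rw [hx']
    exact C.contMDiffOn.contMDiffAt (C.τ.open_source.mem_nhds hx.1)
  have h3 : ContMDiffAt 𝓘(ℂ, E) 𝓘(ℂ, C.V) ω
      (fun y' : G => (C.τ (g⁻¹ * (y' * (y⁻¹ * (g * x))))).1) y :=
    (contDiff_fst.contMDiff.contMDiffAt).comp y h2
  refine h3.congr_of_eventuallyEq ?_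
  have h4 := h1.continuous.continuousAt.eventually_mem (x := y)
    (C.isOpen_nbhd.mem_nhds (by rw [hx']; exact hx))
  filter_upwards [h4] with y' hy'
  rw [chart_apply, hm, C.coord₀_mk hy']

/-- A transition map lifts through the group: it is the slice translated by `g`, followed by the
chart at `g'` composed with the quotient map, and both are holomorphic. -/
lemma isManifold : letI := C.chartedSpace; IsManifold 𝓘(ℂ, C.V) ω (G ⧸ S) := by
  let := C.chartedSpace
  refine isManifold_of_contDiffOn _ _ _ ?_
  rintro _ _ ⟨g, rfl⟩ ⟨g', rfl⟩
  simp only [modelWithCornersSelf_coe, modelWithCornersSelf_coe_symm, Function.id_comp,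
    Function.comp_id, Set.preimage_id, Set.range_id, Set.inter_univ]
  rw [← contMDiffOn_iff_contDiffOn]
  have h1 : ContMDiffOn 𝓘(ℂ, C.V) 𝓘(ℂ, E) ω (fun v => g * C.sec₀ v) C.dom :=
    (contMDiff_mul_left (a := g)).comp_contMDiffOn C.contMDiffOn_sec₀
  have h2 : (((C.chart g).symm.trans (C.chart g') : OpenPartialHomeomorph C.V C.V) : C.V → C.V) =
      (fun y : G => C.chart g' (QuotientGroup.mk y)) ∘ fun v => g * C.sec₀ v := by
    funext v
    rw [OpenPartialHomeomorph.coe_trans, Function.comp_apply, chart_symm_apply]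
    rfl
  rw [h2, OpenPartialHomeomorph.trans_source]
  refine (C.contMDiffOn_chart_mk g').comp (h1.mono fun v hv => hv.1) fun v hv => ?_
  have := hv.2
  rw [Set.mem_preimage, chart_symm_apply] at this
  exact this

lemma chart_mem_maximalAtlas (g : G) :
    letI := C.chartedSpace; C.chart g ∈ IsManifold.maximalAtlas 𝓘(ℂ, C.V) ω (G ⧸ S) := by
  let := C.chartedSpace
  have := C.isManifold
  exact IsManifold.subset_maximalAtlas ⟨g, rfl⟩

lemma contMDiff_mk :
    letI := C.chartedSpace
    ContMDiff 𝓘(ℂ, E) 𝓘(ℂ, C.V) ω (QuotientGroup.mk : G → G ⧸ S) := by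
  let := C.chartedSpace
  have := C.isManifold
  intro g
  have h1 := (C.contMDiffOn_chart_mk g).contMDiffAt (x := g)
    (((C.chart g).open_source.preimage QuotientGroup.continuous_mk).mem_nhds
      (C.mk_mem_chart_source g))
  have h2 : ContMDiffAt 𝓘(ℂ, C.V) 𝓘(ℂ, C.V) ω (C.chart g).symm
      (C.chart g (QuotientGroup.mk g)) :=
    contMDiffAt_symm_of_mem_maximalAtlas (C.chart_mem_maximalAtlas g)
      ((C.chart g).map_source (C.mk_mem_chart_source g))
  refine (h2.comp g h1).congr_of_eventuallyEq ?_
  filter_upwards [((C.chart g).open_source.preimage QuotientGroup.continuous_mk).mem_nhds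
      (C.mk_mem_chart_source g)] with y hy
  exact ((C.chart g).left_inv hy).symm

lemma contMDiffOn_sec (g : G) :
    letI := C.chartedSpace
    ContMDiffOn 𝓘(ℂ, C.V) 𝓘(ℂ, E) ω (C.sec g) (C.chart g).source := by
  let := C.chartedSpace
  have := C.isManifold
  exact (contMDiff_mul_left (a := g)).comp_contMDiffOn (C.contMDiffOn_sec₀.comp
    (contMDiffOn_of_mem_maximalAtlas (C.chart_mem_maximalAtlas g))
    fun z hz => (C.chart g).map_source hz)

end SliceChart

/-! ### The bundle `G_A ×_{G_B} H_B` -/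

instance (G : InvBanachLieGroup.{u}) : IsTopologicalGroup G :=
  topologicalGroup_of_lieGroup 𝓘(ℂ, G.model) ω

namespace SRep

variable (X : SRep.{u})

lemma nonempty_sliceChart : Nonempty (SliceChart (E := X.data.GA.model) X.data.GB) := by
  obtain ⟨W, hW, hWc, h⟩ := X.isSRep.isBanachLieSubgroup
  obtain ⟨φ, hφ, h1, h2⟩ := h 1 X.data.GB.one_mem
  exact exists_sliceChart _ W hW hWc φ hφ h1 h2

/-- A slice chart of `G_A` along `G_B`. -/
def slice : SliceChart (E := X.data.GA.model) X.data.GB := X.nonempty_sliceChart.some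

instance chartedBase : ChartedSpace X.slice.V X.Base := X.slice.chartedSpace

instance : IsManifold 𝓘(ℂ, X.slice.V) ω X.Base := X.slice.isManifold

instance : CompleteSpace X.data.HB := X.isSRep.isClosed_HB.completeSpace_coe

/-- `P π_A(u) ∣ H_B` where `P` is the orthogonal projection onto `H_B`. -/
def compress (u : X.data.GA) : X.data.HB →L[ℂ] X.data.HB :=
  X.data.HB.orthogonalProjectionOnto.comp ((X.data.rep u).comp X.data.HB.subtypeL)

lemma compress_eq (w : X.data.GB) (f : X.data.HB) : X.compress w.1 f = X.repB w f :=
  Submodule.orthogonalProjectionOnto_mem_subspace_eq_self (X.repB w f)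

lemma coe_compress {w : X.data.GA} (hw : w ∈ X.data.GB) (f : X.data.HB) :
    (X.compress w f : X.data.HA) = X.data.rep w f :=
  congrArg Subtype.val (X.compress_eq ⟨w, hw⟩ f)

lemma contMDiff_rep : ContMDiff 𝓘(ℂ, X.data.GA.model) 𝓘(ℂ, X.data.HA →L[ℂ] X.data.HA) ω
    X.data.rep := X.isSRep.isRep.holomorphic

/-- The compression is defined on all of `G_A` and equals `π_B` on `G_B`. It makes `π_B` of a
holomorphic map with values in `G_B` holomorphic in operator norm, with no need for a manifold
structure on `G_B`. -/
lemma contMDiff_compress :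
    ContMDiff 𝓘(ℂ, X.data.GA.model) 𝓘(ℂ, X.data.HB →L[ℂ] X.data.HB) ω X.compress := by
  have h1 : ContDiff ℂ ω (fun T : X.data.HA →L[ℂ] X.data.HA =>
      X.data.HB.orthogonalProjectionOnto.comp (T.comp X.data.HB.subtypeL)) :=
    contDiff_const.clm_comp (contDiff_id.clm_comp contDiff_const)
  exact h1.contMDiff.comp X.contMDiff_rep

lemma rep_mul_apply (u v : X.data.GA) (x : X.data.HA) :
    X.data.rep (u * v) x = X.data.rep u (X.data.rep v x) :=
  DFunLike.congr_fun (X.isSRep.isRep.map_mul u v) x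

/-! ### Fibre coordinates and local trivializations of the homogeneous bundle. -/

variable {X}

/-- `[(u, f)]` as an element of the fibre over `z = u G_B`. -/
def fib {z : X.Base} (u : X.data.GA) (h : QuotientGroup.mk u = z) (f : X.data.HB) : X.Fiber z :=
  ⟨cls u f, h⟩

lemma fib_eq {z : X.Base} {u : X.data.GA} (h : QuotientGroup.mk u = z) (d : X.Fiber z) :
    ∃ f, d = fib u h f := by
  subst h
  exact X.fiber_eq u d

variable (X)

/-- The coordinate of `d ∈ D_z` in `H_B` along the representative `u` of `z`. -/
def coordAt (u : X.data.GA) (z : X.Base) : X.Fiber z →L[ℂ] X.data.HB :=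
  X.data.HB.orthogonalProjectionOnto.comp ((X.data.rep u⁻¹).comp (X.fiberTransferL z))

variable {X}

lemma coordAt_fib_self {z : X.Base} (u : X.data.GA) (h : QuotientGroup.mk u = z) (f : X.data.HB) :
    X.coordAt u z (fib u h f) = f := by
  change X.data.HB.orthogonalProjectionOnto (X.data.rep u⁻¹ (X.data.rep u f)) = f
  rw [rep_inv_rep]
  exact Submodule.orthogonalProjectionOnto_mem_subspace_eq_self f

/-- This is the cocycle of the bundle: replacing the representative `v` by `u` acts on coordinates
through the element `u⁻¹ * v` of `G_B`. -/
lemma coordAt_fib {z : X.Base} (u v : X.data.GA) (h : QuotientGroup.mk v = z) (f : X.data.HB) :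
    X.coordAt u z (fib v h f) = X.compress (u⁻¹ * v) f := by
  change X.data.HB.orthogonalProjectionOnto (X.data.rep u⁻¹ (X.data.rep v f)) = _
  rw [← rep_mul_apply]; rfl

lemma fib_coordAt {z : X.Base} (u : X.data.GA) (h : QuotientGroup.mk u = z) (d : X.Fiber z) :
    fib u h (X.coordAt u z d) = d := by
  obtain ⟨f, rfl⟩ := fib_eq h d
  rw [coordAt_fib_self]

lemma isInducing_coordAt {z : X.Base} (u : X.data.GA) (h : QuotientGroup.mk u = z) :
    IsInducing (X.coordAt u z) := by
  have h1 : IsInducing (X.fiberTransferL z) := ⟨rfl⟩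
  have h2 : X.fiberTransferL z = fun d => X.data.rep u (X.coordAt u z d : X.data.HA) := by
    funext d
    obtain ⟨f, rfl⟩ := fib_eq h d
    rw [coordAt_fib_self]; rfl
  -- The fibre topology is induced by the transfer map, which factors through the coordinate
  -- followed by the continuous operator `π_A(u)`.
  refine IsInducing.of_comp (X.coordAt u z).continuous
    (g := fun f : X.data.HB => X.data.rep u (f : X.data.HA)) ?_ ?_
  · exact (X.data.rep u).continuous.comp continuous_subtype_val
  · change IsInducing (fun d => X.data.rep u (X.coordAt u z d : X.data.HA))
    rw [← h2]
    exact h1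

variable (X)

open Classical in
/-- `[(u, f)]` as an element of the fibre over `z` if `z = u G_B`. -/
def lift (u : X.data.GA) (z : X.Base) (f : X.data.HB) : X.Fiber z :=
  -- The value `0` only makes the inverse trivialization total; over the chart domain `u` always
  -- represents `z`.
  if h : QuotientGroup.mk u = z then fib u h f else 0

variable {X} in
lemma lift_eq {u : X.data.GA} {z : X.Base} (h : QuotientGroup.mk u = z) (f : X.data.HB) :
    X.lift u z f = fib u h f := dif_pos h

/-- The local trivialization of the bundle along the local section of `G_A → G_A / G_B` through
`g`. -/
def pretriv (g : X.data.GA) : Pretrivialization X.data.HB (π X.data.HB X.Fiber) where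
  toFun d := (d.1, X.coordAt (X.slice.sec g d.1) d.1 d.2)
  invFun p := ⟨p.1, X.lift (X.slice.sec g p.1) p.1 p.2⟩
  source := TotalSpace.proj ⁻¹' (X.slice.chart g).source
  target := (X.slice.chart g).source ×ˢ Set.univ
  map_source' d hd := ⟨hd, trivial⟩
  map_target' p hp := hp.1
  left_inv' := by
    rintro ⟨z, d⟩ hd
    have h : QuotientGroup.mk (X.slice.sec g z) = z := X.slice.mk_sec hd
    simp only [lift_eq h, fib_coordAt]
  right_inv' := by
    rintro ⟨z, f⟩ hp
    have h : QuotientGroup.mk (X.slice.sec g z) = z := X.slice.mk_sec hp.1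
    simp only [lift_eq h, coordAt_fib_self]
  open_target := (X.slice.chart g).open_source.prod isOpen_univ
  baseSet := (X.slice.chart g).source
  open_baseSet := (X.slice.chart g).open_source
  source_eq := rfl
  target_eq := rfl
  proj_toFun _ _ := rfl

lemma pretriv_apply (g : X.data.GA) (d : TotalSpace X.data.HB X.Fiber) :
    X.pretriv g d = (d.1, X.coordAt (X.slice.sec g d.1) d.1 d.2) := rfl

instance (g : X.data.GA) : (X.pretriv g).IsLinear ℂ where
  linear z _ := (X.coordAt (X.slice.sec g z) z).toLinearMap.isLinear

lemma pretriv_symm (g : X.data.GA) {z : X.Base} (hz : z ∈ (X.slice.chart g).source)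
    (f : X.data.HB) : (X.pretriv g).symm z f = fib _ (X.slice.mk_sec hz) f := by
  have h : (⟨z, (X.pretriv g).symm z f⟩ : TotalSpace X.data.HB X.Fiber) =
      ⟨z, fib _ (X.slice.mk_sec hz) f⟩ := by
    rw [(X.pretriv g).mk_symm hz]
    exact congrArg _ (lift_eq (X.slice.mk_sec hz) f)
  simpa using h

/-- The coordinate changes of the bundle. -/
def change (g g' : X.data.GA) (z : X.Base) : X.data.HB →L[ℂ] X.data.HB :=
  X.compress ((X.slice.sec g' z)⁻¹ * X.slice.sec g z)

/-- Two local sections differ by a holomorphic map into `G_A`, and the compression sends it to a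
holomorphic operator-valued map. -/
lemma contMDiffOn_change (g g' : X.data.GA) :
    ContMDiffOn 𝓘(ℂ, X.slice.V) 𝓘(ℂ, X.data.HB →L[ℂ] X.data.HB) ω (X.change g g')
      ((X.slice.chart g).source ∩ (X.slice.chart g').source) :=
  X.contMDiff_compress.comp_contMDiffOn
    (((X.slice.contMDiffOn_sec g').mono Set.inter_subset_right).inv.mul
      ((X.slice.contMDiffOn_sec g).mono Set.inter_subset_left))

lemma change_apply (g g' : X.data.GA) {z : X.Base} (hz : z ∈ (X.slice.chart g).source)
    (f : X.data.HB) : X.change g g' z f = (X.pretriv g' ⟨z, (X.pretriv g).symm z f⟩).2 := by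
  rw [pretriv_apply, X.pretriv_symm g hz]
  exact (coordAt_fib _ _ _ _).symm

lemma mem_chart_out (z : X.Base) : z ∈ (X.slice.chart z.out).source :=
  mem_chart_source X.slice.V z

lemma isInducing_pretriv (z : X.Base) : IsInducing (X.pretriv z.out ∘ TotalSpace.mk z) := by
  have h : IsInducing (fun d : X.Fiber z => (z, X.coordAt (X.slice.sec z.out z) z d)) :=
    isInducing_const_prod.2 (isInducing_coordAt _ (X.slice.mk_sec (X.mem_chart_out z)))
  exact h

/-- The bundle structure on `G_A ×_{G_B} H_B`. -/
def prebundle : VectorPrebundle ℂ X.data.HB X.Fiber where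
  pretrivializationAtlas := Set.range X.pretriv
  pretrivialization_linear' := by
    rintro _ ⟨g, rfl⟩
    infer_instance
  pretrivializationAt z := X.pretriv z.out
  mem_base_pretrivializationAt z := X.mem_chart_out z
  pretrivialization_mem_atlas z := ⟨_, rfl⟩
  exists_coordChange := by
    rintro _ ⟨g, rfl⟩ _ ⟨g', rfl⟩
    exact ⟨X.change g g', (X.contMDiffOn_change g g').continuousOn,
      fun z hz f => X.change_apply g g' hz.1 f⟩
  totalSpaceMk_isInducing z := X.isInducing_pretriv z

instance : X.prebundle.IsContMDiff 𝓘(ℂ, X.slice.V) ω where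
  exists_contMDiffCoordChange := by
    rintro _ ⟨g, rfl⟩ _ ⟨g', rfl⟩
    exact ⟨X.change g g', X.contMDiffOn_change g g', fun z hz f => X.change_apply g g' hz.1 f⟩

instance topTotal : TopologicalSpace (TotalSpace X.data.HB X.Fiber) := X.prebundle.totalSpaceTopology

instance fiberBundleTotal : FiberBundle X.data.HB X.Fiber := X.prebundle.toFiberBundle

instance : VectorBundle ℂ X.data.HB X.Fiber := X.prebundle.toVectorBundle

instance : ContMDiffVectorBundle ω X.data.HB X.Fiber 𝓘(ℂ, X.slice.V) :=
  X.prebundle.contMDiffVectorBundle 𝓘(ℂ, X.slice.V)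

/-- `pretriv` as a local trivialization. -/
def triv (g : X.data.GA) : Trivialization X.data.HB (π X.data.HB X.Fiber) :=
  X.prebundle.trivializationOfMemPretrivializationAtlas ⟨g, rfl⟩

instance (g : X.data.GA) : MemTrivializationAtlas (X.triv g) := ⟨⟨X.pretriv g, ⟨g, rfl⟩, rfl⟩⟩

lemma triv_apply (g : X.data.GA) (d : TotalSpace X.data.HB X.Fiber) :
    X.triv g d = (d.1, X.coordAt (X.slice.sec g d.1) d.1 d.2) := rfl

lemma contMDiff_mk : ContMDiff 𝓘(ℂ, X.data.GA.model) 𝓘(ℂ, X.slice.V) ω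
    (QuotientGroup.mk : X.data.GA → X.Base) := X.slice.contMDiff_mk

lemma contMDiffOn_sec (g : X.data.GA) : ContMDiffOn 𝓘(ℂ, X.slice.V) 𝓘(ℂ, X.data.GA.model) ω
    (fun z : X.Base => X.slice.sec g z) (X.slice.chart g).source := X.slice.contMDiffOn_sec g

lemma chart_source_mem_nhds {g : X.data.GA} {z : X.Base} (hz : z ∈ (X.slice.chart g).source) :
    (X.slice.chart g).source ∈ 𝓝 z := (X.slice.chart g).open_source.mem_nhds hz

lemma contMDiffAt_sec {g : X.data.GA} {z : X.Base} (hz : z ∈ (X.slice.chart g).source) :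
    ContMDiffAt 𝓘(ℂ, X.slice.V) 𝓘(ℂ, X.data.GA.model) ω (fun z : X.Base => X.slice.sec g z) z :=
  (X.contMDiffOn_sec g).contMDiffAt (X.chart_source_mem_nhds hz)

/-- The quotient map `(u, f) ↦ [(u, f)]` into the total space of the bundle. -/
def pt (p : X.data.GA × X.data.HB) : TotalSpace X.data.HB X.Fiber := ⟨_, fib p.1 rfl p.2⟩

lemma pt_eq {z : X.Base} {u : X.data.GA} (h : QuotientGroup.mk u = z) (f : X.data.HB) :
    X.pt (u, f) = ⟨z, fib u h f⟩ := by
  subst h; rfl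

lemma triv_pt (g u : X.data.GA) (f : X.data.HB) :
    (X.triv g (X.pt (u, f))).2 = X.compress ((X.slice.sec g (QuotientGroup.mk u))⁻¹ * u) f :=
  coordAt_fib _ _ rfl f

/-- In the trivialization through `u`, the fibre coordinate is the compression of a holomorphic
group-valued map applied to the vector (`triv_pt`). -/
lemma contMDiff_pt : ContMDiff (𝓘(ℂ, X.data.GA.model).prod 𝓘(ℂ, X.data.HB))
    (𝓘(ℂ, X.slice.V).prod 𝓘(ℂ, X.data.HB)) ω X.pt := by
  rintro ⟨u, f⟩
  have hu := X.slice.mk_mem_chart_source u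
  have h0 : X.pt (u, f) ∈ (X.triv u).source := hu
  have hmk : ContMDiffAt (𝓘(ℂ, X.data.GA.model).prod 𝓘(ℂ, X.data.HB)) 𝓘(ℂ, X.slice.V) ω
      (fun p : X.data.GA × X.data.HB => (QuotientGroup.mk p.1 : X.Base)) (u, f) :=
    X.contMDiff_mk.contMDiffAt.comp (u, f) contMDiffAt_fst
  refine ((X.triv u).contMDiffAt_iff h0).2 ⟨hmk, ?_⟩
  have hs := (X.contMDiffAt_sec hu).comp (u, f) hmk
  have h1 : ContMDiffAt (𝓘(ℂ, X.data.GA.model).prod 𝓘(ℂ, X.data.HB)) 𝓘(ℂ, X.data.GA.model) ω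
      (fun p : X.data.GA × X.data.HB => (X.slice.sec u (QuotientGroup.mk p.1))⁻¹ * p.1) (u, f) :=
    hs.inv.mul contMDiffAt_fst
  have h2 := (X.contMDiff_compress.contMDiffAt.comp (u, f) h1).clm_apply contMDiffAt_snd
  exact h2.congr_of_eventuallyEq (.of_forall fun p => X.triv_pt u p.1 p.2)

/-- The local section of `pt` over the domain of `triv g`. -/
def locSec (g : X.data.GA) (d : TotalSpace X.data.HB X.Fiber) : X.data.GA × X.data.HB :=
  (X.slice.sec g d.1, (X.triv g d).2)

lemma contMDiffAt_locSec {g : X.data.GA} {d : TotalSpace X.data.HB X.Fiber}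
    (hd : d.1 ∈ (X.slice.chart g).source) :
    ContMDiffAt (𝓘(ℂ, X.slice.V).prod 𝓘(ℂ, X.data.HB))
      (𝓘(ℂ, X.data.GA.model).prod 𝓘(ℂ, X.data.HB)) ω (X.locSec g) d := by
  have h1 : ContMDiffAt (𝓘(ℂ, X.slice.V).prod 𝓘(ℂ, X.data.HB)) 𝓘(ℂ, X.slice.V) ω
      (TotalSpace.proj : TotalSpace X.data.HB X.Fiber → X.Base) d :=
    contMDiffAt_proj X.Fiber
  have h2 := (X.triv g).contMDiffOn (IB := 𝓘(ℂ, X.slice.V)) (n := ω)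
  have h3 := h2.contMDiffAt ((X.triv g).open_source.mem_nhds (x := d) hd)
  exact ((X.contMDiffAt_sec hd).comp d h1).prodMk (contMDiffAt_snd.comp d h3)

lemma pt_locSec {g : X.data.GA} {d : TotalSpace X.data.HB X.Fiber}
    (hd : d.1 ∈ (X.slice.chart g).source) : X.pt (X.locSec g d) = d := by
  have h := X.slice.mk_sec hd
  rw [locSec, X.pt_eq h, triv_apply, fib_coordAt]

lemma chart_source_mem_nhds_total {g : X.data.GA} {d : TotalSpace X.data.HB X.Fiber}
    (hd : d.1 ∈ (X.slice.chart g).source) :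
    ∀ᶠ d' in 𝓝 d, d'.1 ∈ (X.slice.chart g).source :=
  (X.triv g).open_source.mem_nhds (x := d) hd

section Descend

variable {X} {E' H' N : Type*} [NormedAddCommGroup E'] [NormedSpace ℂ E'] [TopologicalSpace H']
  [TopologicalSpace N] [ChartedSpace H' N] {I' : ModelWithCorners ℂ E' H'}

/-- A map on `G_A / G_B` is holomorphic if its composition with the quotient map is. -/
lemma contMDiff_of_comp_mk {f : X.Base → N}
    (hf : ContMDiff 𝓘(ℂ, X.data.GA.model) I' ω fun u : X.data.GA => f (QuotientGroup.mk u)) :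
    ContMDiff 𝓘(ℂ, X.slice.V) I' ω f := by
  intro z
  have hz := X.mem_chart_out z
  refine (hf.contMDiffAt.comp z (X.contMDiffAt_sec hz)).congr_of_eventuallyEq ?_
  filter_upwards [X.chart_source_mem_nhds hz] with z' hz'
  rw [Function.comp_apply, X.slice.mk_sec hz']

/-- A map on the total space is holomorphic if its composition with the quotient map is. -/
lemma contMDiff_of_comp_pt {f : TotalSpace X.data.HB X.Fiber → N}
    (hf : ContMDiff (𝓘(ℂ, X.data.GA.model).prod 𝓘(ℂ, X.data.HB)) I' ω fun p => f (X.pt p)) :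
    ContMDiff (𝓘(ℂ, X.slice.V).prod 𝓘(ℂ, X.data.HB)) I' ω f := by
  intro d
  have hd := X.mem_chart_out d.1
  refine (hf.contMDiffAt.comp d (X.contMDiffAt_locSec hd)).congr_of_eventuallyEq ?_
  filter_upwards [X.chart_source_mem_nhds_total hd] with d' hd'
  rw [Function.comp_apply, X.pt_locSec hd']

end Descend

/-! ### Holomorphy of the actions and of the transfer mapping. -/

/-- Near a given point the action is multiplication in `G_A` applied to a local section, followed by
the quotient map. `contMDiff_actPt` is the same argument on the total space. -/
lemma contMDiff_smul : ContMDiff (𝓘(ℂ, X.data.GA.model).prod 𝓘(ℂ, X.slice.V)) 𝓘(ℂ, X.slice.V) ω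
    (fun p : X.data.GA × X.Base => p.1 • p.2) := by
  rintro ⟨v, z⟩
  have hz := X.mem_chart_out z
  have hs := ContMDiffAt.comp (I := 𝓘(ℂ, X.data.GA.model).prod 𝓘(ℂ, X.slice.V))
    (f := fun p : X.data.GA × X.Base => p.2) (v, z) (X.contMDiffAt_sec hz) contMDiffAt_snd
  have h1 : ContMDiffAt (𝓘(ℂ, X.data.GA.model).prod 𝓘(ℂ, X.slice.V)) 𝓘(ℂ, X.data.GA.model) ω
      (fun p : X.data.GA × X.Base => p.1 * X.slice.sec z.out p.2) (v, z) :=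
    contMDiffAt_fst.mul hs
  refine (X.contMDiff_mk.contMDiffAt.comp (v, z) h1).congr_of_eventuallyEq ?_
  filter_upwards [continuousAt_snd.eventually_mem (X.chart_source_mem_nhds hz)] with p hp
  exact congrArg (p.1 • ·) (X.slice.mk_sec hp).symm

/-- The action of `G_A` on the total space. -/
def actPt (v : X.data.GA) (d : TotalSpace X.data.HB X.Fiber) : TotalSpace X.data.HB X.Fiber :=
  ⟨v • d.1, X.fiberAct v d.1 d.2⟩

lemma exists_pt (d : TotalSpace X.data.HB X.Fiber) : ∃ p, X.pt p = d :=
  ⟨_, X.pt_locSec (X.mem_chart_out d.1)⟩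

lemma actPt_pt (v u : X.data.GA) (f : X.data.HB) : X.actPt v (X.pt (u, f)) = X.pt (v * u, f) := rfl

lemma contMDiff_actPt :
    ContMDiff (𝓘(ℂ, X.data.GA.model).prod (𝓘(ℂ, X.slice.V).prod 𝓘(ℂ, X.data.HB)))
      (𝓘(ℂ, X.slice.V).prod 𝓘(ℂ, X.data.HB)) ω
      (fun p : X.data.GA × TotalSpace X.data.HB X.Fiber => X.actPt p.1 p.2) := by
  rintro ⟨v, d⟩
  have hd := X.mem_chart_out d.1
  have h0 : ContMDiffAt (𝓘(ℂ, X.data.GA.model).prod (𝓘(ℂ, X.slice.V).prod 𝓘(ℂ, X.data.HB)))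
      (𝓘(ℂ, X.data.GA.model).prod 𝓘(ℂ, X.data.HB)) ω
      (fun p : X.data.GA × TotalSpace X.data.HB X.Fiber => X.locSec d.1.out p.2) (v, d) :=
    (X.contMDiffAt_locSec hd).comp (v, d) contMDiffAt_snd
  have h1 : ContMDiffAt (𝓘(ℂ, X.data.GA.model).prod (𝓘(ℂ, X.slice.V).prod 𝓘(ℂ, X.data.HB)))
      (𝓘(ℂ, X.data.GA.model).prod 𝓘(ℂ, X.data.HB)) ω
      (fun p : X.data.GA × TotalSpace X.data.HB X.Fiber =>
        (p.1 * (X.locSec d.1.out p.2).1, (X.locSec d.1.out p.2).2)) (v, d) :=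
    (contMDiffAt_fst.mul (contMDiffAt_fst.comp (v, d) h0)).prodMk (contMDiffAt_snd.comp (v, d) h0)
  refine (X.contMDiff_pt.contMDiffAt.comp (v, d) h1).congr_of_eventuallyEq ?_
  filter_upwards [continuousAt_snd.eventually (X.chart_source_mem_nhds_total hd)] with p hp
  rw [Function.comp_apply, ← actPt_pt]
  exact congrArg (X.actPt p.1) (X.pt_locSec hp).symm

/-- The transfer mapping on the total space. -/
def transferPt (d : TotalSpace X.data.HB X.Fiber) : X.data.HA := X.fiberTransferL d.1 d.2

lemma contMDiff_transferPt : ContMDiff (𝓘(ℂ, X.slice.V).prod 𝓘(ℂ, X.data.HB)) 𝓘(ℂ, X.data.HA) ω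
    X.transferPt := by
  refine contMDiff_of_comp_pt ?_
  have h1 : ContMDiff (𝓘(ℂ, X.data.GA.model).prod 𝓘(ℂ, X.data.HB)) 𝓘(ℂ, X.data.HA →L[ℂ] X.data.HA)
      ω (fun p : X.data.GA × X.data.HB => X.data.rep p.1) := X.contMDiff_rep.comp contMDiff_fst
  have h2 : ContMDiff (𝓘(ℂ, X.data.GA.model).prod 𝓘(ℂ, X.data.HB)) 𝓘(ℂ, X.data.HA) ω
      (fun p : X.data.GA × X.data.HB => (p.2 : X.data.HA)) :=
    X.data.HB.subtypeL.contMDiff.comp contMDiff_snd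
  exact h1.clm_apply h2

/-! ### The involution and the like-Hermitian pairings. -/

lemma contMDiff_inv_real (G : InvBanachLieGroup.{u}) :
    ContMDiff 𝓘(ℝ, G.model) 𝓘(ℝ, G.model) ∞ (fun u : G => u⁻¹) :=
  contMDiff_real sameModel_self sameModel_self
    ((contMDiff_inv 𝓘(ℂ, G.model) ω (G := G)).of_le (by simp))

lemma contMDiff_negStar (G : InvBanachLieGroup.{u}) :
    ContMDiff 𝓘(ℝ, G.model) 𝓘(ℝ, G.model) ∞ (negStar : G → G) :=
  G.smooth_star.comp (contMDiff_inv_real G)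

lemma contMDiff_baseInv : ContMDiff 𝓘(ℝ, X.slice.V) 𝓘(ℝ, X.slice.V) ∞ X.baseInv := by
  intro z
  have hz := X.mem_chart_out z
  have h1 : ContMDiffAt 𝓘(ℝ, X.slice.V) 𝓘(ℝ, X.data.GA.model) ∞
      (fun z' : X.Base => X.slice.sec z.out z') z :=
    contMDiffAt_real sameModel_self sameModel_self ((X.contMDiffAt_sec hz).of_le (by simp))
  have h2 : ContMDiff 𝓘(ℝ, X.data.GA.model) 𝓘(ℝ, X.slice.V) ∞
      (QuotientGroup.mk : X.data.GA → X.Base) :=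
    contMDiff_real sameModel_self sameModel_self (X.contMDiff_mk.of_le (by simp))
  refine ((h2.comp (contMDiff_negStar X.data.GA)).contMDiffAt.comp z h1).congr_of_eventuallyEq ?_
  filter_upwards [X.chart_source_mem_nhds hz] with z' hz'
  exact congrArg X.baseInv (X.slice.mk_sec hz').symm

lemma inner_rep_negStar (u : X.data.GA) (x y : X.data.HA) :
    ⟪X.data.rep (negStar u) x, X.data.rep u y⟫_ℂ = ⟪x, y⟫_ℂ := by
  rw [negStar, X.isSRep.isRep.map_star, ContinuousLinearMap.adjoint_inner_left, rep_inv_rep]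

-- Along the representatives `u` and `u^{-*}` the pairing is the inner product of `H_B`, so duality
-- questions reduce to the Riesz theorem there.
variable {X} in
lemma pairing_fib {z w : X.Base} {u : X.data.GA} (hz : QuotientGroup.mk u = z)
    (hw : QuotientGroup.mk (negStar u) = w) (f g : X.data.HB) :
    ⟪X.fiberTransferL w (fib (negStar u) hw g), X.fiberTransferL z (fib u hz f)⟫_ℂ = ⟪g, f⟫_ℂ :=
  X.inner_rep_negStar u g f

lemma negStar_negStar {G : InvBanachLieGroup.{u}} (u : G) : negStar (negStar u) = u := by
  have h1 : star (1 : G) = 1 := by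
    have h5 : star (1 : G) * star 1 = star 1 * 1 := by
      rw [← star_mul, mul_one, mul_one]
    exact mul_left_cancel h5
  have h2 : (star u⁻¹)⁻¹ = star u := by
    rw [inv_eq_iff_mul_eq_one, ← star_mul, mul_inv_cancel, h1]
  rw [negStar, negStar, h2, star_star]

lemma baseInv_baseInv (z : X.Base) : X.baseInv (X.baseInv z) = z := by
  induction z using QuotientGroup.induction_on with
  | H u => exact congrArg QuotientGroup.mk (negStar_negStar u)

variable {X} in
/-- `f ↦ [(u, f)]` as a bounded linear operator from `H_B` to `D_z`, `z = u G_B`. -/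
def fibL {z : X.Base} (u : X.data.GA) (h : QuotientGroup.mk u = z) : X.data.HB →L[ℂ] X.Fiber z where
  toFun := fib u h
  map_add' f g := X.fiberTransfer_injective z
    ((map_add (X.data.rep u) f.1 g.1).trans (map_add (X.fiberTransferL z) (fib u h f) (fib u h g)).symm)
  map_smul' c f := X.fiberTransfer_injective z
    ((map_smul (X.data.rep u) c f.1).trans (map_smul (X.fiberTransferL z) c (fib u h f)).symm)
  cont := continuous_induced_rng.2 ((X.data.rep u).continuous.comp continuous_subtype_val)

lemma exists_rep {z w : X.Base} (h : w = X.baseInv z) :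
    ∃ u : X.data.GA, QuotientGroup.mk u = z ∧ QuotientGroup.mk (negStar u) = w := by
  subst h
  induction z using QuotientGroup.induction_on with
  | H u => exact ⟨u, rfl, rfl⟩

lemma exists_unique_left {z w : X.Base} (h : w = X.baseInv z) (φ : X.Fiber w →L⋆[ℂ] ℂ) :
    ∃! ξ : X.Fiber z, ∀ η, ⟪X.fiberTransferL w η, X.fiberTransferL z ξ⟫_ℂ = φ η := by
  obtain ⟨u, hz, hw⟩ := X.exists_rep h
  -- Conjugation turns the antilinear functional into a linear one, to which the Riesz theorem
  -- applies.
  let ψ : X.data.HB →L[ℂ] ℂ :=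
    { toFun := fun f => star (φ (fibL (negStar u) hw f))
      map_add' := fun f g => by rw [map_add, map_add, star_add]
      map_smul' := fun c f => by
        rw [map_smul, φ.map_smulₛₗ, smul_eq_mul, star_mul', ← starRingEnd_apply,
          Complex.conj_conj]
        rfl
      cont := continuous_star.comp (φ.continuous.comp (fibL (negStar u) hw).continuous) }
  have hψ : ∀ g, ⟪g, (InnerProductSpace.toDual ℂ X.data.HB).symm ψ⟫_ℂ =
      φ (fib (negStar u) hw g) := by
    intro g
    rw [← inner_conj_symm (𝕜 := ℂ), InnerProductSpace.toDual_symm_apply]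
    exact star_star (φ (fib (negStar u) hw g))
  refine ⟨fib u hz ((InnerProductSpace.toDual ℂ X.data.HB).symm ψ), fun η => ?_, fun ξ hξ => ?_⟩
  · obtain ⟨g, rfl⟩ := fib_eq hw η
    rw [pairing_fib, hψ]
  · obtain ⟨f, rfl⟩ := fib_eq hz ξ
    have h2 : f = (InnerProductSpace.toDual ℂ X.data.HB).symm ψ := by
      refine ext_inner_left ℂ fun g => ?_
      rw [hψ, ← hξ (fib (negStar u) hw g), pairing_fib]
    rw [h2]

lemma exists_unique_right {z w : X.Base} (h : w = X.baseInv z) (φ : X.Fiber z →L[ℂ] ℂ) :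
    ∃! η : X.Fiber w, ∀ ξ, ⟪X.fiberTransferL w η, X.fiberTransferL z ξ⟫_ℂ = φ ξ := by
  obtain ⟨u, hz, hw⟩ := X.exists_rep h
  let ψ : X.data.HB →L[ℂ] ℂ := φ.comp (fibL u hz)
  have hψ : ∀ g, ⟪(InnerProductSpace.toDual ℂ X.data.HB).symm ψ, g⟫_ℂ = φ (fib u hz g) :=
    fun g => InnerProductSpace.toDual_symm_apply (x := g) (y := ψ)
  refine ⟨fib (negStar u) hw ((InnerProductSpace.toDual ℂ X.data.HB).symm ψ), fun η => ?_,
    fun ξ hξ => ?_⟩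
  · obtain ⟨g, rfl⟩ := fib_eq hz η
    rw [pairing_fib, hψ]
  · obtain ⟨f, rfl⟩ := fib_eq hw ξ
    have h2 : f = (InnerProductSpace.toDual ℂ X.data.HB).symm ψ := by
      refine ext_inner_right ℂ fun g => ?_
      rw [hψ, ← hξ (fib u hz g), pairing_fib]
    rw [h2]

/-- The pairing is an inner product of transferred vectors, so its smoothness in trivializations
follows from that of the transfer mapping read in a trivialization. -/
lemma contMDiffOn_symm_real (e : Trivialization X.data.HB (π X.data.HB X.Fiber))
    [MemTrivializationAtlas e] :
    ContMDiffOn (𝓘(ℝ, X.slice.V).prod 𝓘(ℝ, X.data.HB)) 𝓘(ℝ, X.data.HA) ∞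
      (fun p : X.Base × X.data.HB => X.fiberTransferL p.1 (e.symm p.1 p.2)) e.target := by
  have h1 := e.contMDiffOn_symm (IB := 𝓘(ℂ, X.slice.V)) (n := ω)
  have h2 := X.contMDiff_transferPt.comp_contMDiffOn h1
  have h3 := contMDiffOn_real (sameModel_self.prod sameModel_self) sameModel_self
    (h2.of_le (show (∞ : WithTop ℕ∞) ≤ ω by simp))
  refine h3.congr fun p hp => ?_
  have h4 : (⟨p.1, e.symm p.1 p.2⟩ : TotalSpace X.data.HB X.Fiber) =
      e.toOpenPartialHomeomorph.symm p := e.mk_symm (e.mem_target.1 hp) p.2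
  exact congrArg X.transferPt h4

lemma smooth_pairing (e e' : Trivialization X.data.HB (π X.data.HB X.Fiber))
    [MemTrivializationAtlas e] [MemTrivializationAtlas e'] :
    ContMDiffOn (𝓘(ℝ, X.slice.V).prod 𝓘(ℝ, X.data.HB × X.data.HB)) 𝓘(ℝ, ℂ) ∞
      (fun p : X.Base × (X.data.HB × X.data.HB) =>
        ⟪X.fiberTransferL (X.baseInv p.1) (e'.symm (X.baseInv p.1) p.2.2),
          X.fiberTransferL p.1 (e.symm p.1 p.2.1)⟫_ℂ)
      ((e.baseSet ∩ X.baseInv ⁻¹' e'.baseSet) ×ˢ Set.univ) := by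
  have hf : ContMDiff (𝓘(ℝ, X.slice.V).prod 𝓘(ℝ, X.data.HB × X.data.HB))
      (𝓘(ℝ, X.slice.V).prod 𝓘(ℝ, X.data.HB)) ∞
      (fun p : X.Base × (X.data.HB × X.data.HB) => (p.1, p.2.1)) :=
    contMDiff_fst.prodMk (contDiff_fst.contMDiff.comp contMDiff_snd)
  have hg : ContMDiff (𝓘(ℝ, X.slice.V).prod 𝓘(ℝ, X.data.HB × X.data.HB))
      (𝓘(ℝ, X.slice.V).prod 𝓘(ℝ, X.data.HB)) ∞
      (fun p : X.Base × (X.data.HB × X.data.HB) => (X.baseInv p.1, p.2.2)) :=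
    (X.contMDiff_baseInv.comp contMDiff_fst).prodMk (contDiff_snd.contMDiff.comp contMDiff_snd)
  have h1 := (X.contMDiffOn_symm_real e).comp hf.contMDiffOn
    (s := (e.baseSet ∩ X.baseInv ⁻¹' e'.baseSet) ×ˢ Set.univ) fun p hp => e.mem_target.2 hp.1.1
  have h2 := (X.contMDiffOn_symm_real e').comp hg.contMDiffOn
    (s := (e.baseSet ∩ X.baseInv ⁻¹' e'.baseSet) ×ˢ Set.univ) fun p hp => e'.mem_target.2 hp.1.2
  have h3 : ContDiff ℝ ∞ (fun q : X.data.HA × X.data.HA => ⟪q.1, q.2⟫_ℂ) :=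
    contDiff_fst.inner ℂ contDiff_snd
  exact h3.contMDiff.comp_contMDiffOn (h2.prodMk_space h1)

lemma isManifold_base_real : IsManifold 𝓘(ℝ, X.slice.V) ∞ X.Base := by
  have : IsManifold 𝓘(ℂ, X.slice.V) ∞ X.Base := IsManifold.of_le (n := ω) (by simp)
  exact isManifold_real (I := 𝓘(ℂ, X.slice.V)) sameModel_self

lemma contMDiffVectorBundle_real :
    ContMDiffVectorBundle ∞ X.data.HB X.Fiber 𝓘(ℝ, X.slice.V) := by
  have : ContMDiffVectorBundle ∞ X.data.HB X.Fiber 𝓘(ℂ, X.slice.V) :=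
    ContMDiffVectorBundle.of_le (n := ω) (by simp)
  exact PosKernel.contMDiffVectorBundle_real (I := 𝓘(ℂ, X.slice.V)) sameModel_self

lemma continuous_pairing (z w : X.Base) : Continuous fun p : X.Fiber z × X.Fiber w =>
    ⟪X.fiberTransferL w p.2, X.fiberTransferL z p.1⟫_ℂ :=
  ((X.fiberTransferL w).continuous.comp continuous_snd).inner
    ((X.fiberTransferL z).continuous.comp continuous_fst)

/-- The homogeneous bundle is like-Hermitian. -/
lemma isLikeHermitian :
    @IsLikeHermitian X.family X.slice.V _ _ (QuotientGroup.instTopologicalSpace X.data.GB)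
      X.chartedBase X.topTotal X.fiberBundleTotal :=
  @IsLikeHermitian.mk X.family X.slice.V _ _ (QuotientGroup.instTopologicalSpace X.data.GB)
    X.chartedBase X.topTotal X.fiberBundleTotal X.isManifold_base_real
    (inferInstanceAs (VectorBundle ℂ X.data.HB X.Fiber)) X.contMDiffVectorBundle_real
    X.baseInv_baseInv X.contMDiff_baseInv (fun {z w} _ => X.continuous_pairing z w)
    X.exists_unique_left X.exists_unique_right (fun _ _ _ _ => inner_conj_symm _ _)
    (fun e e' he he' => @smooth_pairing X e e' he he')

/-! ### Algebraic identities of the actions and assembly of the geometry. -/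

lemma actPt_one (d : TotalSpace X.data.HB X.Fiber) : X.actPt 1 d = d := by
  obtain ⟨⟨u, f⟩, rfl⟩ := X.exists_pt d
  rw [actPt_pt, one_mul]

lemma actPt_mul (v w : X.data.GA) (d : TotalSpace X.data.HB X.Fiber) :
    X.actPt (v * w) d = X.actPt v (X.actPt w d) := by
  obtain ⟨⟨u, f⟩, rfl⟩ := X.exists_pt d
  rw [actPt_pt, actPt_pt, actPt_pt, mul_assoc]

lemma negStar_mul {G : InvBanachLieGroup.{u}} (u v : G) :
    negStar (u * v) = negStar u * negStar v := by
  rw [negStar, negStar, negStar, ← star_mul, mul_inv_rev]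

lemma negStar_smul_baseInv (v : X.data.GA) (z : X.Base) :
    negStar v • X.baseInv z = X.baseInv (v • z) := by
  induction z using QuotientGroup.induction_on with
  | H u => exact congrArg QuotientGroup.mk (negStar_mul v u).symm

lemma transferPt_actPt (v : X.data.GA) (d : TotalSpace X.data.HB X.Fiber) :
    X.transferPt (X.actPt v d) = X.data.rep v (X.transferPt d) :=
  X.fiberTransferL_fiberActFun v d.1 d.2

lemma inner_transferPt_actPt (v : X.data.GA) (ξ η : TotalSpace X.data.HB X.Fiber) :
    ⟪X.transferPt ξ, X.transferPt (X.actPt (star v) η)⟫_ℂ =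
      ⟪X.transferPt (X.actPt v ξ), X.transferPt η⟫_ℂ := by
  rw [transferPt_actPt, transferPt_actPt, X.isSRep.isRep.map_star,
    ContinuousLinearMap.adjoint_inner_right]

/-- The geometry of the homogeneous bundle. -/
def geometry : TransGeometry X.transData :=
  @TransGeometry.mk X.transData X.slice.V _ _ _ (QuotientGroup.instTopologicalSpace X.data.GB)
    X.chartedBase X.topTotal X.fiberBundleTotal X.isLikeHermitian
    (inferInstanceAs (IsManifold 𝓘(ℂ, X.slice.V) ω X.Base))
    (inferInstanceAs (VectorBundle ℂ X.data.HB X.Fiber))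
    (inferInstanceAs (ContMDiffVectorBundle ω X.data.HB X.Fiber 𝓘(ℂ, X.slice.V)))
    (one_smul X.data.GA (α := X.Base)) (@mul_smul X.data.GA X.Base _ _)
    X.actPt_one X.actPt_mul X.contMDiff_smul X.contMDiff_actPt X.negStar_smul_baseInv
    (fun v ξ η _ _ _ => X.inner_transferPt_actPt v ξ η) X.isSRep.isRep X.contMDiff_transferPt
    X.fiberTransfer_injective (fun _ _ _ => rfl) X.transferPt_actPt

end SRep

/-! ### The quotient maps are submersions -/

section Submersion

variable {E E'' F H G M N : Type*} [NormedAddCommGroup E] [NormedSpace ℂ E]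
  [NormedAddCommGroup E''] [NormedSpace ℂ E''] [NormedAddCommGroup F] [NormedSpace ℂ F]
  [TopologicalSpace H] [TopologicalSpace G] [TopologicalSpace M] [ChartedSpace H M]
  [TopologicalSpace N] [ChartedSpace G N] {I : ModelWithCorners ℂ E H}
  {J : ModelWithCorners ℂ E'' G}

/-- A continuous map which is a linear projection in suitable charts is a submersion. -/
lemma isSubmersionAtOfComplement_of_charts {f : M → N} {x : M} (hf : ContinuousAt f x)
    (equiv : E ≃L[ℂ] (E'' × F)) (φ : OpenPartialHomeomorph M H) (ψ : OpenPartialHomeomorph N G)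
    (hx : x ∈ φ.source) (hfx : f x ∈ ψ.source) (hφ : φ ∈ IsManifold.maximalAtlas I ω M)
    (hψ : ψ ∈ IsManifold.maximalAtlas J ω N)
    (h : ∀ y ∈ φ.source, J (ψ (f y)) = (equiv (I (φ y))).1) :
    Manifold.IsSubmersionAtOfComplement F I J ω f x := by
  refine .mk_of_continuousAt hf equiv φ ψ hx hfx hφ hψ fun y hy => ?_
  have h1 : (φ.extend I).symm y ∈ φ.source := by
    rw [← φ.extend_source (I := I)]
    exact (φ.extend I).map_target hy
  have h2 : I (φ ((φ.extend I).symm y)) = y := (φ.extend I).right_inv hy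
  have h3 := h _ h1
  rw [h2] at h3
  exact h3

end Submersion

namespace SliceChart

variable {E G : Type u} [NormedAddCommGroup E] [NormedSpace ℂ E] [Group G]
  [TopologicalSpace G] [ChartedSpace E G] {S : Subgroup G} (C : SliceChart (E := E) S)
  [IsTopologicalGroup G]

/-- The translate of the slice chart around `g`, with values in the model space of `G`. -/
def translate (g : G) : OpenPartialHomeomorph G E :=
  ((Homeomorph.mulLeft g⁻¹).transOpenPartialHomeomorph
    (C.τ.restrOpen C.nbhd C.isOpen_nbhd)).transHomeomorph C.equiv.symm.toHomeomorph

lemma mem_translate_source {g x : G} : x ∈ (C.translate g).source ↔ g⁻¹ * x ∈ C.nbhd := by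
  change g⁻¹ * x ∈ C.τ.source ∩ C.nbhd ↔ _
  exact and_iff_right_of_imp fun h => h.1

lemma translate_apply (g x : G) : C.translate g x = C.equiv.symm (C.τ (g⁻¹ * x)) := rfl

lemma translate_symm_apply (g : G) (y : E) :
    (C.translate g).symm y = g * C.τ.symm (C.equiv y) :=
  congrArg (· * C.τ.symm (C.equiv y)) (inv_inv g)

/-- In these charts the quotient map is the projection of `V × W` onto `V`, which is the submersion
property with complement `W`. -/
lemma chart_mk_of_mem_translate {g x : G} (hx : x ∈ (C.translate g).source) :
    C.chart g (QuotientGroup.mk x) = (C.equiv (C.translate g x)).1 := by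
  rw [translate_apply, ContinuousLinearEquiv.apply_symm_apply]
  exact C.coord₀_mk (C.mem_translate_source.1 hx)

lemma self_mem_translate_source (g : G) : g ∈ (C.translate g).source :=
  C.mem_translate_source.2 (by rw [inv_mul_cancel]; exact C.one_mem_nbhd)

variable [LieGroup 𝓘(ℂ, E) ω G]

lemma translate_mem_maximalAtlas (g : G) :
    C.translate g ∈ IsManifold.maximalAtlas 𝓘(ℂ, E) ω G := by
  refine OpenPartialHomeomorph.mem_maximalAtlas_of_contMDiffOn _ ?_ ?_
  · exact C.equiv.symm.contDiff.contMDiff.comp_contMDiffOn (C.contMDiffOn.comp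
      (contMDiff_mul_left (a := g⁻¹)).contMDiffOn
      fun x hx => (C.mem_translate_source.1 hx).1)
  · have h1 : ContMDiffOn 𝓘(ℂ, E) 𝓘(ℂ, E) ω (fun y => g * C.τ.symm (C.equiv y))
        (C.translate g).target :=
      (contMDiff_mul_left (a := g)).comp_contMDiffOn (C.contMDiffOn_symm.comp
        C.equiv.contDiff.contMDiff.contMDiffOn fun y hy => ?_)
    · exact h1.congr fun y _ => C.translate_symm_apply g y
    · exact hy.1

end SliceChart

namespace SRep

variable (X : SRep.{u})

lemma isSubmersion_mk : Manifold.IsSubmersion 𝓘(ℂ, X.data.GA.model) 𝓘(ℂ, X.slice.V) ω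
    (QuotientGroup.mk : X.data.GA → X.Base) := by
  refine Manifold.IsSubmersionOfComplement.isSubmersion (F := X.slice.W) fun u => ?_
  exact isSubmersionAtOfComplement_of_charts X.contMDiff_mk.continuous.continuousAt X.slice.equiv
    (X.slice.translate u) (X.slice.chart u) (X.slice.self_mem_translate_source u)
    (X.slice.mk_mem_chart_source u) (X.slice.translate_mem_maximalAtlas u)
    (X.slice.chart_mem_maximalAtlas u) fun y hy => X.slice.chart_mk_of_mem_translate hy

/-- Compression need not be multiplicative on `G_A`; on `G_B` it is, because `H_B` is invariant and
no projection takes place. -/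
lemma compress_mul_apply {v w : X.data.GA} (hv : v ∈ X.data.GB) (hw : w ∈ X.data.GB)
    (f : X.data.HB) : X.compress v (X.compress w f) = X.compress (v * w) f := by
  refine Subtype.ext ?_
  rw [X.coe_compress hv, X.coe_compress hw, X.coe_compress (mul_mem hv hw), rep_mul_apply]

lemma compress_one (f : X.data.HB) : X.compress 1 f = f :=
  (X.compress_eq 1 f).trans (X.repB_one f)

lemma contMDiffOn_sec_mk (g : X.data.GA) :
    ContMDiffOn (𝓘(ℂ, X.data.GA.model).prod 𝓘(ℂ, X.data.HB)) 𝓘(ℂ, X.data.GA.model) ω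
      (fun p : X.data.GA × X.data.HB => X.slice.sec g (QuotientGroup.mk p.1))
      {p | QuotientGroup.mk p.1 ∈ (X.slice.chart g).source} :=
  (X.contMDiffOn_sec g).comp (X.contMDiff_mk.comp contMDiff_fst).contMDiffOn fun _ hp => hp

/-- The fibre coordinate of `[(u, f)]` depends on `u` as well as on `f`. Taking this coordinate as
the new vector variable makes the quotient map a linear projection. -/
lemma contMDiffOn_twist (g : X.data.GA) :
    ContMDiffOn (𝓘(ℂ, X.data.GA.model).prod 𝓘(ℂ, X.data.HB))
      (𝓘(ℂ, X.data.GA.model).prod 𝓘(ℂ, X.data.HB)) ω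
      (fun p : X.data.GA × X.data.HB =>
        (p.1, X.compress ((X.slice.sec g (QuotientGroup.mk p.1))⁻¹ * p.1) p.2))
      {p | QuotientGroup.mk p.1 ∈ (X.slice.chart g).source} :=
  contMDiffOn_fst.prodMk ((X.contMDiff_compress.comp_contMDiffOn
    ((X.contMDiffOn_sec_mk g).inv.mul contMDiffOn_fst)).clm_apply contMDiffOn_snd)

lemma contMDiffOn_twist_symm (g : X.data.GA) :
    ContMDiffOn (𝓘(ℂ, X.data.GA.model).prod 𝓘(ℂ, X.data.HB))
      (𝓘(ℂ, X.data.GA.model).prod 𝓘(ℂ, X.data.HB)) ω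
      (fun p : X.data.GA × X.data.HB =>
        (p.1, X.compress (p.1⁻¹ * X.slice.sec g (QuotientGroup.mk p.1)) p.2))
      {p | QuotientGroup.mk p.1 ∈ (X.slice.chart g).source} :=
  contMDiffOn_fst.prodMk ((X.contMDiff_compress.comp_contMDiffOn
    (contMDiffOn_fst.inv.mul (X.contMDiffOn_sec_mk g))).clm_apply contMDiffOn_snd)

/-- The diffeomorphism `(u, f) ↦ (u, π_B(s(u G_B)⁻¹ u) f)`, `s` the local section through `g`. -/
def twist (g : X.data.GA) :
    OpenPartialHomeomorph (X.data.GA × X.data.HB) (X.data.GA × X.data.HB) where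
  toFun p := (p.1, X.compress ((X.slice.sec g (QuotientGroup.mk p.1))⁻¹ * p.1) p.2)
  invFun p := (p.1, X.compress (p.1⁻¹ * X.slice.sec g (QuotientGroup.mk p.1)) p.2)
  source := {p | QuotientGroup.mk p.1 ∈ (X.slice.chart g).source}
  target := {p | QuotientGroup.mk p.1 ∈ (X.slice.chart g).source}
  map_source' _ hp := hp
  map_target' _ hp := hp
  left_inv' := by
    rintro ⟨u, f⟩ hp
    -- The section value and `u` represent the same coset, so both their quotients lie in `G_B`,
    -- where the two compressions are mutually inverse.
    have h1 := QuotientGroup.eq.1 (X.slice.mk_sec hp)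
    have h2 := QuotientGroup.eq.1 (X.slice.mk_sec hp).symm
    refine Prod.ext rfl ?_
    simp only
    rw [X.compress_mul_apply h2 h1, mul_assoc, mul_inv_cancel_left, inv_mul_cancel, compress_one]
  right_inv' := by
    rintro ⟨u, f⟩ hp
    have h1 := QuotientGroup.eq.1 (X.slice.mk_sec hp)
    have h2 := QuotientGroup.eq.1 (X.slice.mk_sec hp).symm
    refine Prod.ext rfl ?_
    simp only
    rw [X.compress_mul_apply h1 h2, mul_assoc, mul_inv_cancel_left, inv_mul_cancel, compress_one]
  open_source := (X.slice.chart g).open_source.preimage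
    (QuotientGroup.continuous_mk.comp continuous_fst)
  open_target := (X.slice.chart g).open_source.preimage
    (QuotientGroup.continuous_mk.comp continuous_fst)
  continuousOn_toFun := (X.contMDiffOn_twist g).continuousOn
  continuousOn_invFun := (X.contMDiffOn_twist_symm g).continuousOn

/-- A chart of `G_A × H_B` in which `pt` is a projection. -/
def domChart (g : X.data.GA) :
    OpenPartialHomeomorph (X.data.GA × X.data.HB) (ModelProd X.data.GA.model X.data.HB) :=
  (X.twist g).trans ((X.slice.translate g).prod (OpenPartialHomeomorph.refl X.data.HB))

/-- A chart of the total space in which `pt` is a projection. -/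
def codChart (g : X.data.GA) :
    OpenPartialHomeomorph (TotalSpace X.data.HB X.Fiber) (ModelProd X.slice.V X.data.HB) :=
  (X.triv g).toOpenPartialHomeomorph.trans
    ((X.slice.chart g).prod (OpenPartialHomeomorph.refl X.data.HB))

lemma prod_refl_mem_maximalAtlas {E M F : Type*} [NormedAddCommGroup E] [NormedSpace ℂ E]
    [NormedAddCommGroup F] [NormedSpace ℂ F] [TopologicalSpace M] [ChartedSpace E M]
    [IsManifold 𝓘(ℂ, E) ω M] {φ : OpenPartialHomeomorph M E}
    (hφ : φ ∈ IsManifold.maximalAtlas 𝓘(ℂ, E) ω M) :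
    φ.prod (OpenPartialHomeomorph.refl F) ∈
      IsManifold.maximalAtlas (𝓘(ℂ, E).prod 𝓘(ℂ, F)) ω (M × F) := by
  have h : OpenPartialHomeomorph.refl F ∈ IsManifold.maximalAtlas 𝓘(ℂ, F) ω F :=
    StructureGroupoid.id_mem_maximalAtlas _
  exact IsManifold.mem_maximalAtlas_prod hφ h

lemma domChart_mem_maximalAtlas (g : X.data.GA) :
    X.domChart g ∈ IsManifold.maximalAtlas (𝓘(ℂ, X.data.GA.model).prod 𝓘(ℂ, X.data.HB)) ω
      (X.data.GA × X.data.HB) := by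
  have h := prod_refl_mem_maximalAtlas (F := X.data.HB) (X.slice.translate_mem_maximalAtlas g)
  refine OpenPartialHomeomorph.mem_maximalAtlas_of_contMDiffOn _ ?_ ?_
  · exact (contMDiffOn_of_mem_maximalAtlas h).comp
      ((X.contMDiffOn_twist g).mono fun p hp => hp.1) fun p hp => hp.2
  · exact (X.contMDiffOn_twist_symm g).comp
      ((contMDiffOn_symm_of_mem_maximalAtlas h).mono fun p hp => hp.1) fun p hp => hp.2

lemma codChart_mem_maximalAtlas (g : X.data.GA) :
    X.codChart g ∈ IsManifold.maximalAtlas (𝓘(ℂ, X.slice.V).prod 𝓘(ℂ, X.data.HB)) ω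
      (TotalSpace X.data.HB X.Fiber) := by
  have h := prod_refl_mem_maximalAtlas (F := X.data.HB) (M := X.Base)
    (X.slice.chart_mem_maximalAtlas g)
  have : IsManifold (𝓘(ℂ, X.slice.V).prod 𝓘(ℂ, X.data.HB)) ω (TotalSpace X.data.HB X.Fiber) :=
    Bundle.TotalSpace.isManifold X.data.HB X.Fiber
  refine OpenPartialHomeomorph.mem_maximalAtlas_of_contMDiffOn _ ?_ ?_
  · exact (contMDiffOn_of_mem_maximalAtlas h).comp
      (((X.triv g).contMDiffOn (IB := 𝓘(ℂ, X.slice.V)) (n := ω)).mono fun p hp => hp.1)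
      fun p hp => hp.2
  · exact ((X.triv g).contMDiffOn_symm (IB := 𝓘(ℂ, X.slice.V)) (n := ω)).comp
      ((contMDiffOn_symm_of_mem_maximalAtlas h).mono fun p hp => hp.1) fun p hp => hp.2

/-- `E × H_B ≃ (V × H_B) × W`. -/
def totalEquiv : (X.data.GA.model × X.data.HB) ≃L[ℂ] ((X.slice.V × X.data.HB) × X.slice.W) :=
  (X.slice.equiv.prodCongr (ContinuousLinearEquiv.refl ℂ X.data.HB)).trans
    (((ContinuousLinearEquiv.prodAssoc ℂ _ _ _).trans
      ((ContinuousLinearEquiv.refl ℂ _).prodCongr (ContinuousLinearEquiv.prodComm ℂ _ _))).trans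
      (ContinuousLinearEquiv.prodAssoc ℂ _ _ _).symm)

/-- After twisting the domain, the map is the base projection `V × W → V` times the identity of
`H_B`; the complement is again `W`. -/
lemma isSubmersion_pt : Manifold.IsSubmersion (𝓘(ℂ, X.data.GA.model).prod 𝓘(ℂ, X.data.HB))
    (𝓘(ℂ, X.slice.V).prod 𝓘(ℂ, X.data.HB)) ω X.pt := by
  refine Manifold.IsSubmersionOfComplement.isSubmersion (F := X.slice.W) ?_
  rintro ⟨u, f⟩
  have hu := X.slice.mk_mem_chart_source u
  refine isSubmersionAtOfComplement_of_charts X.contMDiff_pt.continuous.continuousAt X.totalEquiv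
    (X.domChart u) (X.codChart u) ?_ ?_ (X.domChart_mem_maximalAtlas u)
    (X.codChart_mem_maximalAtlas u) ?_
  · exact ⟨hu, X.slice.self_mem_translate_source u, trivial⟩
  · exact ⟨hu, hu, trivial⟩
  · rintro ⟨y, k⟩ hy
    have h1 : y ∈ (X.slice.translate u).source := hy.2.1
    exact Prod.ext (X.slice.chart_mk_of_mem_translate h1) (X.triv_pt u y k)

lemma isQuotientGeometry : X.IsQuotientGeometry X.geometry :=
  ⟨X.isSubmersion_mk, X.isSubmersion_pt⟩

end SRep

/-! ### From representations to transfer mappings: morphisms and functoriality. -/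

/-- The targets of the fibre maps depend on the base map, so comparison on the total space avoids
transport between fibres. The base map is recovered from the zero vectors. -/
lemma LHer.Hom.ext_tot {X Y : LHer.{u}} {Θ Θ' : LHer.Hom X Y} (h : ∀ ξ, Θ.tot ξ = Θ'.tot ξ) :
    Θ = Θ' := by
  have hζ : Θ.ζ = Θ'.ζ := funext fun z => congrArg TotalSpace.proj (h ⟨z, 0⟩)
  obtain ⟨ζ, δ, h1, h2, h3⟩ := Θ
  obtain ⟨ζ', δ', h1', h2', h3'⟩ := Θ'
  obtain rfl : ζ = ζ' := hζ
  obtain rfl : δ = δ' := by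
    funext z
    ext ξ
    exact (TotalSpace.mk_inj).1 (h ⟨z, ξ⟩)
  rfl

/-- A double sum of inner products as a squared norm. -/
lemma sum_sum_inner {H ι : Type*} [NormedAddCommGroup H] [InnerProductSpace ℂ H] [Fintype ι]
    (x : ι → H) : ∑ l, ∑ j, ⟪x j, x l⟫_ℂ = ((‖∑ l, x l‖ ^ 2 : ℝ) : ℂ) := by
  have h := inner_self_eq_norm_sq_to_K (𝕜 := ℂ) (∑ l, x l)
  rw [sum_inner] at h
  simp only [inner_sum] at h
  rw [Finset.sum_comm, h]
  simp

/-- Both double sums are squared norms, of `L (∑ x)` and of `∑ x`. The summand `1` keeps the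
constant positive when `L = 0`. -/
lemma sum_sum_inner_le {H H' ι : Type*} [NormedAddCommGroup H] [InnerProductSpace ℂ H]
    [NormedAddCommGroup H'] [InnerProductSpace ℂ H'] [Fintype ι] (L : H →L[ℂ] H') (x : ι → H) :
    ∑ l, ∑ j, ⟪L (x j), L (x l)⟫_ℂ
      ≤ ((‖L‖ ^ 2 + 1 : ℝ) : ℂ) * ∑ l, ∑ j, ⟪x j, x l⟫_ℂ := by
  rw [sum_sum_inner, sum_sum_inner, ← map_sum, ← Complex.ofReal_mul]
  norm_cast
  have h := pow_le_pow_left₀ (norm_nonneg _) (L.le_opNorm (∑ l, x l)) 2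
  nlinarith [sq_nonneg ‖∑ l, x l‖]

namespace SRep

variable {X Y : SRep.{u}} (f : SRep.Hom X Y)

/-- The restriction of `L` to `H_B`. -/
def Hom.restr : X.data.HB →L[ℂ] Y.data.HB :=
  (f.L.comp X.data.HB.subtypeL).codRestrict Y.data.HB fun x => f.L_mem x x.2

lemma Hom.L_rep_apply (u : X.data.GA) (x : X.data.HA) :
    Y.data.rep (f.α u) (f.L x) = f.L (X.data.rep u x) := (DFunLike.congr_fun (f.L_rep u) x).symm

/-- `u G_B ↦ α(u) G_B`. -/
def Hom.baseMap : X.Base → Y.Base :=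
  Quotient.map' f.α (by
    intro u v h
    refine QuotientGroup.leftRel_apply.2 ?_
    have h1 : f.α (u⁻¹ * v) = (f.α u)⁻¹ * f.α v :=
      (f.α.toMonoidHom.map_mul u⁻¹ v).trans (congrArg (· * f.α v) (f.α.toMonoidHom.map_inv u))
    rw [← h1]
    exact f.α_mem _ (QuotientGroup.leftRel_apply.1 h))

/-- `[(u, x)] ↦ [(α(u), L x)]`. -/
def Hom.totMap : X.Tot → Y.Tot :=
  Quotient.map (fun p => (f.α p.1, f.restr p.2)) (by
    rintro p q ⟨w, h1, h2⟩
    refine ⟨⟨f.α w, f.α_mem w w.2⟩, ?_, ?_⟩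
    · exact (congrArg f.α h1).trans (f.α.toMonoidHom.map_mul _ _)
    · refine Subtype.ext ?_
      have h3 : f.α (w : X.data.GA)⁻¹ = (f.α w)⁻¹ := f.α.toMonoidHom.map_inv _
      change f.L q.2 = Y.data.rep (f.α w)⁻¹ (f.L p.2)
      rw [← h3, f.L_rep_apply, h2]; rfl)

lemma Hom.proj_totMap (d : X.Tot) : Y.proj (f.totMap d) = f.baseMap (X.proj d) := by
  induction d using Quotient.inductionOn with
  | h p => rfl

lemma Hom.transferTot_totMap (d : X.Tot) : Y.transferTot (f.totMap d) = f.L (X.transferTot d) := by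
  induction d using Quotient.inductionOn with
  | h p => exact f.L_rep_apply p.1 p.2

/-- The map induced on fibres. -/
def Hom.fiberFun (z : X.Base) (d : X.Fiber z) : Y.Fiber (f.baseMap z) :=
  ⟨f.totMap d.1, by rw [Hom.proj_totMap, d.2]⟩

lemma Hom.fiberTransferL_fiberFun (z : X.Base) (d : X.Fiber z) :
    Y.fiberTransferL _ (f.fiberFun z d) = f.L (X.fiberTransferL z d) := f.transferTot_totMap d.1

/-- The map induced on fibres as a bounded linear operator. -/
def Hom.fiberMap (z : X.Base) : X.Fiber z →L[ℂ] Y.Fiber (f.baseMap z) where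
  toFun := f.fiberFun z
  map_add' d d' := Y.fiberTransfer_injective _ <| by
    change Y.fiberTransferL _ _ = Y.fiberTransferL _ _
    rw [map_add, Hom.fiberTransferL_fiberFun, Hom.fiberTransferL_fiberFun,
      Hom.fiberTransferL_fiberFun, map_add, map_add]
  map_smul' c d := Y.fiberTransfer_injective _ <| by
    change Y.fiberTransferL _ _ = Y.fiberTransferL _ _
    rw [RingHom.id_apply, map_smul, Hom.fiberTransferL_fiberFun, Hom.fiberTransferL_fiberFun,
      map_smul, map_smul]
  cont := by
    refine continuous_induced_rng.2 ?_
    have h : Y.fiberTransfer (f.baseMap z) ∘ f.fiberFun z =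
        fun d => f.L (X.fiberTransferL z d) := funext (f.fiberTransferL_fiberFun z)
    rw [h]
    exact f.L.continuous.comp (X.fiberTransferL z).continuous

/-- `δ` on the total space. -/
def Hom.mapPt (d : TotalSpace X.data.HB X.Fiber) : TotalSpace Y.data.HB Y.Fiber :=
  ⟨f.baseMap d.1, f.fiberMap d.1 d.2⟩

lemma Hom.mapPt_pt (u : X.data.GA) (x : X.data.HB) :
    f.mapPt (X.pt (u, x)) = Y.pt (f.α u, f.restr x) := rfl

/-- Composed with the quotient map it is `α` followed by the other quotient map, and holomorphy
descends. -/
lemma Hom.contMDiff_baseMap : ContMDiff 𝓘(ℂ, X.slice.V) 𝓘(ℂ, Y.slice.V) ω f.baseMap :=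
  contMDiff_of_comp_mk (Y.contMDiff_mk.comp f.α.holomorphic)

lemma Hom.contMDiff_mapPt : ContMDiff (𝓘(ℂ, X.slice.V).prod 𝓘(ℂ, X.data.HB))
    (𝓘(ℂ, Y.slice.V).prod 𝓘(ℂ, Y.data.HB)) ω f.mapPt := by
  refine contMDiff_of_comp_pt ?_
  have h1 : ContMDiff (𝓘(ℂ, X.data.GA.model).prod 𝓘(ℂ, X.data.HB))
      (𝓘(ℂ, Y.data.GA.model).prod 𝓘(ℂ, Y.data.HB)) ω
      (fun p : X.data.GA × X.data.HB => (f.α p.1, f.restr p.2)) :=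
    (f.α.holomorphic.comp contMDiff_fst).prodMk (f.restr.contMDiff.comp contMDiff_snd)
  exact Y.contMDiff_pt.comp h1

lemma Hom.baseMap_baseInv (z : X.Base) : f.baseMap (X.baseInv z) = Y.baseInv (f.baseMap z) := by
  induction z using QuotientGroup.induction_on with
  | H u =>
    have h : f.α (negStar u) = negStar (f.α u) :=
      (f.α.map_star _).trans (congrArg star (f.α.toMonoidHom.map_inv u))
    exact congrArg QuotientGroup.mk h

lemma Hom.baseMap_smul (v : X.data.GA) (z : X.Base) :
    f.baseMap (v • z) = f.α v • f.baseMap z := by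
  induction z using QuotientGroup.induction_on with
  | H u => exact congrArg QuotientGroup.mk (f.α.toMonoidHom.map_mul v u)

lemma Hom.mapPt_actPt (v : X.data.GA) (d : TotalSpace X.data.HB X.Fiber) :
    f.mapPt (X.actPt v d) = Y.actPt (f.α v) (f.mapPt d) := by
  obtain ⟨⟨u, x⟩, rfl⟩ := X.exists_pt d
  rw [actPt_pt, Hom.mapPt_pt, Hom.mapPt_pt, actPt_pt]
  exact congrArg (fun g => Y.pt (g, f.restr x)) (f.α.toMonoidHom.map_mul v u)

lemma Hom.transferPt_mapPt (d : TotalSpace X.data.HB X.Fiber) :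
    Y.transferPt (f.mapPt d) = f.L (X.transferPt d) := f.fiberTransferL_fiberFun d.1 d.2

/-- The transfer mapping attached to a representation with homogeneous data. -/
def toTrans (X : SRep.{u}) : Trans.{u} := ⟨X.transData, X.geometry⟩

lemma sameModel_total (X : SRep.{u}) : SameModel (𝓘(ℂ, X.slice.V).prod 𝓘(ℂ, X.data.HB))
    (𝓘(ℝ, X.slice.V).prod 𝓘(ℝ, X.data.HB)) := sameModel_self.prod sameModel_self

lemma Hom.smooth_baseMap : ContMDiff 𝓘(ℝ, X.slice.V) 𝓘(ℝ, Y.slice.V) ∞ f.baseMap :=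
  contMDiff_real sameModel_self sameModel_self (f.contMDiff_baseMap.of_le (by simp))

lemma Hom.smooth_mapPt : ContMDiff (𝓘(ℝ, X.slice.V).prod 𝓘(ℝ, X.data.HB))
    (𝓘(ℝ, Y.slice.V).prod 𝓘(ℝ, Y.data.HB)) ∞ f.mapPt :=
  contMDiff_real X.sameModel_total Y.sameModel_total (f.contMDiff_mapPt.of_le (by simp))

/-- The morphism of like-Hermitian bundles induced by a morphism of representations. -/
def Hom.toLHer : LHer.Hom X.toTrans.bundle Y.toTrans.bundle :=
  @LHer.Hom.mk X.toTrans.bundle Y.toTrans.bundle f.baseMap f.fiberMap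
    f.smooth_baseMap f.smooth_mapPt f.baseMap_baseInv

/-- The morphism of transfer mappings induced by a morphism of representations. -/
def Hom.toTrans : Trans.Hom X.toTrans Y.toTrans :=
  @Trans.Hom.mk X.toTrans Y.toTrans f.toLHer f.α f.L f.baseMap_smul f.mapPt_actPt
    (fun u => (f.L_rep u).symm) f.transferPt_mapPt
    ⟨‖f.L‖ ^ 2 + 1, by positivity, fun n ξ => by
      have h := sum_sum_inner_le f.L fun l => X.toTrans.data.transfer (ξ l)
      -- The two sides of the inequality in `Trans.Hom` carry their summation indices in opposite
      -- order.
      exact h.trans_eq (congrArg _ Finset.sum_comm)⟩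

lemma Hom.toTrans_id (X : SRep.{u}) : Hom.toTrans (𝟙 X : X ⟶ X) = 𝟙 X.toTrans := by
  refine Trans.Hom.ext (LHer.Hom.ext_tot fun d => ?_) rfl rfl
  obtain ⟨⟨u, x⟩, rfl⟩ := X.exists_pt d
  rfl

lemma Hom.toTrans_comp {X Y Z : SRep.{u}} (f : X ⟶ Y) (g : Y ⟶ Z) :
    @Eq (X.toTrans ⟶ Z.toTrans) (Hom.toTrans (f ≫ g))
      (CategoryStruct.comp (Y := Y.toTrans) (Hom.toTrans f) (Hom.toTrans g)) := by
  refine Trans.Hom.ext (LHer.Hom.ext_tot fun d => ?_) rfl rfl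
  obtain ⟨⟨u, x⟩, rfl⟩ := X.exists_pt d
  rfl

theorem definesFunctor_toTrans :
    DefinesFunctor (fun X : SRep.{u} => (⟨X.transData, X.geometry⟩ : Trans.{u}))
      (fun {X Y} (f : SRep.Hom X Y)
          (g : Trans.Hom ⟨X.transData, X.geometry⟩ ⟨Y.transData, Y.geometry⟩) =>
        (∀ u : X.data.GA, g.Θ.ζ (X.basePoint u) = Y.basePoint (f.α u)) ∧
        (∀ (u : X.data.GA) (x : X.data.HB),
          g.Θ.tot (X.point (u, x)) = Y.point (f.α u, ⟨f.L x, f.L_mem x x.2⟩)) ∧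
        g.α = f.α ∧ g.L = f.L) :=
  ⟨{ obj := toTrans
     map := Hom.toTrans
     map_id := Hom.toTrans_id
     map_comp := Hom.toTrans_comp }, Hom.toTrans, rfl,
    fun _ => ⟨fun _ => rfl, fun _ _ => rfl, rfl, rfl⟩⟩

end SRep

/-! ### From transfer mappings to reproducing kernels. -/

/-- In a like-Hermitian bundle the operators `S^{-*}` exist. -/
lemma LHer.exists_negStarAdjoint (X : LHer.{u}) {H : Type u} [NormedAddCommGroup H]
    [InnerProductSpace ℂ H] [CompleteSpace H] {z w : X.fam.Z} (h : w = X.fam.inv z)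
    (S : X.fam.E w →L[ℂ] H) :
    ∃ T : H →L[ℂ] X.fam.E z, ∀ (x : H) (y : X.fam.E w), X.fam.pairing h (T x) y = ⟪S y, x⟫_ℂ := by
  have := X.isLikeHermitian.vectorBundle
  let φ (x : H) : X.fam.E w →L⋆[ℂ] ℂ :=
    { toFun := fun y => ⟪S y, x⟫_ℂ
      map_add' := fun y y' => by rw [map_add, inner_add_left]
      map_smul' := fun c y => by rw [map_smul, inner_smul_left]; rfl
      cont := S.continuous.inner continuous_const }
  -- Strong duality determines the operator pointwise, and the uniqueness half makes it linear.
  have hu := fun x => X.isLikeHermitian.exists_unique_left h (φ x)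
  choose T hT hT' using hu
  have hT2 : ∀ x y, X.fam.pairing h (T x) y = ⟪S y, x⟫_ℂ := hT
  let T₁ : H →ₗ[ℂ] X.fam.E z :=
    { toFun := T
      map_add' := fun x x' => (hT' (x + x') (T x + T x') fun y => by
        change _ = ⟪S y, x + x'⟫_ℂ
        rw [map_add, LinearMap.add_apply, hT2, hT2, inner_add_right]).symm
      map_smul' := fun c x => (hT' (c • x) (c • T x) fun y => by
        change _ = ⟪S y, c • x⟫_ℂ
        rw [map_smul, LinearMap.smul_apply, hT2, inner_smul_right]; rfl).symm }
  -- The fibre carries only a topology; a trivialization identifies it with the Banach space `F`,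
  -- where the closed graph theorem is available.
  let e : X.fam.E z ≃L[ℂ] X.fam.F :=
    (trivializationAt X.fam.F X.fam.E z).continuousLinearEquivAt ℂ z
      (mem_baseSet_trivializationAt X.fam.F X.fam.E z)
  have hc : Continuous (e.toLinearEquiv.toLinearMap ∘ₗ T₁) := by
    refine LinearMap.continuous_of_seq_closed_graph _ fun v x y hv hy => ?_
    have h1 : Tendsto (fun n => T (v n)) atTop (𝓝 (e.symm y)) := by
      have := (e.symm.continuous.tendsto y).comp hy
      refine this.congr fun n => e.symm_apply_apply (T (v n))
    -- Continuity of the pairing passes the defining identity to the limit, and uniqueness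
    -- identifies the limit with `T x`.
    have h2 : e.symm y = T x := hT' x _ fun η => by
      have h3 : Tendsto (fun n => X.fam.pairing h (T (v n)) η) atTop
          (𝓝 (X.fam.pairing h (e.symm y) η)) :=
        ((X.isLikeHermitian.continuous_pairing h).tendsto (e.symm y, η)).comp
          (h1.prodMk_nhds tendsto_const_nhds)
      have h4 : Tendsto (fun n => X.fam.pairing h (T (v n)) η) atTop (𝓝 ⟪S η, x⟫_ℂ) := by
        simp only [hT2]
        exact tendsto_const_nhds.inner hv
      exact tendsto_nhds_unique h3 h4
    exact (e.symm_apply_eq.1 h2)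
  refine ⟨⟨T₁, ?_⟩, hT2⟩
  have := e.symm.continuous.comp hc
  exact this.congr fun x => e.symm_apply_apply (T x)

namespace Trans

lemma pairing_negStarAdjoint (X : LHer.{u}) {H : Type u} [NormedAddCommGroup H]
    [InnerProductSpace ℂ H] [CompleteSpace H] {z w : X.fam.Z} (h : w = X.fam.inv z)
    (S : X.fam.E w →L[ℂ] H) (x : H) (y : X.fam.E w) :
    X.fam.pairing h (negStarAdjoint X.fam h S x) y = ⟪S y, x⟫_ℂ :=
  Classical.epsilon_spec (X.exists_negStarAdjoint h S) x y

/-- The defining property of `K^R`. -/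
lemma pairing_kernelOf (X : Trans.{u}) {s t w : X.data.fam.Z} (h : w = X.data.fam.inv s)
    (η : X.data.fam.E t) (ξ : X.data.fam.E w) :
    X.data.fam.pairing h (kernelOf X s t η) ξ = ⟪X.data.R w ξ, X.data.R t η⟫_ℂ := by
  subst h
  exact pairing_negStarAdjoint X.bundle rfl (X.data.R _) (X.data.R t η) ξ

/-- By the defining property of the kernel, the double sum is the squared norm of `∑ R η_j`. -/
lemma isReproducingKernel_kernelOf (X : Trans.{u}) :
    IsReproducingKernel X.bundle (kernelOf X) := by
  intro n t η
  have h : ∀ l j, X.data.fam.pairing rfl (kernelOf X (t l) (X.data.fam.inv (t j)) (η j)) (η l) =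
      ⟪X.data.R _ (η l), X.data.R _ (η j)⟫_ℂ := fun l j => X.pairing_kernelOf rfl _ _
  refine le_of_le_of_eq ?_
    (Finset.sum_congr rfl fun l _ => Finset.sum_congr rfl fun j _ => (h l j).symm)
  rw [Finset.sum_comm, sum_sum_inner (fun j => X.data.R _ (η j))]
  exact Complex.zero_le_real.2 (by positivity)

/-- This translates the inequality for morphisms of kernels into the one for morphisms of transfer
mappings. -/
lemma kernelSum_kernelOf (X : Trans.{u}) {n : ℕ} (s : Fin n → X.data.fam.Z)
    (ξ : ∀ j, X.data.fam.E (s j)) :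
    X.bundle.kernelSum (kernelOf X) s ξ =
      ∑ l, ∑ j, ⟪X.data.R (s l) (ξ l), X.data.R (s j) (ξ j)⟫_ℂ :=
  Finset.sum_congr rfl fun _ _ => Finset.sum_congr rfl fun _ _ => X.pairing_kernelOf _ _ _

/-- The reproducing kernel attached to a transfer mapping. -/
def toKern (X : Trans.{u}) : Kern.{u} := ⟨X.bundle, kernelOf X, X.isReproducingKernel_kernelOf⟩

/-- The morphism of kernels induced by a morphism of transfer mappings. -/
def Hom.toKern {X Y : Trans.{u}} (f : Trans.Hom X Y) : Kern.Hom X.toKern Y.toKern where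
  Θ := f.Θ
  bound := by
    obtain ⟨M, hM, h⟩ := f.bound
    refine ⟨M, hM, fun n s ξ => ?_⟩
    have h1 : ∀ j, Y.data.R (f.Θ.ζ (s j)) (f.Θ.δ (s j) (ξ j)) = f.L (X.data.R (s j) (ξ j)) :=
      fun j => f.transfer_tot ⟨s j, ξ j⟩
    have h2 := h n fun j => ⟨s j, ξ j⟩
    rw [Finset.sum_comm] at h2
    refine (Y.kernelSum_kernelOf _ _).trans_le (le_trans (le_of_eq ?_)
      (h2.trans_eq (congrArg _ (X.kernelSum_kernelOf s ξ).symm)))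
    refine Finset.sum_congr rfl fun l _ => Finset.sum_congr rfl fun j _ => ?_
    exact congrArg₂ (inner ℂ) (h1 l) (h1 j)

theorem definesFunctor_toKern :
    DefinesFunctor
      (fun X : Trans.{u} =>
        (⟨X.bundle, kernelOf X, X.isReproducingKernel_kernelOf⟩ : Kern.{u}))
      (fun {X Y} (f : Trans.Hom X Y)
          (g : Kern.Hom ⟨X.bundle, kernelOf X, X.isReproducingKernel_kernelOf⟩
            ⟨Y.bundle, kernelOf Y, Y.isReproducingKernel_kernelOf⟩) => g.Θ = f.Θ) :=
  ⟨{ obj := toKern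
     map := Hom.toKern
     map_id := fun _ => rfl
     map_comp := fun _ _ => rfl }, Hom.toKern, rfl, fun _ => rfl⟩

end Trans

/-! ### From completely positive maps to representations: the Stinespring dilation. -/

namespace CPos

variable (X : CPos.{u})

/-- Bounded operators on `H_A` are determined by their values on the vectors `ι a ξ`. -/
lemma clm_ext {G : Type*} [NormedAddCommGroup G] [NormedSpace ℂ G] {S T : X.HA →L[ℂ] G}
    (h : ∀ a ξ, S (X.ι a ξ) = T (X.ι a ξ)) : S = T := by
  ext x
  induction x using Completion.induction_on with
  | hp => exact isClosed_eq S.continuous T.continuous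
  | ih x =>
    have h1 : ∀ y : X.A ⊗[ℂ] X.H₀, S ((X.toPre y : X.Pre) : Completion X.Pre) =
        T ((X.toPre y : X.Pre) : Completion X.Pre) := by
      intro y
      induction y with
      | zero => rw [map_zero, Completion.coe_zero, map_zero, map_zero]
      | add y y' hy hy' =>
        rw [map_add, Completion.coe_add, map_add, map_add, hy, hy']
      | tmul a ξ => exact h a ξ
    exact h1 (X.toPre.symm x)

lemma stinespringRep_ι (a b : X.A) (ξ : X.H₀) :
    X.stinespringRep a (X.ι b ξ) = X.ι (a * b) ξ := by
  rw [stinespringRep, ι, ContinuousLinearMap.completion_apply_coe]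
  rfl

lemma inner_ι (a b : X.A) (ξ η : X.H₀) :
    ⟪X.ι a ξ, X.ι b η⟫_ℂ = ⟪ξ, X.Φ (star a * b) η⟫_ℂ := by
  rw [ι, ι, Completion.inner_coe]
  exact X.form_tmul a b ξ η

lemma ι_add (a b : X.A) (ξ : X.H₀) : X.ι (a + b) ξ = X.ι a ξ + X.ι b ξ := by
  rw [ι, TensorProduct.add_tmul, map_add, Completion.coe_add]; rfl

lemma ι_smul (c : ℂ) (a : X.A) (ξ : X.H₀) : X.ι (c • a) ξ = c • X.ι a ξ := by
  rw [ι, ← TensorProduct.smul_tmul', map_smul, Completion.coe_smul]; rfl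

/-- The seminorm bound built into `preRep` passes to the completion by density. It makes the
dilation bounded and linear in `a`, from which holomorphy on the invertibles follows. -/
lemma norm_stinespringRep_le (a : X.A) : ‖X.stinespringRep a‖ ≤ ‖a‖ := by
  refine ContinuousLinearMap.opNorm_le_bound _ (norm_nonneg a) fun x => ?_
  induction x using Completion.induction_on with
  | hp => exact isClosed_le (X.stinespringRep a).continuous.norm (continuous_norm.const_mul _)
  | ih x =>
    rw [stinespringRep, ContinuousLinearMap.completion_apply_coe, Completion.norm_coe,
      Completion.norm_coe]
    exact (X.preRep a).le_of_opNorm_le (LinearMap.mkContinuous_norm_le _ (norm_nonneg a) _) x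

/-- The Stinespring representation of `A` as a bounded linear map. -/
def stinespringRepL : X.A →L[ℂ] (X.HA →L[ℂ] X.HA) :=
  LinearMap.mkContinuous
    { toFun := X.stinespringRep
      map_add' := fun a b => X.clm_ext fun c ξ => by
        rw [add_apply, stinespringRep_ι, stinespringRep_ι, stinespringRep_ι,
          add_mul, ι_add]
      map_smul' := fun z a => X.clm_ext fun c ξ => by
        rw [smul_apply, stinespringRep_ι, stinespringRep_ι, smul_mul_assoc,
          ι_smul, RingHom.id_apply] }
    1 fun a => by
      rw [one_mul]
      exact X.norm_stinespringRep_le a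

lemma stinespringRep_star (a : X.A) :
    X.stinespringRep (star a) = ContinuousLinearMap.adjoint (X.stinespringRep a) := by
  refine X.clm_ext fun c ζ => ?_
  -- Two vectors agree if their inner products with the generating vectors `ι b η` do; the
  -- functionals are bounded, so `clm_ext` applies once more.
  refine innerSL_inj (𝕜 := ℂ) |>.1 (X.clm_ext fun b η => ?_)
  rw [innerSL_apply_apply, innerSL_apply_apply, ContinuousLinearMap.adjoint_inner_left,
    stinespringRep_ι, stinespringRep_ι, inner_ι, inner_ι, star_mul, star_star, mul_assoc]

lemma stinespringRep_one : X.stinespringRep 1 = ContinuousLinearMap.id ℂ X.HA :=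
  X.clm_ext fun a ξ => by rw [stinespringRep_ι, one_mul]; rfl

lemma stinespringRep_mul (a b : X.A) :
    X.stinespringRep (a * b) = (X.stinespringRep a).comp (X.stinespringRep b) :=
  X.clm_ext fun c ξ => by
    rw [ContinuousLinearMap.comp_apply, stinespringRep_ι, stinespringRep_ι, stinespringRep_ι,
      mul_assoc]

lemma contMDiff_stinespringRep : ContMDiff 𝓘(ℂ, X.A) 𝓘(ℂ, X.HA →L[ℂ] X.HA) ω
    (fun u : X.Aˣ => X.stinespringRep u) :=
  X.stinespringRepL.contMDiff.comp (Units.contMDiff_val (𝕜 := ℂ) (R := X.A))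

lemma isHolomorphicStarRep_stinespringRep :
    IsHolomorphicStarRep (G := unitsGroup X.A) (fun u : X.Aˣ => X.stinespringRep u) where
  map_one := X.stinespringRep_one
  map_mul u v := X.stinespringRep_mul (Units.val (α := X.A) u) (Units.val (α := X.A) v)
  map_star u := X.stinespringRep_star (Units.val (α := X.A) u)
  holomorphic := X.contMDiff_stinespringRep

/-- Spectral permanence: an element of a closed unital `*`-subalgebra that is invertible in `A` is
already invertible in the subalgebra. -/
lemma inv_mem (u : X.Aˣ) (hu : (u : X.A) ∈ X.B) : ((u⁻¹ : X.Aˣ) : X.A) ∈ X.B := by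
  have : IsClosed (X.B : Set X.A) := X.isClosed_B
  have h : IsUnit (⟨u, hu⟩ : X.B) := X.B.coe_isUnit.1 u.isUnit
  obtain ⟨v, hv⟩ := h
  have h1 : ((v⁻¹ : X.Bˣ) : X.B).1 = ((u⁻¹ : X.Aˣ) : X.A) := by
    refine eq_comm.1 (Units.inv_eq_of_mul_eq_one_right ?_)
    have h2 := congrArg Subtype.val v.mul_inv
    rw [hv] at h2
    exact h2
  rw [← h1]
  exact ((v⁻¹ : X.Bˣ) : X.B).2

lemma mem_units (u : X.Aˣ) : u ∈ X.B.toSubalgebra.toSubmonoid.units ↔ (u : X.A) ∈ X.B :=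
  ⟨fun h => h.1, fun h => ⟨h, X.inv_mem u h⟩⟩

/-- `B` as a closed complemented subspace of `A`. -/
lemma closedComplemented_B : X.B.toSubalgebra.toSubmodule.ClosedComplemented := by
  have h1 : ∀ a, X.E a ∈ X.B := fun a => by
    have : X.E a ∈ Set.range X.E := ⟨a, rfl⟩
    rwa [X.range_E] at this
  refine ⟨X.E.codRestrict _ h1, ?_⟩
  rintro ⟨b, hb⟩
  have h2 : b ∈ Set.range X.E := by rw [X.range_E]; exact hb
  obtain ⟨a, rfl⟩ := h2
  exact Subtype.ext (X.E_idem a)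

/-- The chart is the inclusion of the invertibles into `A`; by spectral permanence membership in the
subgroup is membership of the value in `B`. -/
lemma exists_chart_units (u : X.Aˣ) : ∃ φ ∈ IsManifold.maximalAtlas 𝓘(ℂ, X.A) ω X.Aˣ,
    u ∈ φ.source ∧ ∀ x ∈ φ.source,
      x ∈ X.B.toSubalgebra.toSubmonoid.units ↔ φ x ∈ X.B.toSubalgebra.toSubmodule :=
  ⟨chartAt X.A u, IsManifold.chart_mem_maximalAtlas u, mem_chart_source X.A u,
    fun x _ => X.mem_units x⟩

lemma isBanachLieSubgroup_units :
    IsBanachLieSubgroup (G := unitsGroup X.A) X.B.toSubalgebra.toSubmonoid.units :=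
  ⟨X.B.toSubalgebra.toSubmodule, X.closedComplemented_B, X.isClosed_B,
    fun u _ => X.exists_chart_units u⟩

/-- The closed span of the vectors `ι b ξ`, `b ∈ B`. -/
abbrev HB : Submodule ℂ X.HA :=
  (Submodule.span ℂ {x | ∃ b ∈ X.B, ∃ ξ, X.ι b ξ = x}).topologicalClosure

variable {X} in
lemma apply_mem_HB {Y : CPos.{u}} (T : X.HA →L[ℂ] Y.HA)
    (h : ∀ b ∈ X.B, ∀ ξ, T (X.ι b ξ) ∈ Y.HB) {x : X.HA} (hx : x ∈ X.HB) : T x ∈ Y.HB := by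
  have h1 : X.HB ≤ Y.HB.comap T.toLinearMap := by
    refine Submodule.topologicalClosure_minimal _ (Submodule.span_le.2 ?_)
      ((Submodule.isClosed_topologicalClosure _).preimage T.continuous)
    rintro _ ⟨b, hb, ξ, rfl⟩
    exact h b hb ξ
  exact h1 hx

lemma ι_mem {b : X.A} (hb : b ∈ X.B) (ξ : X.H₀) : X.ι b ξ ∈ X.HB :=
  Submodule.le_topologicalClosure _ (Submodule.subset_span ⟨b, hb, ξ, rfl⟩)

lemma stinespringRep_mem {b : X.A} (hb : b ∈ X.B) {x : X.HA} (hx : x ∈ X.HB) :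
    X.stinespringRep b x ∈ X.HB := by
  refine apply_mem_HB (X.stinespringRep b) (fun c hc ξ => ?_) hx
  rw [stinespringRep_ι]
  exact X.ι_mem (mul_mem hb hc) ξ

lemma star_mem_units (u : X.Aˣ) (hu : u ∈ X.B.toSubalgebra.toSubmonoid.units) :
    star u ∈ X.B.toSubalgebra.toSubmonoid.units :=
  (X.mem_units (star u)).2 (star_mem ((X.mem_units u).1 hu))

lemma isSRep_stinespring : IsSRep X.stinespring where
  isBanachLieSubgroup := X.isBanachLieSubgroup_units
  star_mem := X.star_mem_units
  isRep := X.isHolomorphicStarRep_stinespringRep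
  isClosed_HB := (Submodule.isClosed_topologicalClosure _ : IsClosed (X.HB : Set X.HA))
  rep_mem u hu _ hx := X.stinespringRep_mem ((X.mem_units u).1 hu) hx

/-! ### Morphisms -/

/-- The matrix `(a_i^* a_j)` is positive. -/
lemma gram_nonneg {n : ℕ} (a : Fin n → X.A) :
    0 ≤ (CStarMatrix.ofMatrix (Matrix.of fun i j => star (a i) * a j) :
      CStarMatrix (Fin n) (Fin n) X.A) := by
  rcases Nat.eq_zero_or_pos n with rfl | hn
  · refine le_of_eq ?_
    ext i
    exact i.elim0
  let i₀ : Fin n := ⟨0, hn⟩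
  -- One row is `a` and the others vanish, so `star c * c` is the Gram matrix. A row exists only for
  -- `n > 0`, hence the separate empty case.
  let c : CStarMatrix (Fin n) (Fin n) X.A :=
    CStarMatrix.ofMatrix (Matrix.of fun i j => if i = i₀ then a j else 0)
  have hc : star c * c = CStarMatrix.ofMatrix (Matrix.of fun i j => star (a i) * a j) := by
    ext i j
    rw [CStarMatrix.mul_apply, Finset.sum_eq_single i₀]
    · simp [c, CStarMatrix.star_apply]
    · intro b _ hb
      simp [c, hb]
    · simp
  rw [← hc]
  exact star_mul_self_nonneg c

variable {X} {Y : CPos.{u}} (f : CPos.Hom X Y)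

/-- `α` as a bounded linear map. -/
def Hom.αL : X.A →L[ℂ] Y.A := ⟨f.α.toAlgHom.toLinearMap, map_continuous f.α⟩

/-- `α ⊗ T` on the algebraic tensor product. -/
def Hom.preMap : X.A ⊗[ℂ] X.H₀ →ₗ[ℂ] Y.A ⊗[ℂ] Y.H₀ :=
  TensorProduct.map f.α.toAlgHom.toLinearMap f.T.toLinearMap

/-- For `x = ∑ a_i ⊗ ξ_i`, the inequality in `CPos.Hom` for the positive matrix of elements `a_i^*
a_j` is this estimate, because `α` preserves products and adjoints. -/
lemma Hom.exists_form_preMap_le : ∃ M : ℝ, 0 < M ∧ ∀ x,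
    Y.form (f.preMap x) (f.preMap x) ≤ (M : ℂ) * X.form x x := by
  obtain ⟨M, hM, h⟩ := f.bound
  refine ⟨M, hM, fun x => ?_⟩
  obtain ⟨n, a, ξ, rfl⟩ := X.exists_sum x
  have h1 := h n _ (X.gram_nonneg a) ξ
  have h2 : ∀ i, f.preMap (a i ⊗ₜ[ℂ] ξ i) = f.α (a i) ⊗ₜ[ℂ] f.T (ξ i) := fun i => rfl
  simp only [map_sum, LinearMap.sum_apply, h2, form_tmul]
  rw [Finset.sum_comm, Finset.sum_comm (f := fun i j => ⟪ξ j, _⟫_ℂ)]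
  simpa only [CStarMatrix.ofMatrix_apply, Matrix.of_apply, map_mul, map_star] using h1

lemma Hom.exists_norm_preMap_le : ∃ C : ℝ, ∀ x : X.Pre,
    ‖Y.toPre (f.preMap (X.toPre.symm x))‖ ≤ C * ‖x‖ := by
  obtain ⟨M, hM, h⟩ := f.exists_form_preMap_le
  -- The constant `M` bounds squared seminorms.
  refine ⟨√M, fun x => ?_⟩
  have h1 : (X.form (X.toPre.symm x) (X.toPre.symm x)).re = ‖x‖ ^ 2 :=
    inner_self_eq_norm_sq (𝕜 := ℂ) x
  have h2 : ∀ y, (Y.form y y).re = ‖Y.toPre y‖ ^ 2 :=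
    fun y => inner_self_eq_norm_sq (𝕜 := ℂ) (Y.toPre y)
  have h3 := (Complex.le_def.1 (h (X.toPre.symm x))).1
  rw [Complex.re_ofReal_mul, h1, h2] at h3
  rw [← sq_le_sq₀ (by positivity) (by positivity), mul_pow, Real.sq_sqrt hM.le]
  exact h3

/-- `α ⊗ T` for the seminorms. -/
def Hom.preMapL : X.Pre →L[ℂ] Y.Pre :=
  (Y.toPre.toLinearMap ∘ₗ f.preMap ∘ₗ X.toPre.symm.toLinearMap).mkContinuous
    f.exists_norm_preMap_le.choose f.exists_norm_preMap_le.choose_spec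

/-- The continuous extension of `α ⊗ T`. -/
def Hom.dilate : X.HA →L[ℂ] Y.HA := f.preMapL.completion

lemma Hom.dilate_ι (a : X.A) (ξ : X.H₀) : f.dilate (X.ι a ξ) = Y.ι (f.α a) (f.T ξ) := by
  rw [Hom.dilate, ι, ContinuousLinearMap.completion_apply_coe]
  rfl

/-- The invertibles are open in the algebra, so holomorphy can be tested there, where the map is the
restriction of the bounded linear `α`. -/
lemma Hom.contMDiff_units : ContMDiff 𝓘(ℂ, X.A) 𝓘(ℂ, Y.A) ω
    (Units.map (f.α : X.A →* Y.A)) :=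
  ContMDiff.of_comp_isOpenEmbedding Units.isOpenEmbedding_val
    (f.αL.contMDiff.comp (Units.contMDiff_val (𝕜 := ℂ) (R := X.A)))

/-- The restriction of `α` to the groups of invertible elements. -/
def Hom.unitsHom : InvBanachLieGroup.Hom (unitsGroup X.A) (unitsGroup Y.A) where
  toMonoidHom := Units.map (f.α : X.A →* Y.A)
  holomorphic := f.contMDiff_units
  map_star u := Units.ext (map_star f.α (Units.val (α := X.A) u))

/-- The representation with homogeneous data attached to `Φ`. -/
def toSRep (X : CPos.{u}) : SRep.{u} := ⟨X.stinespring, X.isSRep_stinespring⟩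

lemma Hom.dilate_rep (u : X.Aˣ) : f.dilate.comp (X.stinespringRep u) =
    (Y.stinespringRep (f.α u)).comp f.dilate := X.clm_ext fun a ξ => by
  rw [ContinuousLinearMap.comp_apply, ContinuousLinearMap.comp_apply, stinespringRep_ι,
    f.dilate_ι, f.dilate_ι, stinespringRep_ι, map_mul]

lemma Hom.dilate_bound (n : ℕ) (u : Fin n → X.Aˣ) (h : Fin n → X.HA) :
    ∑ l, ∑ j, ⟪Y.stinespringRep (f.α (u j)) (f.dilate (h j)),
        Y.stinespringRep (f.α (u l)) (f.dilate (h l))⟫_ℂ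
      ≤ ((‖f.dilate‖ ^ 2 + 1 : ℝ) : ℂ) *
        ∑ l, ∑ j, ⟪X.stinespringRep (u j) (h j), X.stinespringRep (u l) (h l)⟫_ℂ := by
  have h1 : ∀ j, Y.stinespringRep (f.α (u j)) (f.dilate (h j)) =
      f.dilate (X.stinespringRep (u j) (h j)) :=
    fun j => (DFunLike.congr_fun (f.dilate_rep (u j)) (h j)).symm
  simp only [h1]
  exact sum_sum_inner_le f.dilate fun j => X.stinespringRep (u j) (h j)

/-- The morphism of representations induced by a morphism of completely positive maps. -/
def Hom.toSRep : SRep.Hom X.toSRep Y.toSRep where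
  α := f.unitsHom
  L := f.dilate
  α_mem u hu := (Y.mem_units (Units.map (f.α : X.A →* Y.A) u)).2
    (f.α_mem ((X.mem_units u).1 hu))
  L_rep u := f.dilate_rep u
  L_mem _ hx := apply_mem_HB f.dilate (fun b hb ξ => by
    rw [f.dilate_ι]
    exact Y.ι_mem (f.α_mem hb) _) hx
  bound := ⟨‖f.dilate‖ ^ 2 + 1, by positivity, f.dilate_bound⟩

lemma Hom.toSRep_id (X : CPos.{u}) : Hom.toSRep (𝟙 X : X ⟶ X) = 𝟙 X.toSRep := by
  refine SRep.Hom.ext ?_ (X.clm_ext fun a ξ => Hom.dilate_ι _ a ξ)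
  rfl

lemma Hom.toSRep_comp {X Y Z : CPos.{u}} (f : X ⟶ Y) (g : Y ⟶ Z) :
    @Eq (X.toSRep ⟶ Z.toSRep) (Hom.toSRep (f ≫ g))
      (CategoryStruct.comp (Y := Y.toSRep) (Hom.toSRep f) (Hom.toSRep g)) := by
  refine SRep.Hom.ext ?_ (X.clm_ext fun a ξ => ?_)
  · rfl
  · refine (Hom.dilate_ι _ a ξ).trans ?_
    exact ((congrArg (Hom.dilate g) (Hom.dilate_ι f a ξ)).trans (Hom.dilate_ι g _ _)).symm

theorem definesFunctor_toSRep :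
    DefinesFunctor
      (fun X : CPos.{u} => (⟨X.stinespring, X.isSRep_stinespring⟩ : SRep.{u}))
      (fun {X Y} (f : CPos.Hom X Y)
          (g : SRep.Hom ⟨X.stinespring, X.isSRep_stinespring⟩
            ⟨Y.stinespring, Y.isSRep_stinespring⟩) =>
        (∀ u : X.Aˣ, (g.α : X.Aˣ → Y.Aˣ) u = Units.map (f.α : X.A →* Y.A) u) ∧
        ∀ (a : X.A) (ξ : X.H₀), g.L (X.ι a ξ) = Y.ι (f.α a) (f.T ξ)) :=
  ⟨{ obj := toSRep
     map := Hom.toSRep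
     map_id := Hom.toSRep_id
     map_comp := Hom.toSRep_comp }, Hom.toSRep, rfl, fun f => ⟨fun _ => rfl, f.dilate_ι⟩⟩

end CPos

end PosKernel

end

theorem proposition2p8 :
    -- (i) the dilation functor from `CPos` to `SRep`
    (∃ h : ∀ X : PosKernel.CPos.{u}, PosKernel.IsSRep X.stinespring,
      PosKernel.DefinesFunctor
        (fun X : PosKernel.CPos.{u} => (⟨X.stinespring, h X⟩ : PosKernel.SRep.{u}))
        (fun {X Y} (f : PosKernel.CPos.Hom X Y)
            (g : PosKernel.SRep.Hom ⟨X.stinespring, h X⟩ ⟨Y.stinespring, h Y⟩) =>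
          (∀ u : X.Aˣ, (g.α : X.Aˣ → Y.Aˣ) u = Units.map (f.α : X.A →* Y.A) u) ∧
          ∀ (a : X.A) (ξ : X.H₀), g.L (X.ι a ξ) = Y.ι (f.α a) (f.T ξ))) ∧
    -- (ii) the functor from `SRep` to `Trans`
    (∃ geom : ∀ X : PosKernel.SRep.{u}, PosKernel.TransGeometry X.transData,
      (∀ X : PosKernel.SRep.{u}, X.IsQuotientGeometry (geom X)) ∧
      PosKernel.DefinesFunctor
        (fun X : PosKernel.SRep.{u} => (⟨X.transData, geom X⟩ : PosKernel.Trans.{u}))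
        (fun {X Y} (f : PosKernel.SRep.Hom X Y)
            (g : PosKernel.Trans.Hom ⟨X.transData, geom X⟩ ⟨Y.transData, geom Y⟩) =>
          (∀ u : X.data.GA, g.Θ.ζ (X.basePoint u) = Y.basePoint (f.α u)) ∧
          (∀ (u : X.data.GA) (x : X.data.HB),
            g.Θ.tot (X.point (u, x)) = Y.point (f.α u, ⟨f.L x, f.L_mem x x.2⟩)) ∧
          g.α = f.α ∧ g.L = f.L)) ∧
    -- (iii) the functor from `Trans` to `Kern`
    (∃ h : ∀ X : PosKernel.Trans.{u},
        PosKernel.IsReproducingKernel X.bundle (PosKernel.kernelOf X),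
      (∀ (X : PosKernel.Trans.{u}) (s t : X.data.fam.Z) (η : X.data.fam.E t)
        (ξ : X.data.fam.E (X.data.fam.inv s)),
        X.data.fam.pairing rfl (PosKernel.kernelOf X s t η) ξ
          = inner ℂ (X.data.R (X.data.fam.inv s) ξ) (X.data.R t η)) ∧
      PosKernel.DefinesFunctor
        (fun X : PosKernel.Trans.{u} =>
          (⟨X.bundle, PosKernel.kernelOf X, h X⟩ : PosKernel.Kern.{u}))
        (fun {X Y} (f : PosKernel.Trans.Hom X Y)
            (g : PosKernel.Kern.Hom ⟨X.bundle, PosKernel.kernelOf X, h X⟩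
              ⟨Y.bundle, PosKernel.kernelOf Y, h Y⟩) => g.Θ = f.Θ)) :=
  ⟨⟨PosKernel.CPos.isSRep_stinespring, PosKernel.CPos.definesFunctor_toSRep⟩,
    ⟨PosKernel.SRep.geometry, PosKernel.SRep.isQuotientGeometry,
      PosKernel.SRep.definesFunctor_toTrans⟩,
    ⟨PosKernel.Trans.isReproducingKernel_kernelOf,
      fun X _ _ η ξ => X.pairing_kernelOf rfl η ξ, PosKernel.Trans.definesFunctor_toKern⟩⟩
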